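/- Let $X$ be a smooth 4-manifold and let $E\to X$ be an $SO(3)$-bundle, i.e. an oriented rank-3 real vector bundle with a fibre metric; identify $E\cong\mathfrak{so}(E)\cong E^*$ by the cross product and the metric. Let $A$ be a metric connection in $E$ which is \emph{definite}: $F_A(u,v)\neq 0$ whenever $u,v$ are linearly independent tangent vectors. For $e\in E_x$ write $F_A(e)=\langle F_A,e\rangle\in\Lambda^2$, so that $F_A=\sum_i F_i\otimes e_i$, $F_i=F_A(e_i)$, for an orthonormal frame $e_i$ of $E$; put $\mu_A=\frac13\sum_i F_i\wedge F_i$ and let $Q(A)$ be given by $Q(A)(e,f)=\bigl(F_A(e)\wedge F_A(f)\bigr)/\mu_A$ for $e,f\in E_x$. Then: (1) There is a unique smooth Riemannian metric $g_A$ on $X$ whose volume form, for the orientation of $X$ defined by $\mu_A$, is $\mu_A$, and whose bundle $\Lambda^+_A$ of self-dual 2-forms is the image of $F_A\colon E\to\Lambda^2$. (2) $Q(A)$ is a smooth section of $S^2E$ (symmetric bilinear forms on $E$), and it is the pull-back by $F_A\colon E\to\Lambda^+_A$ of the inner product of $g_A$ on 2-forms. The connection $A$ is perfect (that is, $F_A\colon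 E\to\Lambda^+_A$ is an isometry) if and only if $Q(A)$ equals the given fibre metric of $E$; so the perfect connections are the zeros of $A\mapsto Q(A)-\langle\cdot,\cdot\rangle_E$. (3) The linearisation $\delta_AQ(a)=\frac{d}{dt}\big|_{t=0}Q(A+ta)$ exists and is a first-order linear differential operator $\Omega^1(X,E)\to\Omega^0(X,S^2_0E)$, where $S^2_0E\subset S^2E$ is the trace-free part. If $\sigma_A(\alpha)\colon\Lambda^1\otimes E\to S^2_0E$ denotes its principal symbol in the direction $\alpha\in\Lambda^1$, then at each point of $X$ and for each $\alpha\neq0$ the sequence $$0\to TX\oplus E\xrightarrow{\;S_A+w_\alpha\;}\Lambda^1\otimes E\xrightarrow{\;\sigma_A(\alpha)\;}S^2_0E\to0$$ is exact, where $S_A(u)=\iota_uF_A$ and $w_\alpha(\xi)=\alpha\otimes\xi$. (4) Let $V_A\subset\Lambda^1\otimes E$ be the orthogonal complement of the image of $S_A$, with respect to $g_A$ and the fibre metric of $E$. It is a smooth subbundle of rank 8. The operator $d_A\colon\Omega^0(X,E)\to\Omega^1(X,E)$ has a unique (formal) $L^2$-adjoint $d_A^*\colon\Omega^1(X,E)\to\Omega^0(X,E)$,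 defined by $g_A$ and the fibre metric of $E$, and the first-order operator $$D_A=\delta_AQ\oplus d_A^*\colon\Omega^0(X,V_A)\to\Omega^0(X,S^2_0E\oplus E)$$ is elliptic: its principal symbol in each direction $\alpha\ne0$ is an isomorphism $V_A\to S^2_0E\oplus E$. -/

import Mathlib

open Bundle Set MeasureTheory Module
open scoped Manifold ContDiff Topology

set_option maxSynthPendingDepth 3

namespace DefiniteConnection

/-- Model space of the base. -/
abbrev R4 : Type := EuclideanSpace ℝ (Fin 4)

/-- Model fibre of the bundle `E`. -/
abbrev R3 : Type := EuclideanSpace ℝ (Fin 3)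

noncomputable section

/-! ### Sections of vector bundles, principal symbols and ellipticity -/

section Sections

variable {X : Type*} [TopologicalSpace X] [ChartedSpace R4 X]

/-- The space `Ω⁰(V)` of smooth sections of a vector bundle `V` with model fibre `F`. -/
def smoothSections (F : Type*) [NormedAddCommGroup F] [NormedSpace ℝ F]
    (V : X → Type*) [TopologicalSpace (TotalSpace F V)]
    [∀ x, TopologicalSpace (V x)] [∀ x, AddCommGroup (V x)] [∀ x, Module ℝ (V x)]
    [FiberBundle F V] [VectorBundle ℝ F V] : Submodule ℝ (Π x, V x) where
  carrier := {s | ContMDiff (𝓡 4) ((𝓡 4).prod 𝓘(ℝ, F)) ∞ (fun x ↦ TotalSpace.mk' F x (s x))}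
  add_mem' hs ht := ContMDiff.add_section hs ht
  zero_mem' := contMDiff_zeroSection ℝ V
  smul_mem' _ _ hs := ContMDiff.const_smul_section hs

/-- The smooth sections of `V` with values in a given family of subspaces `P x ⊆ V x`. -/
def subSections (F : Type*) [NormedAddCommGroup F] [NormedSpace ℝ F]
    (V : X → Type*) [TopologicalSpace (TotalSpace F V)]
    [∀ x, TopologicalSpace (V x)] [∀ x, AddCommGroup (V x)] [∀ x, Module ℝ (V x)]
    [FiberBundle F V] [VectorBundle ℝ F V] (P : ∀ x, Submodule ℝ (V x)) :
    Submodule ℝ (Π x, P x) :=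
  (smoothSections F V).comap (LinearMap.pi fun x ↦ (P x).subtype ∘ₗ LinearMap.proj x)

/-- The inclusion of the sections of the subbundle `P` into the sections of `V`. -/
def inclSections (F : Type*) [NormedAddCommGroup F] [NormedSpace ℝ F]
    (V : X → Type*) [TopologicalSpace (TotalSpace F V)]
    [∀ x, TopologicalSpace (V x)] [∀ x, AddCommGroup (V x)] [∀ x, Module ℝ (V x)]
    [FiberBundle F V] [VectorBundle ℝ F V] (P : ∀ x, Submodule ℝ (V x)) :
    subSections F V P →ₗ[ℝ] smoothSections F V :=
  (LinearMap.pi fun x ↦ (P x).subtype ∘ₗ LinearMap.proj x).restrict (fun _ h ↦ h)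

/-- The family of subspaces `P` is a smooth subbundle of `V` of rank `k`: all `P x` have
dimension `k`, and each vector in `P x` is the value at `x` of a smooth section of `V` with values
in `P`. -/
def IsSubbundleOfRank (F : Type*) [NormedAddCommGroup F] [NormedSpace ℝ F]
    (V : X → Type*) [TopologicalSpace (TotalSpace F V)]
    [∀ x, TopologicalSpace (V x)] [∀ x, AddCommGroup (V x)] [∀ x, Module ℝ (V x)]
    [FiberBundle F V] [VectorBundle ℝ F V] (P : ∀ x, Submodule ℝ (V x)) (k : ℕ) : Prop :=
  ∀ x, finrank ℝ (P x) = k ∧ ∀ v : P x, ∃ s ∈ subSections F V P, s x = v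

/-- `D`, defined on a space `Γ` of sections of `V` and with values in sections of `W`, is a
first-order linear differential operator with principal symbol `σ`:
`D (f s) (x) = σ_x (df_x) (s x)` for all smooth `f` vanishing at `x` and all sections `s`.
(As `σ_x` is linear in `df_x`, this makes `D s (x)` depend on the 1-jet of `s` at `x` only.) -/
def HasPrincipalSymbol {V W : X → Type*} [∀ x, AddCommGroup (V x)] [∀ x, Module ℝ (V x)]
    [∀ x, AddCommGroup (W x)] [∀ x, Module ℝ (W x)]
    {Γ : Submodule ℝ (Π x, V x)} (D : Γ →ₗ[ℝ] (Π x, W x))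
    (σ : ∀ x, (TangentSpace (𝓡 4) x →L[ℝ] ℝ) →ₗ[ℝ] V x →ₗ[ℝ] W x) : Prop :=
  ∀ (x : X) (f : X → ℝ), ContMDiff (𝓡 4) 𝓘(ℝ, ℝ) ∞ f → f x = 0 →
    ∀ s t : Γ, (∀ y, (t : Π x, V x) y = f y • (s : Π x, V x) y) →
      D t x = σ x (mvfderiv (𝓡 4) f x) ((s : Π x, V x) x)

/-- A first-order linear differential operator is elliptic if its principal symbol in each
non-zero direction `α` is an isomorphism `V x ≅ W x`. -/
def IsElliptic {V W : X → Type*} [∀ x, AddCommGroup (V x)] [∀ x, Module ℝ (V x)]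
    [∀ x, AddCommGroup (W x)] [∀ x, Module ℝ (W x)]
    {Γ : Submodule ℝ (Π x, V x)} (D : Γ →ₗ[ℝ] (Π x, W x)) : Prop :=
  ∃ σ : ∀ x, (TangentSpace (𝓡 4) x →L[ℝ] ℝ) →ₗ[ℝ] V x →ₗ[ℝ] W x,
    HasPrincipalSymbol D σ ∧ ∀ x α, α ≠ 0 → Function.Bijective (σ x α)

end Sections

/-! ### Linear algebra of forms on a tangent space -/

section Forms

variable {X : Type*} [TopologicalSpace X] [ChartedSpace R4 X]

/-- The basis `∂₀, …, ∂₃` of `T_x X` given by the preferred chart at `x`. -/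
def tangentBasis (x : X) (i : Fin 4) : TangentSpace (𝓡 4) x :=
  (EuclideanSpace.single i (1 : ℝ) : R4)

/-- The dual basis of `tangentBasis`. -/
def tangentCoord (x : X) (i : Fin 4) : TangentSpace (𝓡 4) x →L[ℝ] ℝ :=
  (EuclideanSpace.proj i : R4 →L[ℝ] ℝ)

/-- Bilinear forms on `T_x X`; the 2-forms are the alternating ones. -/
abbrev TangentBilin (x : X) : Type := TangentSpace (𝓡 4) x →L[ℝ] TangentSpace (𝓡 4) x →L[ℝ] ℝ

/-- The bilinear map on `T_x X` with the values `c i j` on the basis vectors `∂ᵢ, ∂ⱼ`. -/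
def bilinOfBasis {G : Type*} [AddCommGroup G] [Module ℝ G] [TopologicalSpace G]
    [IsTopologicalAddGroup G] [ContinuousSMul ℝ G] (x : X) (c : Fin 4 → Fin 4 → G) :
    TangentSpace (𝓡 4) x →L[ℝ] TangentSpace (𝓡 4) x →L[ℝ] G :=
  ∑ i, ∑ j, (tangentCoord x i).smulRight ((tangentCoord x j).smulRight (c i j))

/-- The wedge product of two 2-forms on `T_x X`, a 4-form on `T_x X`; a 4-form is represented
by its value on `(∂₀, ∂₁, ∂₂, ∂₃)`. -/
def wedge {x : X} (θ η : TangentBilin x) : ℝ :=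
  let b := tangentBasis x
  θ (b 0) (b 1) * η (b 2) (b 3) - θ (b 0) (b 2) * η (b 1) (b 3) + θ (b 0) (b 3) * η (b 1) (b 2)
    + θ (b 1) (b 2) * η (b 0) (b 3) - θ (b 1) (b 3) * η (b 0) (b 2) + θ (b 2) (b 3) * η (b 0) (b 1)

/-- The Gram matrix of an inner product on `T_x X` in a family of four vectors. -/
def gram {x : X} (g : TangentBilin x) (b : Fin 4 → TangentSpace (𝓡 4) x) :
    Matrix (Fin 4) (Fin 4) ℝ :=
  Matrix.of fun i j ↦ g (b i) (b j)

/-- The inner product of two 2-forms on `T_x X` defined by the inner product `g`, normalised such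
that `eⁱ ∧ eʲ`, `i < j`, are orthonormal if the `eⁱ` are. -/
def twoFormInner {x : X} (g θ η : TangentBilin x) : ℝ :=
  let b := tangentBasis x
  let G := (gram g b)⁻¹
  (1 / 2) * ∑ i, ∑ j, ∑ k, ∑ l, G i k * G j l * θ (b i) (b j) * η (b k) (b l)

/-- The self-dual 2-forms on `T_x X` for the inner product `g` and the volume form `ν`:
those alternating `θ` with `η ∧ θ = (η, θ)_g ν` for all 2-forms `η` (that is, `*θ = θ`). -/
def selfDualForms {x : X} (g : TangentBilin x) (ν : ℝ) : Submodule ℝ (TangentBilin x) where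
  carrier := {θ | (∀ v, θ v v = 0) ∧
    ∀ η : TangentBilin x, (∀ v, η v v = 0) → wedge η θ = twoFormInner g η θ * ν}
  add_mem' := by
    rintro θ θ' ⟨h1, h2⟩ ⟨h1', h2'⟩
    refine ⟨fun v ↦ by simp [h1, h1'], fun η hη ↦ ?_⟩
    have e1 : wedge η (θ + θ') = wedge η θ + wedge η θ' := by
      simp only [wedge, _root_.add_apply]; ring
    have e2 : twoFormInner g η (θ + θ') = twoFormInner g η θ + twoFormInner g η θ' := by
      simp only [twoFormInner, _root_.add_apply, mul_add, Finset.sum_add_distrib]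
    rw [e1, e2, h2 η hη, h2' η hη]; ring
  zero_mem' := by
    refine ⟨fun v ↦ by simp, fun η _ ↦ ?_⟩
    simp [wedge, twoFormInner]
  smul_mem' := by
    rintro c θ ⟨h1, h2⟩
    refine ⟨fun v ↦ by simp [h1], fun η hη ↦ ?_⟩
    have e1 : wedge η (c • θ) = c * wedge η θ := by
      simp only [wedge, _root_.smul_apply, smul_eq_mul]; ring
    have e2 : twoFormInner g η (c • θ) = c * twoFormInner g η θ := by
      simp only [twoFormInner, _root_.smul_apply, smul_eq_mul, Finset.mul_sum]
      refine Finset.sum_congr rfl fun i _ ↦ Finset.sum_congr rfl fun j _ ↦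
        Finset.sum_congr rfl fun k _ ↦ Finset.sum_congr rfl fun l _ ↦ by ring
    rw [e1, e2, h2 η hη]; ring

/-- The inner product on `T*_x X ⊗ E_x = Hom(T_x X, E_x)` defined by the inner product `g` on
`T_x X` and the given one on `E_x`. -/
def oneFormInner {x : X} {G : Type*} [NormedAddCommGroup G] [InnerProductSpace ℝ G]
    (g : TangentBilin x) (a b : TangentSpace (𝓡 4) x →L[ℝ] G) : ℝ :=
  ∑ i, ∑ j, (gram g (tangentBasis x))⁻¹ i j * inner ℝ (a (tangentBasis x i)) (b (tangentBasis x j))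

end Forms

/-! ### The Riemannian volume measure -/

section Volume

variable {X : Type*} [TopologicalSpace X] [ChartedSpace R4 X] [IsManifold (𝓡 4) ∞ X]

/-- The Riemannian volume measure on the domain of the preferred chart `φ` at `x₀`,
extended by zero to `X`: the image under `φ⁻¹` of `√det(g(∂ᵢ, ∂ⱼ)) dy` on the target of `φ`. -/
def chartVolume [MeasurableSpace X]
    (g : ContMDiffRiemannianMetric (𝓡 4) ∞ R4 (TangentSpace (𝓡 4) : X → Type _)) (x₀ : X) :
    Measure X :=
  let φ := chartAt R4 x₀
  Measure.map φ.symm ((volume.restrict φ.target).withDensity fun y ↦ ENNReal.ofReal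
    (Real.sqrt (gram (g.inner (φ.symm y))
      (fun i ↦ mfderiv 𝓘(ℝ, R4) (𝓡 4) φ.symm y (EuclideanSpace.single i (1 : ℝ)))).det))

/-- The Riemannian volume measure of `g`. The measures `chartVolume g x₀` agree on overlaps of
chart domains, and their supremum is the measure that restricts to each of them. -/
def riemannianVolume [MeasurableSpace X]
    (g : ContMDiffRiemannianMetric (𝓡 4) ∞ R4 (TangentSpace (𝓡 4) : X → Type _)) : Measure X :=
  ⨆ x₀ : X, chartVolume g x₀

end Volume

/-! ### Connections in `SO(3)`-bundles -/

section Bundle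

variable {X : Type*} [TopologicalSpace X] [ChartedSpace R4 X] [IsManifold (𝓡 4) ∞ X]
  {E : X → Type*} [TopologicalSpace (TotalSpace R3 E)]
  [∀ x, NormedAddCommGroup (E x)] [∀ x, InnerProductSpace ℝ (E x)]
  [FiberBundle R3 E] [VectorBundle ℝ R3 E]

/-- `Λ¹ ⊗ E`, as the bundle `Hom(TX, E)`. -/
abbrev OneForm (E : X → Type*) [∀ x, NormedAddCommGroup (E x)] [∀ x, InnerProductSpace ℝ (E x)]
    (x : X) : Type _ := TangentSpace (𝓡 4) x →L[ℝ] E x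

/-- Bilinear forms on the fibres of `E`. -/
abbrev FibreBilin (E : X → Type*) [∀ x, NormedAddCommGroup (E x)]
    [∀ x, InnerProductSpace ℝ (E x)] (x : X) : Type _ := E x →L[ℝ] E x →L[ℝ] ℝ

variable (E) in
/-- A smooth orientation of the rank-3 Riemannian vector bundle `E`, given by its unit volume form;
together with the fibre metric it makes `E` an `SO(3)`-bundle. -/
structure FibreOrientation where
  form : ∀ x, E x [⋀^Fin 3]→ₗ[ℝ] ℝ
  abs_form_eq_one : ∀ x (b : OrthonormalBasis (Fin 3) ℝ (E x)), |form x b| = 1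
  contMDiff : ∀ s₀ ∈ smoothSections R3 E, ∀ s₁ ∈ smoothSections R3 E, ∀ s₂ ∈ smoothSections R3 E,
    ContMDiff (𝓡 4) 𝓘(ℝ, ℝ) ∞ (fun x ↦ form x ![s₀ x, s₁ x, s₂ x])

namespace FibreOrientation

variable (o : FibreOrientation E)

/-- The cross product on `E_x`: `⟨v × w, z⟩ = form (v, w, z)`. -/
def cross (x : X) : E x →L[ℝ] E x →L[ℝ] E x :=
  haveI : FiniteDimensional ℝ (E x) := VectorBundle.finiteDimensional ℝ R3 E x
  (LinearMap.mk₂ ℝ (fun v w ↦ ∑ i, o.form x ![v, w, stdOrthonormalBasis ℝ (E x) i] •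
      stdOrthonormalBasis ℝ (E x) i)
    (fun v v' w ↦ by
      rw [← Finset.sum_add_distrib]
      refine Finset.sum_congr rfl fun i _ ↦ ?_
      rw [← add_smul]; congr 1
      simpa using (o.form x).map_vecCons_add ![w, stdOrthonormalBasis ℝ (E x) i] v v')
    (fun c v w ↦ by
      rw [Finset.smul_sum]
      refine Finset.sum_congr rfl fun i _ ↦ ?_
      rw [smul_smul]; congr 1
      simpa using (o.form x).map_vecCons_smul ![w, stdOrthonormalBasis ℝ (E x) i] c v)
    (fun v w w' ↦ by
      rw [← Finset.sum_add_distrib]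
      refine Finset.sum_congr rfl fun i _ ↦ ?_
      rw [← add_smul]; congr 1
      have hu (z : E x) : Function.update ![v, w, stdOrthonormalBasis ℝ (E x) i] 1 z =
          ![v, z, stdOrthonormalBasis ℝ (E x) i] := by
        ext j; fin_cases j <;> simp
      have h := (o.form x).map_update_add ![v, w, stdOrthonormalBasis ℝ (E x) i] 1 w w'
      rwa [hu, hu, hu] at h)
    (fun c v w ↦ by
      rw [Finset.smul_sum]
      refine Finset.sum_congr rfl fun i _ ↦ ?_
      rw [smul_smul]; congr 1
      have hu (z : E x) : Function.update ![v, w, stdOrthonormalBasis ℝ (E x) i] 1 z =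
          ![v, z, stdOrthonormalBasis ℝ (E x) i] := by
        ext j; fin_cases j <;> simp
      have h := (o.form x).map_update_smul ![v, w, stdOrthonormalBasis ℝ (E x) i] 1 c w
      rwa [hu, hu] at h)).toContinuousBilinearMap

/-- The inverse of the isomorphism `E_x ≅ so(E_x)`, `ξ ↦ (s ↦ ξ × s)`, applied to the
skew-adjoint endomorphism `φ` of `E_x`. -/
def axial {x : X} (φ : E x → E x) : E x :=
  haveI : FiniteDimensional ℝ (E x) := VectorBundle.finiteDimensional ℝ R3 E x
  (1 / 2 : ℝ) • ∑ i, o.cross x (stdOrthonormalBasis ℝ (E x) i) (φ (stdOrthonormalBasis ℝ (E x) i))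

end FibreOrientation

/-- The curvature endomorphism `[∇_U, ∇_V] s - ∇_[U,V] s` at `x`, for the vector fields `U`, `V`
and the section `s` extending the given `u, v ∈ T_x X` and `s ∈ E_x`. -/
def curvatureEndo (A : CovariantDerivative (𝓡 4) R3 E) {x : X} (u v : TangentSpace (𝓡 4) x)
    (s : E x) : E x :=
  let U : Π y : X, TangentSpace (𝓡 4) y := FiberBundle.extend R4 u
  let V : Π y : X, TangentSpace (𝓡 4) y := FiberBundle.extend R4 v
  let S : Π y : X, E y := FiberBundle.extend R3 s
  A (fun y ↦ A S y (V y)) x (U x) - A (fun y ↦ A S y (U y)) x (V x)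
    - A S x (VectorField.mlieBracket (𝓡 4) U V x)

variable (o : FibreOrientation E) (A : CovariantDerivative (𝓡 4) R3 E)

/-- The curvature `F_A ∈ Λ² ⊗ so(E) ≅ Λ² ⊗ E` at `x`, as a bilinear map on `T_x X`. It is tensorial,
hence determined by its values on the basis vectors. -/
def curvature (x : X) : TangentSpace (𝓡 4) x →L[ℝ] TangentSpace (𝓡 4) x →L[ℝ] E x :=
  bilinOfBasis x fun i j ↦ o.axial (curvatureEndo A (tangentBasis x i) (tangentBasis x j))

/-- The curvature as a homomorphism `F_A : E_x → Λ²`, `F_A(e)(u, v) = ⟨F_A(u, v), e⟩`. -/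
def curvatureForm (x : X) : E x →ₗ[ℝ] TangentBilin x where
  toFun e := bilinOfBasis x fun i j ↦
    inner ℝ (curvature o A x (tangentBasis x i) (tangentBasis x j)) e
  map_add' e f := by
    ext u v
    simp [bilinOfBasis, inner_add_right, mul_add, Finset.sum_add_distrib]
  map_smul' c e := by
    ext u v
    simp [bilinOfBasis, inner_smul_right, Finset.mul_sum]
    refine Finset.sum_congr rfl fun i _ ↦ Finset.sum_congr rfl fun j _ ↦ by ring

/-- A connection is definite if its curvature is non-zero on every tangent 2-plane. -/
def IsDefinite : Prop :=
  ∀ (x : X) (u v : TangentSpace (𝓡 4) x), LinearIndependent ℝ ![u, v] → curvature o A x u v ≠ 0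

/-- The 4-form `μ_A = ⅓ ∑ Fᵢ ∧ Fᵢ` at `x`, where `F_A = ∑ Fᵢ ⊗ eᵢ` for an orthonormal basis `eᵢ`
of `E_x`. -/
def volumeForm (x : X) : ℝ :=
  haveI : FiniteDimensional ℝ (E x) := VectorBundle.finiteDimensional ℝ R3 E x
  (1 / 3) * ∑ i, wedge (curvatureForm o A x (stdOrthonormalBasis ℝ (E x) i))
    (curvatureForm o A x (stdOrthonormalBasis ℝ (E x) i))

/-- `Q(A)(e, f) = (F_A(e) ∧ F_A(f)) / μ_A`. -/
def Q (x : X) (e f : E x) : ℝ :=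
  wedge (curvatureForm o A x e) (curvatureForm o A x f) / volumeForm o A x

/-- `g` is the Riemannian metric `g_A` determined by the definite connection `A`: its volume form,
for the orientation of `X` given by `μ_A`, is `μ_A`, and its bundle of self-dual 2-forms `Λ⁺_A` is
the image of `F_A : E → Λ²`. -/
def IsAssociatedMetric
    (g : ContMDiffRiemannianMetric (𝓡 4) ∞ R4 (TangentSpace (𝓡 4) : X → Type _)) : Prop :=
  ∀ x, |volumeForm o A x| = Real.sqrt (gram (g.inner x) (tangentBasis x)).det ∧
    LinearMap.range (curvatureForm o A x) = selfDualForms (g.inner x) (volumeForm o A x)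

/-- `A` is perfect if `F_A : E → Λ⁺_A` is an isometry. -/
def IsPerfect
    (g : ContMDiffRiemannianMetric (𝓡 4) ∞ R4 (TangentSpace (𝓡 4) : X → Type _)) : Prop :=
  ∀ (x : X) (e f : E x),
    twoFormInner (g.inner x) (curvatureForm o A x e) (curvatureForm o A x f) = inner ℝ e f

variable (E) in
/-- `S²E`: symmetric bilinear forms on `E_x`. -/
def symForms (x : X) : Submodule ℝ (FibreBilin E x) where
  carrier := {B | ∀ e f, B e f = B f e}
  add_mem' := fun {B C} hB hC e f ↦ by simp [hB e f, hC e f]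
  zero_mem' := fun e f ↦ by simp
  smul_mem' := fun c B hB e f ↦ by simp [hB e f]

variable (E) in
/-- `S²₀E`: trace-free symmetric bilinear forms on `E_x`. -/
def traceFreeSymForms (x : X) : Submodule ℝ (FibreBilin E x) where
  carrier := {B | (∀ e f, B e f = B f e) ∧
    ∀ b : OrthonormalBasis (Fin 3) ℝ (E x), ∑ i, B (b i) (b i) = 0}
  add_mem' := fun {B C} hB hC ↦ ⟨fun e f ↦ by simp [hB.1 e f, hC.1 e f], fun b ↦ by
    simp [Finset.sum_add_distrib, hB.2 b, hC.2 b]⟩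
  zero_mem' := ⟨fun e f ↦ by simp, fun b ↦ by simp⟩
  smul_mem' := fun c B hB ↦ ⟨fun e f ↦ by simp [hB.1 e f], fun b ↦ by
    simp [← Finset.mul_sum, hB.2 b]⟩

instance (x : X) : AddCommGroup (symForms E x) := Submodule.addCommGroup _
instance (x : X) : Module ℝ (symForms E x) := Submodule.module _
instance (x : X) : AddCommGroup (traceFreeSymForms E x) := Submodule.addCommGroup _
instance (x : X) : Module ℝ (traceFreeSymForms E x) := Submodule.module _

instance (x : X) : AddCommGroup (traceFreeSymForms E x × E x) := Prod.instAddCommGroup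
instance (x : X) : Module ℝ (traceFreeSymForms E x × E x) := Prod.instModule

/-- The connection `A + a`, for a 1-form `a` with values in `E ≅ so(E)`. -/
def addForm (a : Π x : X, OneForm E x) : CovariantDerivative (𝓡 4) R3 E :=
  A.addOneForm fun x ↦
    haveI : FiniteDimensional ℝ (E x) := VectorBundle.finiteDimensional ℝ R3 E x
    LinearMap.toContinuousLinearMap
      { toFun := fun s ↦ ((o.cross x).flip s).comp (a x)
        map_add' := fun s t ↦ by ext u; simp
        map_smul' := fun c s ↦ by ext u; simp }

/-- The map `S_A + w_α : T_x X ⊕ E_x → Λ¹ ⊗ E`, `(u, ξ) ↦ ι_u F_A + α ⊗ ξ`. -/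
def gaugeSymbol (x : X) (α : TangentSpace (𝓡 4) x →L[ℝ] ℝ) :
    (TangentSpace (𝓡 4) x × E x) →ₗ[ℝ] OneForm E x where
  toFun p := curvature o A x p.1 + α.smulRight p.2
  map_add' p q := by
    ext u
    simp only [Prod.fst_add, Prod.snd_add, map_add, _root_.add_apply,
      ContinuousLinearMap.smulRight_apply, smul_add]
    abel
  map_smul' c p := by
    ext u
    simp only [Prod.smul_fst, Prod.smul_snd, map_smul, _root_.add_apply, _root_.smul_apply,
      ContinuousLinearMap.smulRight_apply, smul_add, RingHom.id_apply]
    rw [smul_comm]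

/-- `V_A ⊆ Λ¹ ⊗ E`, the orthogonal complement of the forms `ι_u F_A`, `u ∈ T_x X`. -/
def gaugeFixedForms
    (g : ContMDiffRiemannianMetric (𝓡 4) ∞ R4 (TangentSpace (𝓡 4) : X → Type _)) (x : X) :
    Submodule ℝ (OneForm E x) where
  carrier := {a | ∀ u, oneFormInner (g.inner x) a (curvature o A x u) = 0}
  add_mem' := fun {a b} ha hb u ↦ by
    have : oneFormInner (g.inner x) (a + b) (curvature o A x u) =
        oneFormInner (g.inner x) a (curvature o A x u)
          + oneFormInner (g.inner x) b (curvature o A x u) := by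
      simp only [oneFormInner, _root_.add_apply, inner_add_left, mul_add,
        Finset.sum_add_distrib]
    rw [this, ha u, hb u, add_zero]
  zero_mem' := fun u ↦ by simp [oneFormInner]
  smul_mem' := fun c a ha u ↦ by
    have : oneFormInner (g.inner x) (c • a) (curvature o A x u) =
        c * oneFormInner (g.inner x) a (curvature o A x u) := by
      simp only [oneFormInner, _root_.smul_apply, real_inner_smul_left,
        Finset.mul_sum]
      refine Finset.sum_congr rfl fun i _ ↦ Finset.sum_congr rfl fun j _ ↦ by ring
    rw [this, ha u, mul_zero]

variable [ContMDiffVectorBundle ∞ R3 E (𝓡 4)]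

variable (E) in
/-- `Ω¹(X, E) = Ω⁰(X, Λ¹ ⊗ E)`. -/
abbrev OneForms : Submodule ℝ (Π x : X, OneForm E x) := smoothSections (R4 →L[ℝ] R3) (OneForm E)

variable (E) in
/-- `Ω⁰(X, S²E)`. -/
abbrev SymSections : Submodule ℝ (Π x : X, symForms E x) :=
  subSections (R3 →L[ℝ] R3 →L[ℝ] ℝ) (FibreBilin E) (symForms E)

variable (E) in
/-- `Ω⁰(X, S²₀E)`. -/
abbrev TraceFreeSymSections : Submodule ℝ (Π x : X, traceFreeSymForms E x) :=
  subSections (R3 →L[ℝ] R3 →L[ℝ] ℝ) (FibreBilin E) (traceFreeSymForms E)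

/-- `dQ` is the linearisation `δ_A Q` of `Q` at `A`. -/
def IsLinearisation (dQ : OneForms E →ₗ[ℝ] TraceFreeSymSections E) : Prop :=
  ∀ (a : OneForms E) (x : X) (e f : E x),
    HasDerivAt (fun t : ℝ ↦ Q o (addForm o A (t • (a : Π x, OneForm E x))) x e f)
      (((dQ a : Π x, traceFreeSymForms E x) x : FibreBilin E x) e f) 0

/-- `dStar` is the `L²`-adjoint `d_A^* : Ω¹(X, E) → Ω⁰(X, E)` of `d_A : Ω⁰(X, E) → Ω¹(X, E)`, for the
metric `g` on `X` and the fibre metric of `E`: `∫ (d_A ξ, a) = ∫ (ξ, d_A^* a)` for all `a` and all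
compactly supported `ξ`. -/
def IsL2Adjoint [MeasurableSpace X]
    (g : ContMDiffRiemannianMetric (𝓡 4) ∞ R4 (TangentSpace (𝓡 4) : X → Type _))
    (dStar : OneForms E →ₗ[ℝ] smoothSections R3 E) : Prop :=
  ∀ (a : OneForms E) (ξ : smoothSections R3 E),
    IsCompact (closure {x | (ξ : Π x, E x) x ≠ 0}) →
    ∫ x, oneFormInner (g.inner x) (A (ξ : Π x, E x) x) ((a : Π x, OneForm E x) x)
        ∂(riemannianVolume g) =
      ∫ x, inner ℝ ((ξ : Π x, E x) x) ((dStar a : Π x, E x) x) ∂(riemannianVolume g)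

/-- The operator `D_A = δ_A Q ⊕ d_A^* : Ω⁰(X, V_A) → Ω⁰(X, S²₀E ⊕ E)`. -/
def gaugeFixedOperator
    (g : ContMDiffRiemannianMetric (𝓡 4) ∞ R4 (TangentSpace (𝓡 4) : X → Type _))
    (dQ : OneForms E →ₗ[ℝ] TraceFreeSymSections E) (dStar : OneForms E →ₗ[ℝ] smoothSections R3 E) :
    subSections (R4 →L[ℝ] R3) (OneForm E) (gaugeFixedForms o A g) →ₗ[ℝ]
      (Π x : X, traceFreeSymForms E x × E x) :=
  LinearMap.pi fun x ↦
    ((LinearMap.proj x ∘ₗ (TraceFreeSymSections E).subtype ∘ₗ dQ).prod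
      (LinearMap.proj x ∘ₗ (smoothSections R3 E).subtype ∘ₗ dStar)) ∘ₗ
      inclSections (R4 →L[ℝ] R3) (OneForm E) (gaugeFixedForms o A g)

end Bundle

end

end DefiniteConnection

/-!
The curvature of a connection in an `SO(3)`-bundle is a tensor `F_A ∈ Λ² ⊗ E`. Everything else is
linear algebra at a point, smoothness in local frames, and one integration by parts.

*The metric.* If `A` is definite and `u ≠ 0`, then `v ↦ F_A(u, v)` maps `T_x X` onto the fibre of
`E` with kernel `ℝ u`. A 2-form with vanishing square has a non-zero kernel vector, so
`F_A(e) ∧ F_A(e) ≠ 0` for `e ≠ 0`. Choosing preimages under `v ↦ F_A(u, v)` of a frame for which the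
forms `F_A(fᵢ)` are orthogonal, and correcting them by multiples of `u`, gives a basis of `T_x X` in
which the image of `F_A` consists of the self-dual forms and `μ_A` is the volume form
(`IsDefiniteMap.exists_selfDual_basis`); declaring it orthonormal defines `g_A`. Urbantke's formula
(`urbantke_eq_metric`) expresses any such metric by `∑ sgn(ijk) (ι_u Fᵢ ∧ ι_v Fⱼ) ∧ Fₖ`, so that
`g_A` is unique and smooth.

*The linearisation.* As `F_{A+ta} = F_A + t d_A a + t² [a, a]/2`, the derivative of `Q` is obtained
from the derivative of `F ↦ (F(e) ∧ F(f)) / μ`, evaluated on `d_A a` (`QVar`, `curvatureVar`). Its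
symbol replaces `d_A a` by `α ∧ a`. It kills `α ⊗ ξ`, because `α ∧ α = 0`, and `ι_u F_A`, because
the contraction of the 5-form `α ∧ F(e) ∧ F(f)` with `u` vanishes, which leaves a multiple of `Q(A)`
with zero trace-free part. It is onto because `α ∧ F_A(f) ≠ 0` for `f ≠ 0`. Exactness in the middle
then follows from `12 = (4 + 3) + 5`.

*The adjoint.* In a chart, `d_A^* a = -(1/√g) ∑ ∇ᵢ(√g gⁱʲ aⱼ)`; a partition of unity patches these
operators together (`covDerivAdjoint`). The adjunction formula is the divergence theorem for a
compactly supported vector field in a chart, once the Riemannian volume is known to restrict to the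
coordinate volume of each chart (`riemannianVolume_restrict`). The symbol of `d_A^*` at `α` is minus
the contraction with `α`.

*Ellipticity.* An element of `V_A` killed by the symbol of `δ_A Q` is of the form `ι_u F_A + α ⊗ ξ`.
It is orthogonal to the first summand by definition of `V_A`, and to the second if it is killed by
the symbol of `d_A^*`; so it vanishes, and `8 = 5 + 3` gives bijectivity.
-/
set_option linter.unusedSectionVars false

namespace DefiniteConnection

noncomputable section

/-! ### Smooth sections and local frames -/

section SectionTools

variable {X : Type*} [TopologicalSpace X] [ChartedSpace R4 X] [IsManifold (𝓡 4) ∞ X]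
  {F : Type*} [NormedAddCommGroup F] [NormedSpace ℝ F]
  {V : X → Type*} [TopologicalSpace (TotalSpace F V)]
  [∀ x, TopologicalSpace (V x)] [∀ x, AddCommGroup (V x)] [∀ x, Module ℝ (V x)]
  [FiberBundle F V] [VectorBundle ℝ F V]

lemma mem_smoothSections {s : Π x, V x} : s ∈ smoothSections F V ↔
    ContMDiff (𝓡 4) ((𝓡 4).prod 𝓘(ℝ, F)) ∞ (fun x ↦ TotalSpace.mk' F x (s x)) := Iff.rfl

lemma smul_mem_smoothSections {f : X → ℝ} (hf : ContMDiff (𝓡 4) 𝓘(ℝ, ℝ) ∞ f)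
    {s : Π x, V x} (hs : s ∈ smoothSections F V) : (fun x ↦ f x • s x) ∈ smoothSections F V :=
  ContMDiff.smul_section hf hs

/-- Away from the support of a cutoff function only local smoothness of the section is needed. -/
lemma smul_mem_smoothSections_of_tsupport {f : X → ℝ} (hf : ContMDiff (𝓡 4) 𝓘(ℝ, ℝ) ∞ f)
    {u : Set X} (hu : IsOpen u) (hfu : tsupport f ⊆ u) {s : Π x, V x}
    (hs : ContMDiffOn (𝓡 4) ((𝓡 4).prod 𝓘(ℝ, F)) ∞ (fun x ↦ TotalSpace.mk' F x (s x)) u) :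
    (fun x ↦ f x • s x) ∈ smoothSections F V :=
  ContMDiffOn.smul_section_of_tsupport hf.contMDiffOn hu hfu hs

lemma exists_cutoff [T2Space X] {x₀ : X} {u : Set X} (hu : u ∈ 𝓝 x₀) :
    ∃ f : X → ℝ, ContMDiff (𝓡 4) 𝓘(ℝ, ℝ) ∞ f ∧ tsupport f ⊆ u ∧ HasCompactSupport f ∧
      (∀ x, 0 ≤ f x) ∧ ∀ᶠ x in 𝓝 x₀, f x = 1 := by
  obtain ⟨f, -, hf⟩ := (SmoothBumpFunction.nhds_basis_tsupport (I := 𝓡 4) x₀).mem_iff.1 hu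
  exact ⟨f, f.contMDiff, hf, f.hasCompactSupport, fun x ↦ f.nonneg, f.eventuallyEq_one⟩

/-- A section which is smooth near `x₀` has the same germ at `x₀` as a global smooth section. -/
lemma exists_smoothSection_eventuallyEq [T2Space X] {x₀ : X} {u : Set X} (hu : u ∈ 𝓝 x₀)
    {s : Π x, V x}
    (hs : ContMDiffOn (𝓡 4) ((𝓡 4).prod 𝓘(ℝ, F)) ∞ (fun x ↦ TotalSpace.mk' F x (s x)) u) :
    ∃ s' ∈ smoothSections F V, ∀ᶠ x in 𝓝 x₀, s' x = s x := by
  obtain ⟨f, hf, hfu, -, -, h1⟩ := exists_cutoff (x₀ := x₀) (interior_mem_nhds.2 hu)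
  refine ⟨_, smul_mem_smoothSections_of_tsupport hf isOpen_interior hfu
    (hs.mono interior_subset), ?_⟩
  filter_upwards [h1] with x hx
  simp [hx]

/-- A trivialization provides a frame of `V` near `x₀` by global smooth sections. -/
lemma exists_frame_localFrame [T2Space X] [ContMDiffVectorBundle ∞ F V (𝓡 4)] {ι : Type*}
    [Finite ι] (b : Basis ι ℝ F) (x₀ : X) :
    ∃ s : ι → Π x, V x, (∀ i, s i ∈ smoothSections F V) ∧
      ∀ᶠ x in 𝓝 x₀, x ∈ (trivializationAt F V x₀).baseSet ∧
        ∀ i, s i x = (trivializationAt F V x₀).localFrame b i x := by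
  have hb : (trivializationAt F V x₀).baseSet ∈ 𝓝 x₀ :=
    (trivializationAt F V x₀).open_baseSet.mem_nhds (mem_baseSet_trivializationAt F V x₀)
  choose s hs hs' using fun i ↦ exists_smoothSection_eventuallyEq hb
    ((trivializationAt F V x₀).contMDiffOn_localFrame_baseSet (I := 𝓡 4) ∞ b i)
  exact ⟨s, hs, (Filter.eventually_of_mem hb fun _ h ↦ h).and (Filter.eventually_all.2 hs')⟩

lemma exists_frame [T2Space X] [ContMDiffVectorBundle ∞ F V (𝓡 4)] {ι : Type*}
    [Finite ι] (b : Basis ι ℝ F) (x₀ : X) :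
    ∃ s : ι → Π x, V x, (∀ i, s i ∈ smoothSections F V) ∧
      ∀ᶠ x in 𝓝 x₀, LinearIndependent ℝ (fun i ↦ s i x) ∧
        ⊤ ≤ Submodule.span ℝ (Set.range fun i ↦ s i x) := by
  obtain ⟨s, hs, h⟩ := exists_frame_localFrame (V := V) b x₀
  refine ⟨s, hs, ?_⟩
  filter_upwards [h] with x hx
  have hf := (trivializationAt F V x₀).isLocalFrameOn_localFrame_baseSet (𝓡 4) ∞ b
  have : (fun i ↦ s i x) = fun i ↦ (trivializationAt F V x₀).localFrame b i x := funext hx.2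
  rw [this]
  exact ⟨hf.linearIndependent hx.1, hf.generating hx.1⟩

lemma exists_smoothSection_apply_eq [T2Space X] [ContMDiffVectorBundle ∞ F V (𝓡 4)] {x₀ : X}
    (v : V x₀) : ∃ s ∈ smoothSections F V, s x₀ = v := by
  obtain ⟨u, hu, hs⟩ := FiberBundle.exists_contMDiffOn_extend (𝓡 4) F (k := ∞) v
  obtain ⟨s, hs, h⟩ := exists_smoothSection_eventuallyEq hu hs
  exact ⟨s, hs, by rw [h.self_of_nhds, FiberBundle.extend_apply_self]⟩

lemma contMDiffAt_section_trivial_iff {f : X → F} {x₀ : X} :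
    ContMDiffAt (𝓡 4) ((𝓡 4).prod 𝓘(ℝ, F)) ∞
      (fun x ↦ TotalSpace.mk' F (E := Bundle.Trivial X F) x (f x)) x₀ ↔
    ContMDiffAt (𝓡 4) 𝓘(ℝ, F) ∞ f x₀ := by
  rw [contMDiffAt_section]
  rfl

variable {F' : Type*} [NormedAddCommGroup F'] [NormedSpace ℝ F']
  {V' : X → Type*} [TopologicalSpace (TotalSpace F' V')]
  [∀ x, TopologicalSpace (V' x)] [∀ x, AddCommGroup (V' x)] [∀ x, Module ℝ (V' x)]
  [FiberBundle F' V'] [VectorBundle ℝ F' V']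
  [∀ x, IsTopologicalAddGroup (V' x)] [∀ x, ContinuousSMul ℝ (V' x)]

/-- A family of linear maps `V x → V' x` is smooth at `x₀` if it takes smooth sections of `V` to
sections of `V'` that are smooth at `x₀`. -/
lemma contMDiffAt_hom_of_forall [T2Space X] [ContMDiffVectorBundle ∞ F V (𝓡 4)]
    [FiniteDimensional ℝ F] (Φ : Π x, V x →L[ℝ] V' x) (x₀ : X)
    (h : ∀ σ ∈ smoothSections F V, ContMDiffAt (𝓡 4) ((𝓡 4).prod 𝓘(ℝ, F')) ∞
      (fun x ↦ TotalSpace.mk' F' x (Φ x (σ x))) x₀) :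
    ContMDiffAt (𝓡 4) ((𝓡 4).prod 𝓘(ℝ, F →L[ℝ] F')) ∞
      (fun x ↦ TotalSpace.mk' (F →L[ℝ] F') x (Φ x)) x₀ := by
  rw [contMDiffAt_hom_bundle]
  refine ⟨contMDiffAt_id, ?_⟩
  let b := finBasis ℝ F
  set G : X → F →L[ℝ] F' := fun x ↦
    ContinuousLinearMap.inCoordinates F V F' V' x₀ x x₀ x (Φ x) with hG
  obtain ⟨s, hs, hsb⟩ := exists_frame_localFrame (V := V) b x₀
  have h1 (i) : ContMDiffAt (𝓡 4) 𝓘(ℝ, F') ∞ (fun x ↦ G x (b i)) x₀ := by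
    refine (((contMDiffAt_section _).1 (h (s i) (hs i)))).congr_of_eventuallyEq ?_
    have hb' : (trivializationAt F' V' x₀).baseSet ∈ 𝓝 x₀ :=
      (trivializationAt F' V' x₀).open_baseSet.mem_nhds (mem_baseSet_trivializationAt F' V' x₀)
    filter_upwards [hsb, hb'] with x hx hx'
    simp only [hG]
    rw [ContinuousLinearMap.inCoordinates_eq hx.1 hx']
    simp only [ContinuousLinearMap.coe_comp, ContinuousLinearEquiv.coe_coe, Function.comp_apply]
    rw [hx.2 i, Trivialization.localFrame_apply_of_mem_baseSet _ _ hx.1]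
    simp [Trivialization.basisAt]
  have h2 : G = fun x ↦ ∑ i, (ContinuousLinearMap.smulRightL ℝ F F'
      (LinearMap.toContinuousLinearMap (b.coord i))) (G x (b i)) := by
    funext x
    ext v
    have hv := congrArg (G x) (b.sum_repr v)
    simp only [map_sum, map_smul] at hv
    simp [← hv]
  rw [hG] at h2
  change ContMDiffAt (𝓡 4) 𝓘(ℝ, F →L[ℝ] F') ∞ G x₀
  rw [hG, h2]
  exact ContMDiffAt.sum fun i _ ↦
    (ContinuousLinearMap.contMDiff (n := ∞) _).contMDiffAt.comp x₀ (h1 i)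

lemma hom_mem_smoothSections [T2Space X] [ContMDiffVectorBundle ∞ F V (𝓡 4)]
    [FiniteDimensional ℝ F] {Φ : Π x, V x →L[ℝ] V' x}
    (h : ∀ σ ∈ smoothSections F V, (fun x ↦ Φ x (σ x)) ∈ smoothSections F' V') :
    Φ ∈ smoothSections (F →L[ℝ] F') (fun x ↦ V x →L[ℝ] V' x) :=
  fun x₀ ↦ contMDiffAt_hom_of_forall Φ x₀ fun σ hσ ↦ h σ hσ x₀

lemma apply_mem_smoothSections {Φ : Π x, V x →L[ℝ] V' x}
    (hΦ : Φ ∈ smoothSections (F →L[ℝ] F') (fun x ↦ V x →L[ℝ] V' x))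
    {σ : Π x, V x} (hσ : σ ∈ smoothSections F V) :
    (fun x ↦ Φ x (σ x)) ∈ smoothSections F' V' :=
  ContMDiff.clm_bundle_apply hΦ hσ

end SectionTools

section MatrixTools

variable {X : Type*} [TopologicalSpace X] [ChartedSpace R4 X] {ι : Type*} [Fintype ι]
  [DecidableEq ι]

lemma contMDiffAt_det {M : X → Matrix ι ι ℝ} {x₀ : X}
    (hM : ∀ i j, ContMDiffAt (𝓡 4) 𝓘(ℝ, ℝ) ∞ (fun x ↦ M x i j) x₀) :
    ContMDiffAt (𝓡 4) 𝓘(ℝ, ℝ) ∞ (fun x ↦ (M x).det) x₀ := by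
  simp only [Matrix.det_apply, Units.smul_def, zsmul_eq_mul]
  exact ContMDiffAt.sum fun σ _ ↦
    ContMDiffAt.mul contMDiffAt_const (ContMDiffAt.prod fun i _ ↦ hM _ _)

lemma contMDiffAt_inv {f : X → ℝ} {x₀ : X} (hf : ContMDiffAt (𝓡 4) 𝓘(ℝ, ℝ) ∞ f x₀)
    (h0 : f x₀ ≠ 0) : ContMDiffAt (𝓡 4) 𝓘(ℝ, ℝ) ∞ (fun x ↦ (f x)⁻¹) x₀ :=
  (contDiffAt_inv ℝ h0).contMDiffAt.comp x₀ hf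

lemma contMDiffAt_sqrt {f : X → ℝ} {x₀ : X} (hf : ContMDiffAt (𝓡 4) 𝓘(ℝ, ℝ) ∞ f x₀)
    (h0 : f x₀ ≠ 0) : ContMDiffAt (𝓡 4) 𝓘(ℝ, ℝ) ∞ (fun x ↦ Real.sqrt (f x)) x₀ :=
  (Real.contDiffAt_sqrt h0).contMDiffAt.comp x₀ hf

lemma contMDiffAt_matrix_inv {M : X → Matrix ι ι ℝ} {x₀ : X}
    (hM : ∀ i j, ContMDiffAt (𝓡 4) 𝓘(ℝ, ℝ) ∞ (fun x ↦ M x i j) x₀) (h0 : (M x₀).det ≠ 0)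
    (i j : ι) : ContMDiffAt (𝓡 4) 𝓘(ℝ, ℝ) ∞ (fun x ↦ (M x)⁻¹ i j) x₀ := by
  simp only [Matrix.inv_def, Ring.inverse_eq_inv', Matrix.smul_apply, smul_eq_mul,
    Matrix.adjugate_apply]
  refine (contMDiffAt_inv (contMDiffAt_det hM) h0).mul (contMDiffAt_det fun k l ↦ ?_)
  by_cases hk : k = j
  · subst hk; simp [contMDiffAt_const]
  · simpa [Matrix.updateRow_ne hk] using hM k l

end MatrixTools

/-! ### Orthonormal frames, the cross product and the axial vector -/

section InnerTools

/-- The trace of a bilinear map with respect to an inner product does not depend on the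
orthonormal basis used to compute it. -/
lemma sum_orthonormalBasis_eq {ι G H : Type*} [Fintype ι] [NormedAddCommGroup G]
    [InnerProductSpace ℝ G] [AddCommGroup H] [Module ℝ H] (β : G →ₗ[ℝ] G →ₗ[ℝ] H)
    (b b' : OrthonormalBasis ι ℝ G) : ∑ i, β (b i) (b i) = ∑ i, β (b' i) (b' i) := by
  classical
  have h (i) : β (b i) (b i) =
      ∑ j, ∑ k, (inner ℝ (b' j) (b i) * inner ℝ (b i) (b' k)) • β (b' j) (b' k) := by
    conv_lhs => rw [← b'.sum_repr' (b i)]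
    simp only [map_sum, map_smul, LinearMap.sum_apply, LinearMap.smul_apply, Finset.smul_sum,
      smul_smul]
    rw [Finset.sum_comm]
    refine Finset.sum_congr rfl fun j _ ↦ Finset.sum_congr rfl fun k _ ↦ ?_
    rw [mul_comm, real_inner_comm (b' k) (b i)]
  simp only [h]
  rw [Finset.sum_comm]
  refine Finset.sum_congr rfl fun j _ ↦ ?_
  rw [Finset.sum_comm]
  have h2 (k) : ∑ i, (inner ℝ (b' j) (b i) * inner ℝ (b i) (b' k)) • β (b' j) (b' k) =
      (if j = k then (1 : ℝ) else 0) • β (b' j) (b' k) := by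
    rw [← Finset.sum_smul, b.sum_inner_mul_inner, orthonormal_iff_ite.1 b'.orthonormal]
  simp [h2]

end InnerTools

section Frames

variable {X : Type*} [TopologicalSpace X] [ChartedSpace R4 X] [IsManifold (𝓡 4) ∞ X]
  {E : X → Type*} [TopologicalSpace (TotalSpace R3 E)]
  [∀ x, NormedAddCommGroup (E x)] [∀ x, InnerProductSpace ℝ (E x)]
  [FiberBundle R3 E] [VectorBundle ℝ R3 E]

lemma finiteDimensional_fibre (x : X) : FiniteDimensional ℝ (E x) :=
  VectorBundle.finiteDimensional ℝ R3 E x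

lemma finrank_fibre (x : X) : finrank ℝ (E x) = 3 := by
  rw [(VectorBundle.continuousLinearEquivAt ℝ R3 E x).toLinearEquiv.finrank_eq]
  simp

/-- A reference orthonormal basis of `E x`, indexed by `Fin 3`. -/
def fibreBasis (x : X) : OrthonormalBasis (Fin 3) ℝ (E x) :=
  haveI := finiteDimensional_fibre (E := E) x
  (stdOrthonormalBasis ℝ (E x)).reindex (finCongr (finrank_fibre x))

lemma sum_stdOrthonormalBasis {H : Type*} [AddCommGroup H] [Module ℝ H] (x : X)
    (f : E x → H) :
    haveI := finiteDimensional_fibre (E := E) x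
    ∑ i, f (stdOrthonormalBasis ℝ (E x) i) = ∑ i, f (fibreBasis x i) := by
  have := finiteDimensional_fibre (E := E) x
  simp only [fibreBasis, OrthonormalBasis.reindex_apply]
  exact ((finCongr (finrank_fibre (E := E) x)).symm.sum_comp
    fun i ↦ f (stdOrthonormalBasis ℝ (E x) i)).symm

/-- The orthonormal basis of `E x` consisting of three given orthonormal vectors. -/
def orthonormalBasisOf {x : X} {e : Fin 3 → E x} (he : Orthonormal ℝ e) :
    OrthonormalBasis (Fin 3) ℝ (E x) :=
  OrthonormalBasis.mk he (by
    have := finiteDimensional_fibre (E := E) x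
    exact (he.linearIndependent.span_eq_top_of_card_eq_finrank
      (by simp [finrank_fibre x])).ge)

@[simp]
lemma orthonormalBasisOf_apply {x : X} {e : Fin 3 → E x} (he : Orthonormal ℝ e) (i : Fin 3) :
    orthonormalBasisOf he i = e i := by
  simp [orthonormalBasisOf]

variable [ContMDiffVectorBundle ∞ R3 E (𝓡 4)] [IsContMDiffRiemannianBundle (𝓡 4) ∞ R3 E]

lemma contMDiffOn_gramSchmidt {ι : Type*} [LinearOrder ι] [LocallyFiniteOrderBot ι]
    [WellFoundedLT ι] {s : ι → Π x, E x} {u : Set X}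
    (hs : ∀ i, ContMDiffOn (𝓡 4) ((𝓡 4).prod 𝓘(ℝ, R3)) ∞
      (fun x ↦ TotalSpace.mk' R3 x (s i x)) u)
    (hli : ∀ x ∈ u, LinearIndependent ℝ fun i ↦ s i x) (n : ι) :
    ContMDiffOn (𝓡 4) ((𝓡 4).prod 𝓘(ℝ, R3)) ∞
      (fun x ↦ TotalSpace.mk' R3 x (InnerProductSpace.gramSchmidt ℝ (fun i ↦ s i x) n)) u := by
  induction n using WellFoundedLT.induction with
  | _ n ih =>
    have h (x : X) := InnerProductSpace.gramSchmidt_def ℝ (fun i ↦ s i x) n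
    simp only [Submodule.starProjection_singleton] at h
    simp only [h]
    refine ContMDiffOn.sub_section (hs n) (ContMDiffOn.sum_section fun i hi ↦ ?_)
    have hi' := ih i (Finset.mem_Iio.1 hi)
    refine ContMDiffOn.smul_section (f := fun x ↦
      inner ℝ (InnerProductSpace.gramSchmidt ℝ (fun i ↦ s i x) i) (s n x) /
        ‖InnerProductSpace.gramSchmidt ℝ (fun i ↦ s i x) i‖ ^ 2) ?_ hi'
    simp only [← real_inner_self_eq_norm_sq]
    exact ContMDiffOn.div₀ (hi'.inner_bundle (hs n)) (hi'.inner_bundle hi') fun x hx ↦ by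
      simpa using InnerProductSpace.gramSchmidt_ne_zero _ (hli x hx)

lemma exists_orthonormal_frame [T2Space X] (x₀ : X) :
    ∃ e : Fin 3 → Π x, E x, (∀ i, e i ∈ smoothSections R3 E) ∧
      ∀ᶠ x in 𝓝 x₀, Orthonormal ℝ (fun i ↦ e i x) := by
  obtain ⟨s, hs, hli⟩ := exists_frame (V := E) (EuclideanSpace.basisFun (Fin 3) ℝ).toBasis x₀
  set u := {x | LinearIndependent ℝ (fun i ↦ s i x)} with hu
  have hux : u ∈ 𝓝 x₀ := by filter_upwards [hli] with x hx using hx.1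
  have hgs (n) := contMDiffOn_gramSchmidt (u := u) (fun i ↦ (hs i).contMDiffOn) (fun x hx ↦ hx) n
  have hgn (n) : ContMDiffOn (𝓡 4) ((𝓡 4).prod 𝓘(ℝ, R3)) ∞
      (fun x ↦ TotalSpace.mk' R3 x
        (InnerProductSpace.gramSchmidtNormed ℝ (fun i ↦ s i x) n)) u := by
    refine ContMDiffOn.smul_section (f := fun x ↦
      ((‖InnerProductSpace.gramSchmidt ℝ (fun i ↦ s i x) n‖ : ℝ))⁻¹) ?_ (hgs n)
    simp only [norm_eq_sqrt_real_inner]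
    intro x hx
    have h0 : inner ℝ (InnerProductSpace.gramSchmidt ℝ (fun i ↦ s i x) n)
        (InnerProductSpace.gramSchmidt ℝ (fun i ↦ s i x) n) ≠ 0 := by
      simpa using InnerProductSpace.gramSchmidt_ne_zero n hx
    have h1 : ContMDiffAt 𝓘(ℝ, ℝ) 𝓘(ℝ, ℝ) ∞ (fun r : ℝ ↦ (√r)⁻¹)
        (inner ℝ (InnerProductSpace.gramSchmidt ℝ (fun i ↦ s i x) n)
          (InnerProductSpace.gramSchmidt ℝ (fun i ↦ s i x) n)) :=
      ((Real.contDiffAt_sqrt h0).inv (by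
        rwa [ne_eq, Real.sqrt_eq_zero real_inner_self_nonneg])).contMDiffAt
    exact ContMDiffAt.comp_contMDiffWithinAt (g := fun r : ℝ ↦ (√r)⁻¹) x h1 (((hgs n).inner_bundle (hgs n)) x hx)
  choose e he he' using fun n ↦ exists_smoothSection_eventuallyEq hux (hgn n)
  refine ⟨e, he, ?_⟩
  filter_upwards [hux, Filter.eventually_all.2 he'] with x hx hx'
  have : (fun i ↦ e i x) = InnerProductSpace.gramSchmidtNormed ℝ (fun i ↦ s i x) := funext hx'
  rw [this]
  exact InnerProductSpace.gramSchmidtNormed_orthonormal hx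

/-- A section of `E` is smooth at `x₀` if its inner products with smooth sections are. -/
lemma contMDiffAt_section_of_inner [T2Space X] {s : Π x, E x} {x₀ : X}
    (h : ∀ σ ∈ smoothSections R3 E, ContMDiffAt (𝓡 4) 𝓘(ℝ, ℝ) ∞ (fun x ↦ inner ℝ (σ x) (s x)) x₀) :
    ContMDiffAt (𝓡 4) ((𝓡 4).prod 𝓘(ℝ, R3)) ∞ (fun x ↦ TotalSpace.mk' R3 x (s x)) x₀ := by
  obtain ⟨e, he, hon⟩ := exists_orthonormal_frame (E := E) x₀
  have : ContMDiffAt (𝓡 4) ((𝓡 4).prod 𝓘(ℝ, R3)) ∞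
      (fun x ↦ TotalSpace.mk' R3 x (∑ i, (fun x ↦ inner ℝ (e i x) (s x)) x • e i x)) x₀ :=
    ContMDiffAt.sum_section fun i _ ↦ ContMDiffAt.smul_section (h _ (he i)) (he i x₀)
  refine this.congr_of_eventuallyEq ?_
  filter_upwards [hon] with x hx
  have := (orthonormalBasisOf hx).sum_repr' (s x)
  simp only [orthonormalBasisOf_apply] at this
  simp only [this]

namespace FibreOrientation

variable (o : FibreOrientation E)

lemma inner_cross (x : X) (v w z : E x) : inner ℝ (o.cross x v w) z = o.form x ![v, w, z] := by
  have := finiteDimensional_fibre (E := E) x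
  have hz := (stdOrthonormalBasis ℝ (E x)).sum_repr' z
  have h1 : o.cross x v w = ∑ i, o.form x ![v, w, stdOrthonormalBasis ℝ (E x) i] •
      stdOrthonormalBasis ℝ (E x) i := rfl
  have hu (y : E x) : Function.update ![v, w, z] 2 y = ![v, w, y] := by
    ext j; fin_cases j <;> simp
  have h2 : o.form x ![v, w, z] = ∑ i, inner ℝ (stdOrthonormalBasis ℝ (E x) i) z *
      o.form x ![v, w, stdOrthonormalBasis ℝ (E x) i] := by
    have h3 := (o.form x).map_update_sum Finset.univ 2
      (fun i ↦ inner ℝ (stdOrthonormalBasis ℝ (E x) i) z • stdOrthonormalBasis ℝ (E x) i) ![v, w, z]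
    have h4 (c : ℝ) (y : E x) : o.form x ![v, w, c • y] = c * o.form x ![v, w, y] := by
      have := (o.form x).map_update_smul ![v, w, z] 2 c y
      rwa [hu, hu] at this
    simp only [hu, h4] at h3
    rwa [hz] at h3
  rw [h1, h2, sum_inner]
  simp only [real_inner_smul_left]
  exact Finset.sum_congr rfl fun i _ ↦ mul_comm _ _

lemma cross_mem_smoothSections [T2Space X] {s t : Π x, E x} (hs : s ∈ smoothSections R3 E)
    (ht : t ∈ smoothSections R3 E) : (fun x ↦ o.cross x (s x) (t x)) ∈ smoothSections R3 E := by
  refine fun x₀ ↦ contMDiffAt_section_of_inner fun σ hσ ↦ ?_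
  simp only [real_inner_comm (o.cross _ _ _), o.inner_cross]
  exact o.contMDiff s hs t ht σ hσ x₀

/-- In coordinates with respect to an orthonormal basis the volume form is `±` the determinant. -/
lemma form_eq_det (x : X) (b : OrthonormalBasis (Fin 3) ℝ (E x)) (v : Fin 3 → E x) :
    o.form x v = o.form x b * (Matrix.of fun i j ↦ (inner ℝ (b i) (v j) : ℝ)).det := by
  have h := congrArg (fun f ↦ f v) ((o.form x).eq_smul_basis_det b.toBasis)
  simp only [AlternatingMap.smul_apply, smul_eq_mul, b.coe_toBasis] at h
  rw [h, Basis.det_apply]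
  congr 2
  ext i j
  simp [Basis.toMatrix_apply, OrthonormalBasis.repr_apply_apply]

lemma axial_eq_sum {x : X} (b : OrthonormalBasis (Fin 3) ℝ (E x)) (φ : E x →ₗ[ℝ] E x) :
    o.axial φ = (1 / 2 : ℝ) • ∑ i, o.cross x (b i) (φ (b i)) := by
  have := finiteDimensional_fibre (E := E) x
  have h := sum_orthonormalBasis_eq (LinearMap.mk₂ ℝ (fun v w : E x ↦ o.cross x v (φ w))
    (by simp) (by simp) (by simp) (by simp)) (fibreBasis x) b
  simp only [LinearMap.mk₂_apply] at h
  rw [← h, ← sum_stdOrthonormalBasis x fun v ↦ o.cross x v (φ v)]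
  rfl

/-- `axial` inverts the isomorphism `E_x ≅ so(E_x)`. -/
lemma axial_cross {x : X} (ξ : E x) : o.axial (fun v ↦ o.cross x ξ v) = ξ := by
  set b := fibreBasis (E := E) x
  have h := o.axial_eq_sum b (o.cross x ξ).toLinearMap
  have hσ : o.form x b * o.form x b = 1 := by
    have := o.abs_form_eq_one x b
    rw [← abs_mul_abs_self, this, one_mul]
  have hb (i j) := orthonormal_iff_ite.1 b.orthonormal i j
  have hc (l : Fin 3) (v w : E x) : inner ℝ (b l) (o.cross x v w) = o.form x ![v, w, b l] := by
    rw [real_inner_comm, o.inner_cross]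
  have hdet := o.form_eq_det x b
  generalize o.form x b = σ at hσ hdet
  refine Eq.trans h (b.repr.injective (PiLp.ext fun k ↦ ?_))
  simp only [OrthonormalBasis.repr_apply_apply, ContinuousLinearMap.coe_coe, inner_smul_right, inner_sum, hc]
  simp only [Fin.sum_univ_three, hdet, Matrix.det_fin_three, Matrix.of_apply,
    Matrix.cons_val_zero, Matrix.cons_val_one, Matrix.cons_val_two, hb, hc]
  fin_cases k <;> simp <;> linear_combination (inner ℝ (b _) ξ) * hσ

lemma axial_add {x : X} (φ ψ : E x → E x) : o.axial (φ + ψ) = o.axial φ + o.axial ψ := by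
  simp [axial, Finset.sum_add_distrib]

lemma axial_smul {x : X} (c : ℝ) (φ : E x → E x) : o.axial (c • φ) = c • o.axial φ := by
  simp only [axial, Pi.smul_apply, map_smul, ← Finset.smul_sum]
  rw [smul_comm]

end FibreOrientation

end Frames

/-! ### Operators on sections which are linear over smooth functions -/

section Tensorial

variable {X : Type*} [TopologicalSpace X] [ChartedSpace R4 X] [IsManifold (𝓡 4) ∞ X]
  {F : Type*} [NormedAddCommGroup F] [NormedSpace ℝ F]
  {V : X → Type*} [TopologicalSpace (TotalSpace F V)]
  [∀ x, TopologicalSpace (V x)] [∀ x, AddCommGroup (V x)] [∀ x, Module ℝ (V x)]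
  [FiberBundle F V] [VectorBundle ℝ F V]

lemma exists_smooth_eventuallyEq [T2Space X] {x₀ : X} {u : Set X} (hu : u ∈ 𝓝 x₀) {f : X → ℝ}
    (hf : ContMDiffOn (𝓡 4) 𝓘(ℝ, ℝ) ∞ f u) :
    ∃ f' : X → ℝ, ContMDiff (𝓡 4) 𝓘(ℝ, ℝ) ∞ f' ∧ ∀ᶠ x in 𝓝 x₀, f' x = f x := by
  have hs : ContMDiffOn (𝓡 4) ((𝓡 4).prod 𝓘(ℝ, ℝ)) ∞
      (fun x ↦ TotalSpace.mk' ℝ (E := Bundle.Trivial X ℝ) x (f x)) u := fun x hx ↦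
    contMDiffWithinAt_section.2 (hf x hx)
  obtain ⟨f', hf', h⟩ := exists_smoothSection_eventuallyEq hu hs
  exact ⟨f', fun x ↦ contMDiffAt_section_trivial_iff.1 (hf' x), h⟩

variable {A : Type*} [AddCommGroup A] [Module ℝ A]

/-- An operation on smooth sections which is linear over smooth functions depends only on the germ
of the section. -/
lemma eq_of_germ_eq [T2Space X] {x₀ : X} (Φ : (Π x, V x) → A)
    (hsmul : ∀ f : X → ℝ, ContMDiff (𝓡 4) 𝓘(ℝ, ℝ) ∞ f → ∀ s ∈ smoothSections F V,
      Φ (fun x ↦ f x • s x) = f x₀ • Φ s)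
    {s t : Π x, V x} (hs : s ∈ smoothSections F V) (ht : t ∈ smoothSections F V)
    (h : ∀ᶠ x in 𝓝 x₀, s x = t x) : Φ s = Φ t := by
  obtain ⟨f, hf, hfu, -, -, h1⟩ := exists_cutoff h
  have hst : (fun x ↦ f x • s x) = fun x ↦ f x • t x := by
    funext x
    by_cases hx : x ∈ tsupport f
    · rw [show s x = t x from hfu hx]
    · simp [image_eq_zero_of_notMem_tsupport hx]
  have h2 := hsmul f hf s hs
  rw [hst, hsmul f hf t ht, h1.self_of_nhds, one_smul, one_smul] at h2
  exact h2.symm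

/-- An operation on smooth sections which is linear over smooth functions depends only on the value
of the section. -/
lemma eq_of_apply_eq [T2Space X] [ContMDiffVectorBundle ∞ F V (𝓡 4)] [FiniteDimensional ℝ F]
    {x₀ : X} (Φ : (Π x, V x) → A)
    (hadd : ∀ s ∈ smoothSections F V, ∀ t ∈ smoothSections F V,
      Φ (fun x ↦ s x + t x) = Φ s + Φ t)
    (hsmul : ∀ f : X → ℝ, ContMDiff (𝓡 4) 𝓘(ℝ, ℝ) ∞ f → ∀ s ∈ smoothSections F V,
      Φ (fun x ↦ f x • s x) = f x₀ • Φ s)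
    {s t : Π x, V x} (hs : s ∈ smoothSections F V) (ht : t ∈ smoothSections F V)
    (h : s x₀ = t x₀) : Φ s = Φ t := by
  have h0 : Φ 0 = 0 := by
    have := hsmul (fun _ ↦ 0) contMDiff_const 0 (Submodule.zero_mem _)
    rw [zero_smul] at this
    rw [← this]
    congr 1
    funext x
    simp
  let b := finBasis ℝ F
  obtain ⟨e, he, heb⟩ := exists_frame_localFrame (V := V) b x₀
  set tr := trivializationAt F V x₀
  have hmem : tr.baseSet ∈ 𝓝 x₀ :=
    tr.open_baseSet.mem_nhds (mem_baseSet_trivializationAt F V x₀)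
  have key (r : Π x, V x) (hr : r ∈ smoothSections F V) :
      Φ r = ∑ i, tr.localFrameCoeff (𝓡 4) b i x₀ (r x₀) • Φ (e i) := by
    have hc (i) : ContMDiffOn (𝓡 4) 𝓘(ℝ, ℝ) ∞
        (fun x ↦ tr.localFrameCoeff (𝓡 4) b i x (r x)) tr.baseSet :=
      contMDiffOn_baseSet_localFrameCoeff (I := 𝓡 4) (e := tr) b hr.contMDiffOn i
    choose c hcs hcg using fun i ↦ exists_smooth_eventuallyEq hmem (hc i)
    have hsum (S : Finset (Fin (finrank ℝ F))) :
        (fun x ↦ ∑ i ∈ S, c i x • e i x) ∈ smoothSections F V ∧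
        Φ (fun x ↦ ∑ i ∈ S, c i x • e i x) = ∑ i ∈ S, c i x₀ • Φ (e i) := by
      classical
      induction S using Finset.induction_on with
      | empty => simpa using ⟨Submodule.zero_mem _, h0⟩
      | insert i S hi ih =>
        simp only [Finset.sum_insert hi]
        have h1 := smul_mem_smoothSections (hcs i) (he i)
        exact ⟨Submodule.add_mem _ h1 ih.1, by rw [hadd _ h1 _ ih.1, ih.2, hsmul _ (hcs i) _ (he i)]⟩
    rw [eq_of_germ_eq (F := F) Φ hsmul hr (hsum Finset.univ).1, (hsum _).2]
    · exact Finset.sum_congr rfl fun i _ ↦ by rw [(hcg i).self_of_nhds]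
    · filter_upwards [tr.eventually_eq_localFrame_sum_coeff_smul (I := 𝓡 4) b
        (mem_baseSet_trivializationAt F V x₀) (s := r), heb, Filter.eventually_all.2 hcg]
        with x hx hx' hx''
      rw [hx]
      exact Finset.sum_congr rfl fun i _ ↦ by rw [hx'', hx'.2 i]
  rw [key s hs, key t ht, h]

end Tensorial

/-! ### Vector fields and derivatives of functions -/

section VectorFields

variable {X : Type*} [TopologicalSpace X] [ChartedSpace R4 X] [IsManifold (𝓡 4) ∞ X]

variable (X) in
/-- The smooth vector fields on `X`. -/
abbrev vectorFields : Submodule ℝ (Π x : X, TangentSpace (𝓡 4) x) :=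
  smoothSections R4 (TangentSpace (𝓡 4) : X → Type _)

lemma contMDiff_mvfderiv_apply {f : X → ℝ} (hf : ContMDiff (𝓡 4) 𝓘(ℝ, ℝ) ∞ f)
    {U : Π x : X, TangentSpace (𝓡 4) x} (hU : U ∈ vectorFields X) :
    ContMDiff (𝓡 4) 𝓘(ℝ, ℝ) ∞ (fun x ↦ mvfderiv (𝓡 4) f x (U x)) :=
  (contMDiff_snd_tangentBundle_modelSpace ℝ 𝓘(ℝ, ℝ)).comp
    ((hf.contMDiff_tangentMap (m := ∞) (by simp)).comp hU)

lemma mlieBracket_mem {U V : Π x : X, TangentSpace (𝓡 4) x} (hU : U ∈ vectorFields X)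
    (hV : V ∈ vectorFields X) : VectorField.mlieBracket (𝓡 4) U V ∈ vectorFields X := by
  have : IsManifold (𝓡 4) ((((⊤ : ℕ∞) : WithTop ℕ∞)) + 1) X := by simpa
  have : IsManifold (𝓡 4) (minSmoothness ℝ 2) X := by
    simpa using IsManifold.of_le (n := ∞) (m := 2) (ENat.LEInfty.out)
  exact fun x ↦ ContMDiffAt.mlieBracket_vectorField (m := ⊤) (n := ⊤) (hU x) (hV x) (by simp)

lemma mdifferentiableAt_of_mem {F : Type*} [NormedAddCommGroup F] [NormedSpace ℝ F]
    {V : X → Type*} [TopologicalSpace (TotalSpace F V)]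
    [∀ x, TopologicalSpace (V x)] [∀ x, AddCommGroup (V x)] [∀ x, Module ℝ (V x)]
    [FiberBundle F V] [VectorBundle ℝ F V] {s : Π x, V x} (hs : s ∈ smoothSections F V) (x : X) :
    MDifferentiableAt (𝓡 4) ((𝓡 4).prod 𝓘(ℝ, F)) (fun x ↦ TotalSpace.mk' F x (s x)) x :=
  (hs x).mdifferentiableAt (by simp)

/-- `[U, V] f = U (V f) - V (U f)`. This is the coefficient of `W` in the Jacobi identity for
`U`, `V` and `f W`, where `W` is any vector field that does not vanish at the point. -/
lemma mvfderiv_mlieBracket [T2Space X] {U V : Π x : X, TangentSpace (𝓡 4) x}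
    (hU : U ∈ vectorFields X) (hV : V ∈ vectorFields X) {f : X → ℝ}
    (hf : ContMDiff (𝓡 4) 𝓘(ℝ, ℝ) ∞ f) (x : X) :
    mvfderiv (𝓡 4) f x (VectorField.mlieBracket (𝓡 4) U V x) =
      mvfderiv (𝓡 4) (fun y ↦ mvfderiv (𝓡 4) f y (V y)) x (U x) -
      mvfderiv (𝓡 4) (fun y ↦ mvfderiv (𝓡 4) f y (U y)) x (V x) := by
  obtain ⟨W, hW, hWx⟩ := exists_smoothSection_apply_eq (F := R4) (tangentBasis x 0)
  have hW0 : W x ≠ 0 := by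
    rw [hWx]
    intro h
    have : (EuclideanSpace.single (0 : Fin 4) (1 : ℝ) : R4) = 0 := h
    simp at this
  have hfd (x) : MDifferentiableAt (𝓡 4) 𝓘(ℝ, ℝ) f x := (hf x).mdifferentiableAt (by simp)
  have hVf := contMDiff_mvfderiv_apply hf hV
  have hUf := contMDiff_mvfderiv_apply hf hU
  have : IsManifold (𝓡 4) (minSmoothness ℝ 3) X := by
    simpa using IsManifold.of_le (n := ∞) (m := 3) (ENat.LEInfty.out)
  have jac (Z : Π x : X, TangentSpace (𝓡 4) x) (hZ : Z ∈ vectorFields X) :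
      VectorField.mlieBracket (𝓡 4) U (VectorField.mlieBracket (𝓡 4) V Z) x =
      VectorField.mlieBracket (𝓡 4) (VectorField.mlieBracket (𝓡 4) U V) Z x +
      VectorField.mlieBracket (𝓡 4) V (VectorField.mlieBracket (𝓡 4) U Z) x := by
    have hle : minSmoothness ℝ 2 ≤ (∞ : WithTop ℕ∞) := by
      simpa using (ENat.LEInfty.out : (2 : ℕ∞ω) ≤ ∞)
    exact VectorField.leibniz_identity_mlieBracket_apply ((hU x).of_le hle) ((hV x).of_le hle)
      ((hZ x).of_le hle)
  have hfW : f • W ∈ vectorFields X := smul_mem_smoothSections hf hW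
  have e1 (Y : Π x : X, TangentSpace (𝓡 4) x) : VectorField.mlieBracket (𝓡 4) Y (f • W) =
      (fun y ↦ mvfderiv (𝓡 4) f y (Y y)) • W + f • VectorField.mlieBracket (𝓡 4) Y W := by
    funext y
    rw [VectorField.mlieBracket_smul_right (hfd y) (mdifferentiableAt_of_mem hW y)]
    rfl
  have e2 (Y Z : Π x : X, TangentSpace (𝓡 4) x) (hZ : Z ∈ vectorFields X) (g : X → ℝ)
      (hg : ContMDiff (𝓡 4) 𝓘(ℝ, ℝ) ∞ g) :
      VectorField.mlieBracket (𝓡 4) Y (g • W + f • VectorField.mlieBracket (𝓡 4) Z W) x =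
      mvfderiv (𝓡 4) g x (Y x) • W x + g x • VectorField.mlieBracket (𝓡 4) Y W x +
      (mvfderiv (𝓡 4) f x (Y x) • VectorField.mlieBracket (𝓡 4) Z W x +
        f x • VectorField.mlieBracket (𝓡 4) Y (VectorField.mlieBracket (𝓡 4) Z W) x) := by
    have hZW := mlieBracket_mem hZ hW
    rw [VectorField.mlieBracket_add_right
      (W := g • W) (W₁ := f • VectorField.mlieBracket (𝓡 4) Z W)
      (mdifferentiableAt_of_mem (smul_mem_smoothSections hg hW) x)
      (mdifferentiableAt_of_mem (smul_mem_smoothSections hf hZW) x),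
      VectorField.mlieBracket_smul_right ((hg x).mdifferentiableAt (by simp))
        (mdifferentiableAt_of_mem hW x),
      VectorField.mlieBracket_smul_right (hfd x) (mdifferentiableAt_of_mem hZW x)]
  have h := jac _ hfW
  rw [e1 V, e1 U, e2 U V hV _ hVf, e2 V U hU _ hUf, e1, Pi.add_apply, Pi.smul_apply', 
    Pi.smul_apply', jac W hW] at h
  have h2 : (mvfderiv (𝓡 4) f x (VectorField.mlieBracket (𝓡 4) U V x) -
      (mvfderiv (𝓡 4) (fun y ↦ mvfderiv (𝓡 4) f y (V y)) x (U x) -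
      mvfderiv (𝓡 4) (fun y ↦ mvfderiv (𝓡 4) f y (U y)) x (V x))) • W x = 0 := by
    rw [← sub_eq_zero] at h
    rw [← neg_eq_zero, ← h]
    module
  exact sub_eq_zero.1 ((smul_eq_zero.1 h2).resolve_right hW0)

end VectorFields

/-! ### Curvature as a tensor -/

section Curvature

variable {X : Type*} [TopologicalSpace X] [ChartedSpace R4 X]

lemma sum_tangentCoord_smul {x : X} (w : TangentSpace (𝓡 4) x) :
    ∑ i, tangentCoord x i w • tangentBasis x i = w := by
  have h := (EuclideanSpace.basisFun (Fin 4) ℝ).sum_repr (w : R4)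
  simp only [EuclideanSpace.basisFun_apply] at h
  exact h

lemma bilinOfBasis_apply_eq {x : X} {G : Type*} [AddCommGroup G] [Module ℝ G] [TopologicalSpace G]
    [IsTopologicalAddGroup G] [ContinuousSMul ℝ G]
    (β : TangentSpace (𝓡 4) x →ₗ[ℝ] TangentSpace (𝓡 4) x →ₗ[ℝ] G) (u v : TangentSpace (𝓡 4) x) :
    bilinOfBasis x (fun i j ↦ β (tangentBasis x i) (tangentBasis x j)) u v = β u v := by
  conv_rhs => rw [← sum_tangentCoord_smul u, ← sum_tangentCoord_smul v]
  simp only [bilinOfBasis, map_sum, map_smul, LinearMap.sum_apply, LinearMap.smul_apply,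
    _root_.sum_apply, ContinuousLinearMap.smulRight_apply, _root_.smul_apply,
    Finset.smul_sum]
  rw [Finset.sum_comm]
  exact Finset.sum_congr rfl fun i _ ↦ Finset.sum_congr rfl fun j _ ↦ smul_comm _ _ _

variable [IsManifold (𝓡 4) ∞ X] {E : X → Type*} [TopologicalSpace (TotalSpace R3 E)]
  [∀ x, NormedAddCommGroup (E x)] [∀ x, InnerProductSpace ℝ (E x)]
  [FiberBundle R3 E] [VectorBundle ℝ R3 E] [ContMDiffVectorBundle ∞ R3 E (𝓡 4)]
  [IsContMDiffRiemannianBundle (𝓡 4) ∞ R3 E]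

variable (A : CovariantDerivative (𝓡 4) R3 E)

lemma curvatureForm_apply (o : FibreOrientation E) {x : X} (e : E x) (u v : TangentSpace (𝓡 4) x) :
    curvatureForm o A x e u v = inner ℝ (curvature o A x u v) e :=
  bilinOfBasis_apply_eq (LinearMap.mk₂ ℝ (fun u v ↦ inner ℝ (curvature o A x u v) e)
    (by simp [inner_add_left]) (by simp [inner_smul_left]) (by simp [inner_add_left])
    (by simp [inner_smul_left])) u v

/-- The curvature operator `∇_U ∇_V S - ∇_V ∇_U S - ∇_[U, V] S`. -/
def curvatureOp (U V : Π x : X, TangentSpace (𝓡 4) x) (S : Π x, E x) (x : X) : E x :=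
  A (fun y ↦ A S y (V y)) x (U x) - A (fun y ↦ A S y (U y)) x (V x)
    - A S x (VectorField.mlieBracket (𝓡 4) U V x)

variable {U V W : Π x : X, TangentSpace (𝓡 4) x} {S T : Π x, E x}

lemma covDeriv_mem [A.ContMDiffCovariantDerivative ∞] (hS : S ∈ smoothSections R3 E) :
    (fun x ↦ A S x) ∈ OneForms E := by
  have h := (CovariantDerivative.ContMDiffCovariantDerivative.contMDiff (cov := A) (k := ∞)).contMDiff
    (σ := S) (by simpa using hS.contMDiffOn)
  exact contMDiffOn_univ.1 h

lemma covDeriv_apply_mem [A.ContMDiffCovariantDerivative ∞] (hU : U ∈ vectorFields X)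
    (hS : S ∈ smoothSections R3 E) : (fun x ↦ A S x (U x)) ∈ smoothSections R3 E :=
  apply_mem_smoothSections (covDeriv_mem A hS) hU

lemma covDeriv_add (hS : S ∈ smoothSections R3 E) (hT : T ∈ smoothSections R3 E) (x : X) :
    A (fun y ↦ S y + T y) x = A S x + A T x :=
  A.isCovariantDerivativeOnUniv.add (mdifferentiableAt_of_mem hS x) (mdifferentiableAt_of_mem hT x)

lemma covDeriv_smul {f : X → ℝ} (hf : ContMDiff (𝓡 4) 𝓘(ℝ, ℝ) ∞ f)
    (hS : S ∈ smoothSections R3 E) (x : X) (v : TangentSpace (𝓡 4) x) :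
    A (fun y ↦ f y • S y) x v = f x • A S x v + mvfderiv (𝓡 4) f x v • S x := by
  have := A.isCovariantDerivativeOnUniv.leibniz (g := f) (mdifferentiableAt_of_mem hS x)
    ((hf x).mdifferentiableAt (by simp))
  exact congrArg (fun L ↦ L v) this

lemma covDeriv_congr {x : X} (hT : T ∈ smoothSections R3 E) (h : ∀ᶠ y in 𝓝 x, S y = T y) :
    A S x = A T x := by
  have hT' := mdifferentiableAt_of_mem hT x
  refine A.isCovariantDerivativeOnUniv.congr_of_eventuallyEq
    (hT'.congr_of_eventuallyEq ?_) hT' Filter.univ_mem h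
  filter_upwards [h] with y hy
  rw [hy]

lemma curvatureOp_congr [A.ContMDiffCovariantDerivative ∞] {U' V' : Π x : X, TangentSpace (𝓡 4) x}
    {S' : Π x, E x} {x : X} (hU : U ∈ vectorFields X) (hV : V ∈ vectorFields X)
    (hS : S ∈ smoothSections R3 E) (hU' : ∀ᶠ y in 𝓝 x, U' y = U y) (hV' : ∀ᶠ y in 𝓝 x, V' y = V y)
    (hS' : ∀ᶠ y in 𝓝 x, S' y = S y) : curvatureOp A U' V' S' x = curvatureOp A U V S x := by
  have key {Y Y' : Π x : X, TangentSpace (𝓡 4) x} (hY : Y ∈ vectorFields X)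
      (hY' : ∀ᶠ y in 𝓝 x, Y' y = Y y) :
      A (fun y ↦ A S' y (Y' y)) x = A (fun y ↦ A S y (Y y)) x := by
    refine covDeriv_congr A (covDeriv_apply_mem A hY hS) ?_
    filter_upwards [hS'.eventually_nhds, hY'] with y hy hy'
    rw [covDeriv_congr A hS hy, hy']
  rw [curvatureOp, curvatureOp, key hU hU', key hV hV', covDeriv_congr A hS hS', hU'.self_of_nhds,
    hV'.self_of_nhds, Filter.EventuallyEq.mlieBracket_vectorField_eq hU' hV']

lemma curvatureOp_swap (U V : Π x : X, TangentSpace (𝓡 4) x) (S : Π x, E x) (x : X) :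
    curvatureOp A U V S x = -curvatureOp A V U S x := by
  rw [curvatureOp, curvatureOp, VectorField.mlieBracket_swap, Pi.neg_apply, map_neg]
  abel

variable [A.ContMDiffCovariantDerivative ∞]

lemma curvatureOp_add_right (hV : V ∈ vectorFields X) (hW : W ∈ vectorFields X)
    (hS : S ∈ smoothSections R3 E) (x : X) : curvatureOp A U (fun y ↦ V y + W y) S x =
      curvatureOp A U V S x + curvatureOp A U W S x := by
  have h1 : A (fun y ↦ A S y (V y + W y)) x =
      A (fun y ↦ A S y (V y)) x + A (fun y ↦ A S y (W y)) x := by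
    simp only [map_add]
    exact covDeriv_add A (covDeriv_apply_mem A hV hS) (covDeriv_apply_mem A hW hS) x
  have h2 : VectorField.mlieBracket (𝓡 4) U (fun y ↦ V y + W y) x =
      VectorField.mlieBracket (𝓡 4) U V x + VectorField.mlieBracket (𝓡 4) U W x :=
    VectorField.mlieBracket_add_right (mdifferentiableAt_of_mem hV x)
      (mdifferentiableAt_of_mem hW x)
  simp only [curvatureOp]
  rw [h1, h2]
  simp only [_root_.add_apply, map_add]
  abel

lemma curvatureOp_smul_right {f : X → ℝ} (hf : ContMDiff (𝓡 4) 𝓘(ℝ, ℝ) ∞ f)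
    (hV : V ∈ vectorFields X) (hS : S ∈ smoothSections R3 E) (x : X) :
    curvatureOp A U (fun y ↦ f y • V y) S x = f x • curvatureOp A U V S x := by
  have h1 : A (fun y ↦ A S y (f y • V y)) x (U x) =
      f x • A (fun y ↦ A S y (V y)) x (U x) + mvfderiv (𝓡 4) f x (U x) • A S x (V x) := by
    simp only [map_smul]
    exact covDeriv_smul A hf (covDeriv_apply_mem A hV hS) x _
  have h2 : VectorField.mlieBracket (𝓡 4) U (fun y ↦ f y • V y) x =
      mvfderiv (𝓡 4) f x (U x) • V x + f x • VectorField.mlieBracket (𝓡 4) U V x :=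
    VectorField.mlieBracket_smul_right ((hf x).mdifferentiableAt (by simp))
      (mdifferentiableAt_of_mem hV x)
  simp only [curvatureOp]
  rw [h1, h2]
  simp only [map_add, map_smul]
  module

lemma curvatureOp_add_section (hU : U ∈ vectorFields X) (hV : V ∈ vectorFields X)
    (hS : S ∈ smoothSections R3 E) (hT : T ∈ smoothSections R3 E) (x : X) :
    curvatureOp A U V (fun y ↦ S y + T y) x =
      curvatureOp A U V S x + curvatureOp A U V T x := by
  have h1 {Y : Π x : X, TangentSpace (𝓡 4) x} (hY : Y ∈ vectorFields X) :
      A (fun y ↦ A (fun y ↦ S y + T y) y (Y y)) x =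
      A (fun y ↦ A S y (Y y)) x + A (fun y ↦ A T y (Y y)) x := by
    simp only [covDeriv_add A hS hT, _root_.add_apply]
    exact covDeriv_add A (covDeriv_apply_mem A hY hS) (covDeriv_apply_mem A hY hT) x
  simp only [curvatureOp]
  rw [h1 hU, h1 hV, covDeriv_add A hS hT]
  simp only [_root_.add_apply]
  abel

lemma curvatureOp_smul_section [T2Space X] {f : X → ℝ} (hf : ContMDiff (𝓡 4) 𝓘(ℝ, ℝ) ∞ f)
    (hU : U ∈ vectorFields X) (hV : V ∈ vectorFields X) (hS : S ∈ smoothSections R3 E) (x : X) :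
    curvatureOp A U V (fun y ↦ f y • S y) x = f x • curvatureOp A U V S x := by
  have h1 {Y Z : Π x : X, TangentSpace (𝓡 4) x} (hY : Y ∈ vectorFields X) :
      A (fun y ↦ A (fun y ↦ f y • S y) y (Y y)) x (Z x) =
      f x • A (fun y ↦ A S y (Y y)) x (Z x) + mvfderiv (𝓡 4) f x (Z x) • A S x (Y x) +
      (mvfderiv (𝓡 4) f x (Y x) • A S x (Z x) +
        mvfderiv (𝓡 4) (fun y ↦ mvfderiv (𝓡 4) f y (Y y)) x (Z x) • S x) := by
    have hYf := contMDiff_mvfderiv_apply hf hY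
    have hAS := covDeriv_apply_mem A hY hS
    simp only [covDeriv_smul A hf hS]
    rw [covDeriv_add A (smul_mem_smoothSections hf hAS) (smul_mem_smoothSections hYf hS),
      _root_.add_apply, covDeriv_smul A hf hAS, covDeriv_smul A hYf hS]
  simp only [curvatureOp]
  rw [h1 hU, h1 hV, covDeriv_smul A hf hS, mvfderiv_mlieBracket hU hV hf]
  module

variable [T2Space X]

/-- The curvature operator is tensorial: `curvatureEndo`, which uses local extensions, computes it
for all global sections. -/
lemma curvatureEndo_eq (hU : U ∈ vectorFields X) (hV : V ∈ vectorFields X)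
    (hS : S ∈ smoothSections R3 E) (x : X) :
    curvatureEndo A (U x) (V x) (S x) = curvatureOp A U V S x := by
  obtain ⟨n, hn, hn'⟩ := FiberBundle.exists_contMDiffOn_extend (𝓡 4) R4 (k := ∞) (U x)
  obtain ⟨U', hU', hUe⟩ := exists_smoothSection_eventuallyEq hn hn'
  obtain ⟨n, hn, hn'⟩ := FiberBundle.exists_contMDiffOn_extend (𝓡 4) R4 (k := ∞) (V x)
  obtain ⟨V', hV', hVe⟩ := exists_smoothSection_eventuallyEq hn hn'
  obtain ⟨n, hn, hn'⟩ := FiberBundle.exists_contMDiffOn_extend (𝓡 4) R3 (k := ∞) (S x)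
  obtain ⟨S', hS', hSe⟩ := exists_smoothSection_eventuallyEq hn hn'
  have e1 : curvatureEndo A (U x) (V x) (S x) = curvatureOp A U' V' S' x :=
    curvatureOp_congr A hU' hV' hS' (hUe.mono fun _ h ↦ h.symm) (hVe.mono fun _ h ↦ h.symm)
      (hSe.mono fun _ h ↦ h.symm)
  have hUx : U' x = U x := by rw [hUe.self_of_nhds, FiberBundle.extend_apply_self]
  have hVx : V' x = V x := by rw [hVe.self_of_nhds, FiberBundle.extend_apply_self]
  have hSx : S' x = S x := by rw [hSe.self_of_nhds, FiberBundle.extend_apply_self]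
  rw [e1,
    eq_of_apply_eq (F := R3) (fun S ↦ curvatureOp A U' V' S x)
      (fun s hs t ht ↦ curvatureOp_add_section A hU' hV' hs ht x)
      (fun f hf s hs ↦ curvatureOp_smul_section A hf hU' hV' hs x) hS' hS hSx,
    eq_of_apply_eq (F := R4) (fun V ↦ curvatureOp A U' V S x)
      (fun s hs t ht ↦ curvatureOp_add_right A hs ht hS x)
      (fun f hf s hs ↦ curvatureOp_smul_right A hf hs hS x) hV' hV hVx,
    curvatureOp_swap,
    eq_of_apply_eq (F := R4) (fun U ↦ curvatureOp A V U S x)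
      (fun s hs t ht ↦ curvatureOp_add_right A hs ht hS x)
      (fun f hf s hs ↦ curvatureOp_smul_right A hf hs hS x) hU' hU hUx,
    ← curvatureOp_swap]

lemma exists_vectorField {x : X} (u : TangentSpace (𝓡 4) x) : ∃ U ∈ vectorFields X, U x = u :=
  exists_smoothSection_apply_eq (F := R4) u

lemma curvatureEndo_swap {x : X} (u v : TangentSpace (𝓡 4) x) (s : E x) :
    curvatureEndo A u v s = -curvatureEndo A v u s := by
  obtain ⟨U, hU, rfl⟩ := exists_vectorField u
  obtain ⟨V, hV, rfl⟩ := exists_vectorField v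
  obtain ⟨S, hS, rfl⟩ := exists_smoothSection_apply_eq (F := R3) s
  rw [curvatureEndo_eq A hU hV hS, curvatureEndo_eq A hV hU hS, curvatureOp_swap]

lemma curvatureEndo_add_right {x : X} (u v w : TangentSpace (𝓡 4) x) (s : E x) :
    curvatureEndo A u (v + w) s = curvatureEndo A u v s + curvatureEndo A u w s := by
  obtain ⟨U, hU, rfl⟩ := exists_vectorField u
  obtain ⟨V, hV, rfl⟩ := exists_vectorField v
  obtain ⟨W, hW, rfl⟩ := exists_vectorField w
  obtain ⟨S, hS, rfl⟩ := exists_smoothSection_apply_eq (F := R3) s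
  rw [curvatureEndo_eq A hU hV hS, curvatureEndo_eq A hU hW hS,
    ← curvatureOp_add_right A hV hW hS, ← curvatureEndo_eq A hU (show (fun y ↦ V y + W y) ∈ _ from add_mem hV hW) hS]

lemma curvatureEndo_smul_right {x : X} (c : ℝ) (u v : TangentSpace (𝓡 4) x) (s : E x) :
    curvatureEndo A u (c • v) s = c • curvatureEndo A u v s := by
  obtain ⟨U, hU, rfl⟩ := exists_vectorField u
  obtain ⟨V, hV, rfl⟩ := exists_vectorField v
  obtain ⟨S, hS, rfl⟩ := exists_smoothSection_apply_eq (F := R3) s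
  rw [curvatureEndo_eq A hU hV hS,
    ← curvatureOp_smul_right A (f := fun _ ↦ c) contMDiff_const hV hS,
    ← curvatureEndo_eq A hU (show (fun y ↦ c • V y) ∈ _ from Submodule.smul_mem _ c hV) hS]

lemma curvatureEndo_add_section {x : X} (u v : TangentSpace (𝓡 4) x) (s t : E x) :
    curvatureEndo A u v (s + t) = curvatureEndo A u v s + curvatureEndo A u v t := by
  obtain ⟨U, hU, rfl⟩ := exists_vectorField u
  obtain ⟨V, hV, rfl⟩ := exists_vectorField v
  obtain ⟨S, hS, rfl⟩ := exists_smoothSection_apply_eq (F := R3) s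
  obtain ⟨T, hT, rfl⟩ := exists_smoothSection_apply_eq (F := R3) t
  rw [curvatureEndo_eq A hU hV hS, curvatureEndo_eq A hU hV hT,
    ← curvatureOp_add_section A hU hV hS hT,
    ← curvatureEndo_eq A hU hV (show (fun y ↦ S y + T y) ∈ _ from add_mem hS hT)]

lemma curvatureEndo_smul_section {x : X} (c : ℝ) (u v : TangentSpace (𝓡 4) x) (s : E x) :
    curvatureEndo A u v (c • s) = c • curvatureEndo A u v s := by
  obtain ⟨U, hU, rfl⟩ := exists_vectorField u
  obtain ⟨V, hV, rfl⟩ := exists_vectorField v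
  obtain ⟨S, hS, rfl⟩ := exists_smoothSection_apply_eq (F := R3) s
  rw [curvatureEndo_eq A hU hV hS,
    ← curvatureOp_smul_section A (f := fun _ ↦ c) contMDiff_const hU hV hS,
    ← curvatureEndo_eq A hU hV (show (fun y ↦ c • S y) ∈ _ from Submodule.smul_mem _ c hS)]

/-- `curvatureEndo` as a linear endomorphism of the fibre. -/
def curvatureEndoLinear {x : X} (u v : TangentSpace (𝓡 4) x) : E x →ₗ[ℝ] E x where
  toFun := curvatureEndo A u v
  map_add' := curvatureEndo_add_section A u v
  map_smul' c := curvatureEndo_smul_section A c u v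

variable (o : FibreOrientation E)

lemma curvature_apply {x : X} (u v : TangentSpace (𝓡 4) x) :
    curvature o A x u v = o.axial (curvatureEndo A u v) := by
  have hr (u v w : TangentSpace (𝓡 4) x) : o.axial (curvatureEndo A u (v + w)) =
      o.axial (curvatureEndo A u v) + o.axial (curvatureEndo A u w) := by
    rw [← FibreOrientation.axial_add]
    exact congrArg o.axial (funext (curvatureEndo_add_right A u v w))
  have hs (c : ℝ) (u v : TangentSpace (𝓡 4) x) : o.axial (curvatureEndo A u (c • v)) =
      c • o.axial (curvatureEndo A u v) := by
    rw [← FibreOrientation.axial_smul]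
    exact congrArg o.axial (funext (curvatureEndo_smul_right A c u v))
  have hn (u v : TangentSpace (𝓡 4) x) : o.axial (curvatureEndo A u v) =
      (-1 : ℝ) • o.axial (curvatureEndo A v u) := by
    rw [← FibreOrientation.axial_smul]
    refine congrArg o.axial (funext fun s ↦ ?_)
    rw [curvatureEndo_swap, Pi.smul_apply, neg_one_smul]
  exact bilinOfBasis_apply_eq (LinearMap.mk₂ ℝ (fun u v ↦ o.axial (curvatureEndo A u v))
    (fun u u' v ↦ by rw [hn, hr, hn u, hn u', smul_add])
    (fun c u v ↦ by rw [hn, hs, hn u, smul_comm]) hr hs) u v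

lemma curvature_self {x : X} (u : TangentSpace (𝓡 4) x) : curvature o A x u u = 0 := by
  rw [curvature_apply, show curvatureEndo A u u = (0 : ℝ) • curvatureEndo A u u from ?_,
    FibreOrientation.axial_smul, zero_smul]
  funext s
  rw [Pi.smul_apply, zero_smul]
  have h := curvatureEndo_swap A u u s
  rw [eq_neg_iff_add_eq_zero, ← two_smul ℝ] at h
  exact (smul_eq_zero.1 h).resolve_left two_ne_zero

lemma curvatureForm_self {x : X} (e : E x) (u : TangentSpace (𝓡 4) x) :
    curvatureForm o A x e u u = 0 := by
  rw [curvatureForm_apply, curvature_self, inner_zero_left]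

lemma curvatureOp_mem (hU : U ∈ vectorFields X) (hV : V ∈ vectorFields X)
    (hS : S ∈ smoothSections R3 E) : curvatureOp A U V S ∈ smoothSections R3 E :=
  sub_mem (sub_mem (covDeriv_apply_mem A hU (covDeriv_apply_mem A hV hS))
    (covDeriv_apply_mem A hV (covDeriv_apply_mem A hU hS)))
    (covDeriv_apply_mem A (mlieBracket_mem hU hV) hS)

lemma curvature_apply_mem (hU : U ∈ vectorFields X) (hV : V ∈ vectorFields X) :
    (fun x ↦ curvature o A x (U x) (V x)) ∈ smoothSections R3 E := by
  intro x₀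
  obtain ⟨e, he, hon⟩ := exists_orthonormal_frame (E := E) x₀
  have hm : (fun x ↦ (1 / 2 : ℝ) • ∑ i, o.cross x (e i x) (curvatureOp A U V (e i) x)) ∈
      smoothSections R3 E := by
    have := Submodule.smul_mem _ (1 / 2 : ℝ) (Submodule.sum_mem (t := Finset.univ) _ fun i _ ↦
      o.cross_mem_smoothSections (he i) (curvatureOp_mem A hU hV (he i)))
    convert this using 2 with x
    simp
  refine (hm x₀).congr_of_eventuallyEq ?_
  filter_upwards [hon] with x hx
  rw [curvature_apply]
  congr 1
  rw [show curvatureEndo A (U x) (V x) = curvatureEndoLinear A (U x) (V x) from rfl,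
    o.axial_eq_sum (orthonormalBasisOf hx)]
  simp only [orthonormalBasisOf_apply]
  congr 1
  refine Finset.sum_congr rfl fun i _ ↦ congrArg _ ?_
  exact curvatureEndo_eq A hU hV (he i) x

lemma curvature_mem_oneForms (hU : U ∈ vectorFields X) :
    (fun x ↦ curvature o A x (U x)) ∈ OneForms E :=
  hom_mem_smoothSections fun _ hV ↦ curvature_apply_mem A o hU hV

end Curvature

/-! ### Variation of the curvature -/

section Variation

variable {X : Type*} [TopologicalSpace X] [ChartedSpace R4 X] [IsManifold (𝓡 4) ∞ X] [T2Space X]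
  {E : X → Type*} [TopologicalSpace (TotalSpace R3 E)]
  [∀ x, NormedAddCommGroup (E x)] [∀ x, InnerProductSpace ℝ (E x)]
  [FiberBundle R3 E] [VectorBundle ℝ R3 E] [ContMDiffVectorBundle ∞ R3 E (𝓡 4)]
  [IsContMDiffRiemannianBundle (𝓡 4) ∞ R3 E]

variable (o : FibreOrientation E) (A : CovariantDerivative (𝓡 4) R3 E)

lemma addForm_apply (a : Π x : X, OneForm E x) (S : Π x, E x) (x : X)
    (u : TangentSpace (𝓡 4) x) :
    addForm o A a S x u = A S x u + o.cross x (a x u) (S x) := rfl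

variable [A.ContMDiffCovariantDerivative ∞]
  {U V : Π x : X, TangentSpace (𝓡 4) x} {S : Π x, E x} {a b : Π x : X, OneForm E x}

lemma cross_apply_mem (ha : a ∈ OneForms E) (hU : U ∈ vectorFields X)
    (hS : S ∈ smoothSections R3 E) :
    (fun x ↦ o.cross x (a x (U x)) (S x)) ∈ smoothSections R3 E :=
  o.cross_mem_smoothSections (apply_mem_smoothSections ha hU) hS

lemma contMDiffCovariantDerivative_addForm (ha : a ∈ OneForms E) :
    (addForm o A a).ContMDiffCovariantDerivative ∞ := by
  refine ⟨⟨fun {S} hS ↦ contMDiffOn_univ.2 ?_⟩⟩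
  have hS' : S ∈ smoothSections R3 E :=
    mem_smoothSections.2 (by simpa using contMDiffOn_univ.1 hS)
  exact hom_mem_smoothSections fun U hU ↦
    add_mem (covDeriv_apply_mem A hU hS') (cross_apply_mem o ha hU hS')

/-- The derivative of the curvature operator of `A + t a` at `t = 0`. -/
def curvatureOpVar (a : Π x : X, OneForm E x) (U V : Π x : X, TangentSpace (𝓡 4) x)
    (S : Π x, E x) (x : X) : E x :=
  A (fun y ↦ o.cross y (a y (V y)) (S y)) x (U x) + o.cross x (a x (U x)) (A S x (V x))
    - (A (fun y ↦ o.cross y (a y (U y)) (S y)) x (V x) + o.cross x (a x (V x)) (A S x (U x)))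
    - o.cross x (a x (VectorField.mlieBracket (𝓡 4) U V x)) (S x)

lemma curvatureOp_addForm (ha : a ∈ OneForms E) (hU : U ∈ vectorFields X)
    (hV : V ∈ vectorFields X) (hS : S ∈ smoothSections R3 E) (x : X) :
    curvatureOp (addForm o A a) U V S x = curvatureOp A U V S x + curvatureOpVar o A a U V S x +
      (o.cross x (a x (U x)) (o.cross x (a x (V x)) (S x)) -
        o.cross x (a x (V x)) (o.cross x (a x (U x)) (S x))) := by
  have h {Y Z : Π x : X, TangentSpace (𝓡 4) x} (hY : Y ∈ vectorFields X) :
      addForm o A a (fun y ↦ addForm o A a S y (Y y)) x (Z x) =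
      A (fun y ↦ A S y (Y y)) x (Z x) + A (fun y ↦ o.cross y (a y (Y y)) (S y)) x (Z x) +
      (o.cross x (a x (Z x)) (A S x (Y x)) +
        o.cross x (a x (Z x)) (o.cross x (a x (Y x)) (S x))) := by
    simp only [addForm_apply]
    rw [covDeriv_add A (covDeriv_apply_mem A hY hS) (cross_apply_mem o ha hY hS)]
    simp
  rw [curvatureOp, h hV, h hU, addForm_apply, curvatureOp, curvatureOpVar]
  abel

lemma curvatureOpVar_add (ha : a ∈ OneForms E) (hb : b ∈ OneForms E) (hU : U ∈ vectorFields X)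
    (hV : V ∈ vectorFields X) (hS : S ∈ smoothSections R3 E) (x : X) :
    curvatureOpVar o A (a + b) U V S x =
      curvatureOpVar o A a U V S x + curvatureOpVar o A b U V S x := by
  have h {Y : Π x : X, TangentSpace (𝓡 4) x} (hY : Y ∈ vectorFields X) :
      A (fun y ↦ o.cross y ((a + b) y (Y y)) (S y)) x =
      A (fun y ↦ o.cross y (a y (Y y)) (S y)) x + A (fun y ↦ o.cross y (b y (Y y)) (S y)) x := by
    rw [← covDeriv_add A (cross_apply_mem o ha hY hS) (cross_apply_mem o hb hY hS)]
    congr 1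
    funext y
    simp
  rw [curvatureOpVar, h hU, h hV, curvatureOpVar, curvatureOpVar]
  simp only [Pi.add_apply, _root_.add_apply, map_add]
  abel

lemma curvatureOpVar_smul {f : X → ℝ} (hf : ContMDiff (𝓡 4) 𝓘(ℝ, ℝ) ∞ f) (ha : a ∈ OneForms E)
    (hU : U ∈ vectorFields X) (hV : V ∈ vectorFields X) (hS : S ∈ smoothSections R3 E) (x : X) :
    curvatureOpVar o A (fun y ↦ f y • a y) U V S x = f x • curvatureOpVar o A a U V S x +
      o.cross x (mvfderiv (𝓡 4) f x (U x) • a x (V x) - mvfderiv (𝓡 4) f x (V x) • a x (U x))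
        (S x) := by
  have h {Y Z : Π x : X, TangentSpace (𝓡 4) x} (hY : Y ∈ vectorFields X) :
      A (fun y ↦ o.cross y ((f y • a y) (Y y)) (S y)) x (Z x) =
      f x • A (fun y ↦ o.cross y (a y (Y y)) (S y)) x (Z x) +
        mvfderiv (𝓡 4) f x (Z x) • o.cross x (a x (Y x)) (S x) := by
    rw [← covDeriv_smul A hf (cross_apply_mem o ha hY hS)]
    congr 2
    funext y
    simp
  rw [curvatureOpVar, h hU, h hV, curvatureOpVar]
  simp only [_root_.smul_apply, map_smul, map_sub, _root_.sub_apply]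
  module

lemma curvatureOpVar_const_smul (c : ℝ) (ha : a ∈ OneForms E)
    (hU : U ∈ vectorFields X) (hV : V ∈ vectorFields X) (hS : S ∈ smoothSections R3 E) (x : X) :
    curvatureOpVar o A (c • a) U V S x = c • curvatureOpVar o A a U V S x := by
  have := curvatureOpVar_smul o A (f := fun _ ↦ c) contMDiff_const ha hU hV hS x
  simp only [mvfderiv_const, _root_.zero_apply, zero_smul, sub_self, map_zero, add_zero] at this
  exact this

/-- The endomorphism-valued 2-form `d_A a`, as the odd part of the curvature of `A + a`. -/
def curvatureEndoVar (a : Π x : X, OneForm E x) {x : X} (u v : TangentSpace (𝓡 4) x) (s : E x) :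
    E x :=
  (1 / 2 : ℝ) • (curvatureEndo (addForm o A a) u v s - curvatureEndo (addForm o A (-a)) u v s)

lemma curvatureEndoVar_eq (ha : a ∈ OneForms E) (hU : U ∈ vectorFields X)
    (hV : V ∈ vectorFields X) (hS : S ∈ smoothSections R3 E) (x : X) :
    curvatureEndoVar o A a (U x) (V x) (S x) = curvatureOpVar o A a U V S x := by
  have := contMDiffCovariantDerivative_addForm o A ha
  have hn := contMDiffCovariantDerivative_addForm o A (neg_mem ha)
  have h := curvatureOpVar_const_smul o A (-1) ha hU hV hS x
  rw [neg_one_smul, neg_one_smul] at h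
  rw [curvatureEndoVar, curvatureEndo_eq _ hU hV hS, curvatureEndo_eq _ hU hV hS,
    curvatureOp_addForm o A ha hU hV hS, curvatureOp_addForm o A (neg_mem ha) hU hV hS, h]
  simp only [Pi.neg_apply, _root_.neg_apply, map_neg, neg_neg]
  module

/-- The variation `d_A a ∈ Λ² ⊗ E` of the curvature in the direction `a`. As the curvature of
`A + t a` is quadratic in `t`, it is the odd part of the curvature of `A + a`, and hence a smooth
tensor. -/
def curvatureVar (a : Π x : X, OneForm E x) (x : X) :
    TangentSpace (𝓡 4) x →L[ℝ] TangentSpace (𝓡 4) x →L[ℝ] E x :=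
  (1 / 2 : ℝ) • (curvature o (addForm o A a) x - curvature o (addForm o A (-a)) x)

lemma curvatureVar_apply (ha : a ∈ OneForms E) {x : X} (u v : TangentSpace (𝓡 4) x) :
    curvatureVar o A a x u v = o.axial (curvatureEndoVar o A a u v) := by
  have := contMDiffCovariantDerivative_addForm o A ha
  have hn := contMDiffCovariantDerivative_addForm o A (neg_mem ha)
  have h : curvatureEndoVar o A a u v = (1 / 2 : ℝ) • (curvatureEndo (addForm o A a) u v +
      (-1 : ℝ) • curvatureEndo (addForm o A (-a)) u v) := by
    funext s
    simp only [curvatureEndoVar, Pi.smul_apply, Pi.add_apply]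
    module
  rw [h, o.axial_smul, o.axial_add, o.axial_smul, ← curvature_apply, ← curvature_apply]
  simp only [curvatureVar, _root_.smul_apply, _root_.sub_apply]
  module

lemma curvatureVar_self (ha : a ∈ OneForms E) {x : X} (u : TangentSpace (𝓡 4) x) :
    curvatureVar o A a x u u = 0 := by
  have := contMDiffCovariantDerivative_addForm o A ha
  have hn := contMDiffCovariantDerivative_addForm o A (neg_mem ha)
  simp [curvatureVar, curvature_self]

lemma curvatureVar_apply_mem (ha : a ∈ OneForms E) (hU : U ∈ vectorFields X)
    (hV : V ∈ vectorFields X) :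
    (fun x ↦ curvatureVar o A a x (U x) (V x)) ∈ smoothSections R3 E := by
  have := contMDiffCovariantDerivative_addForm o A ha
  have hn := contMDiffCovariantDerivative_addForm o A (neg_mem ha)
  exact Submodule.smul_mem _ _ (sub_mem (curvature_apply_mem (addForm o A a) o hU hV)
    (curvature_apply_mem (addForm o A (-a)) o hU hV))

/-- The part of the curvature of `A + a` which is quadratic in `a`. -/
def curvatureQuad (a : Π x : X, OneForm E x) {x : X} (u v : TangentSpace (𝓡 4) x) : E x :=
  o.axial fun s ↦ o.cross x (a x u) (o.cross x (a x v) s) - o.cross x (a x v) (o.cross x (a x u) s)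

lemma curvature_addForm (ha : a ∈ OneForms E) (t : ℝ) {x : X} (u v : TangentSpace (𝓡 4) x) :
    curvature o (addForm o A (t • a)) x u v = curvature o A x u v +
      t • curvatureVar o A a x u v + t ^ 2 • curvatureQuad o a u v := by
  have hta : t • a ∈ OneForms E := Submodule.smul_mem _ t ha
  have := contMDiffCovariantDerivative_addForm o A hta
  rw [curvature_apply, curvature_apply, curvatureVar_apply o A ha, curvatureQuad,
    ← o.axial_smul, ← o.axial_smul, ← o.axial_add, ← o.axial_add]
  refine congrArg _ (funext fun s ↦ ?_)
  obtain ⟨U, hU, rfl⟩ := exists_vectorField u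
  obtain ⟨V, hV, rfl⟩ := exists_vectorField v
  obtain ⟨S, hS, rfl⟩ := exists_smoothSection_apply_eq (F := R3) s
  simp only [Pi.add_apply, Pi.smul_apply]
  rw [curvatureEndo_eq _ hU hV hS, curvatureEndo_eq _ hU hV hS,
    curvatureEndoVar_eq o A ha hU hV hS, curvatureOp_addForm o A hta hU hV hS,
    curvatureOpVar_const_smul o A t ha hU hV hS]
  simp only [Pi.smul_apply, _root_.smul_apply, map_smul]
  module

lemma curvatureVar_add (ha : a ∈ OneForms E) (hb : b ∈ OneForms E) (x : X) :
    curvatureVar o A (a + b) x = curvatureVar o A a x + curvatureVar o A b x := by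
  ext u v
  rw [_root_.add_apply, _root_.add_apply, curvatureVar_apply o A (add_mem ha hb),
    curvatureVar_apply o A ha, curvatureVar_apply o A hb, ← o.axial_add]
  refine congrArg _ (funext fun s ↦ ?_)
  obtain ⟨U, hU, rfl⟩ := exists_vectorField u
  obtain ⟨V, hV, rfl⟩ := exists_vectorField v
  obtain ⟨S, hS, rfl⟩ := exists_smoothSection_apply_eq (F := R3) s
  rw [Pi.add_apply, curvatureEndoVar_eq o A (add_mem ha hb) hU hV hS,
    curvatureEndoVar_eq o A ha hU hV hS, curvatureEndoVar_eq o A hb hU hV hS,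
    curvatureOpVar_add o A ha hb hU hV hS]

lemma curvatureVar_smul (c : ℝ) (ha : a ∈ OneForms E) (x : X) :
    curvatureVar o A (c • a) x = c • curvatureVar o A a x := by
  ext u v
  rw [_root_.smul_apply, _root_.smul_apply, curvatureVar_apply o A (Submodule.smul_mem _ c ha),
    curvatureVar_apply o A ha, ← o.axial_smul]
  refine congrArg _ (funext fun s ↦ ?_)
  obtain ⟨U, hU, rfl⟩ := exists_vectorField u
  obtain ⟨V, hV, rfl⟩ := exists_vectorField v
  obtain ⟨S, hS, rfl⟩ := exists_smoothSection_apply_eq (F := R3) s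
  rw [Pi.smul_apply, curvatureEndoVar_eq o A (Submodule.smul_mem _ c ha) hU hV hS,
    curvatureEndoVar_eq o A ha hU hV hS, curvatureOpVar_const_smul o A c ha hU hV hS]

/-- The principal symbol of `d_A` on 1-forms is the exterior product. -/
lemma curvatureVar_symbol {f : X → ℝ} (hf : ContMDiff (𝓡 4) 𝓘(ℝ, ℝ) ∞ f) (ha : a ∈ OneForms E)
    {x : X} (hx : f x = 0) (u v : TangentSpace (𝓡 4) x) :
    curvatureVar o A (fun y ↦ f y • a y) x u v =
      mvfderiv (𝓡 4) f x u • a x v - mvfderiv (𝓡 4) f x v • a x u := by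
  have hfa := smul_mem_smoothSections hf ha
  rw [curvatureVar_apply o A hfa, ← o.axial_cross (mvfderiv (𝓡 4) f x u • a x v - _)]
  refine congrArg _ (funext fun s ↦ ?_)
  obtain ⟨U, hU, rfl⟩ := exists_vectorField u
  obtain ⟨V, hV, rfl⟩ := exists_vectorField v
  obtain ⟨S, hS, rfl⟩ := exists_smoothSection_apply_eq (F := R3) s
  rw [curvatureEndoVar_eq o A hfa hU hV hS, curvatureOpVar_smul o A hf ha hU hV hS, hx, zero_smul,
    zero_add]

end Variation

/-! ### Exterior algebra of a tangent space -/

section FormAlgebra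

variable {X : Type*} [TopologicalSpace X] [ChartedSpace R4 X] {x : X}

variable (x) in
/-- `tangentBasis`, as a basis. -/
def tangentBasisFun : Basis (Fin 4) ℝ (TangentSpace (𝓡 4) x) :=
  (EuclideanSpace.basisFun (Fin 4) ℝ).toBasis

lemma tangentBasisFun_apply (i : Fin 4) : tangentBasisFun x i = tangentBasis x i := by
  change (EuclideanSpace.basisFun (Fin 4) ℝ).toBasis i = _
  rw [OrthonormalBasis.coe_toBasis, EuclideanSpace.basisFun_apply]
  rfl

lemma coe_tangentBasisFun : ⇑(tangentBasisFun x) = tangentBasis x :=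
  funext tangentBasisFun_apply

instance finiteDimensional_tangentSpace : FiniteDimensional ℝ (TangentSpace (𝓡 4) x) :=
  .of_basis (tangentBasisFun x)

lemma finrank_tangentSpace : finrank ℝ (TangentSpace (𝓡 4) x) = 4 := by
  simpa using finrank_eq_card_basis (tangentBasisFun x)

lemma alternating_swap {θ : TangentBilin x} (hθ : ∀ v, θ v v = 0) (u v : TangentSpace (𝓡 4) x) :
    θ u v = -θ v u := by
  have h := hθ (u + v)
  simp only [map_add, _root_.add_apply, hθ, zero_add, add_zero] at h
  linarith

/-- The value of the 4-form `θ ∧ η` on four vectors. -/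
def wedgeOn (b : Fin 4 → TangentSpace (𝓡 4) x) (θ η : TangentBilin x) : ℝ :=
  θ (b 0) (b 1) * η (b 2) (b 3) - θ (b 0) (b 2) * η (b 1) (b 3) + θ (b 0) (b 3) * η (b 1) (b 2)
    + θ (b 1) (b 2) * η (b 0) (b 3) - θ (b 1) (b 3) * η (b 0) (b 2) + θ (b 2) (b 3) * η (b 0) (b 1)

lemma wedge_eq_wedgeOn (θ η : TangentBilin x) : wedge θ η = wedgeOn (tangentBasis x) θ η := rfl

lemma wedgeOn_comm (b : Fin 4 → TangentSpace (𝓡 4) x) (θ η : TangentBilin x) :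
    wedgeOn b θ η = wedgeOn b η θ := by
  simp only [wedgeOn]; ring

lemma wedgeOn_add_left (b : Fin 4 → TangentSpace (𝓡 4) x) (θ θ' η : TangentBilin x) :
    wedgeOn b (θ + θ') η = wedgeOn b θ η + wedgeOn b θ' η := by
  simp only [wedgeOn, _root_.add_apply]; ring

lemma wedgeOn_smul_left (b : Fin 4 → TangentSpace (𝓡 4) x) (c : ℝ) (θ η : TangentBilin x) :
    wedgeOn b (c • θ) η = c * wedgeOn b θ η := by
  simp only [wedgeOn, _root_.smul_apply, smul_eq_mul]; ring

lemma wedgeOn_add_right (b : Fin 4 → TangentSpace (𝓡 4) x) (θ η η' : TangentBilin x) :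
    wedgeOn b θ (η + η') = wedgeOn b θ η + wedgeOn b θ η' := by
  simp only [wedgeOn, _root_.add_apply]; ring

lemma wedgeOn_smul_right (b : Fin 4 → TangentSpace (𝓡 4) x) (c : ℝ) (θ η : TangentBilin x) :
    wedgeOn b θ (c • η) = c * wedgeOn b θ η := by
  simp only [wedgeOn, _root_.smul_apply, smul_eq_mul]; ring

/-- `wedgeOn b` as a bilinear form in the two 2-forms. -/
def wedgeOnBilin (b : Fin 4 → TangentSpace (𝓡 4) x) :
    TangentBilin x →ₗ[ℝ] TangentBilin x →ₗ[ℝ] ℝ :=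
  LinearMap.mk₂ ℝ (wedgeOn b) (wedgeOn_add_left b) (wedgeOn_smul_left b)
    (wedgeOn_add_right b) (wedgeOn_smul_right b)

/-- The 4-form `θ ∧ η`. -/
def wedgeForm {θ η : TangentBilin x} (hθ : ∀ v, θ v v = 0) (hη : ∀ v, η v v = 0) :
    TangentSpace (𝓡 4) x [⋀^Fin 4]→ₗ[ℝ] ℝ where
  toFun b := wedgeOn b θ η
  map_update_add' := by
    intro inst b i v w
    obtain rfl : inst = instDecidableEqFin 4 := Subsingleton.elim _ _
    fin_cases i <;> simp [wedgeOn] <;> ring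
  map_update_smul' := by
    intro inst b i c v
    obtain rfl : inst = instDecidableEqFin 4 := Subsingleton.elim _ _
    fin_cases i <;> simp [wedgeOn] <;> ring
  map_eq_zero_of_eq' b i j h hij := by
    wlog hlt : i < j generalizing i j
    · exact this j i h.symm hij.symm (lt_of_le_of_ne (not_lt.1 hlt) hij.symm)
    have e := alternating_swap hθ
    have e' := alternating_swap hη
    fin_cases i <;> fin_cases j <;> simp at h hij hlt <;> simp only [wedgeOn]
    · rw [h, hθ, hη]; ring
    · rw [h, hθ, hη, e (b 2) (b 1), e' (b 2) (b 1)]; ring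
    · rw [h, hθ, hη, e (b 3) (b 1), e' (b 3) (b 1), e (b 3) (b 2), e' (b 3) (b 2)]; ring
    · rw [h, hθ, hη]; ring
    · rw [h, hθ, hη, e (b 3) (b 2), e' (b 3) (b 2)]; ring
    · rw [h, hθ, hη]; ring

/-- The value of `θ ∧ η` on a family of vectors is its coefficient `wedge θ η` times the
determinant of the family. -/
lemma wedgeOn_eq_det_mul {θ η : TangentBilin x} (hθ : ∀ v, θ v v = 0) (hη : ∀ v, η v v = 0)
    (b : Fin 4 → TangentSpace (𝓡 4) x) :
    wedgeOn b θ η = (tangentBasisFun x).det b * wedge θ η := by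
  have h := congrArg (fun f ↦ f b) ((wedgeForm hθ hη).eq_smul_basis_det (tangentBasisFun x))
  simp only [AlternatingMap.smul_apply, smul_eq_mul] at h
  rw [mul_comm, wedge_eq_wedgeOn, ← coe_tangentBasisFun]
  exact h

/-- The 2-form `α ∧ β`. -/
def wedgeOne (α β : TangentSpace (𝓡 4) x →L[ℝ] ℝ) : TangentBilin x :=
  α.smulRight β - β.smulRight α

@[simp]
lemma wedgeOne_apply (α β : TangentSpace (𝓡 4) x →L[ℝ] ℝ) (u v : TangentSpace (𝓡 4) x) :
    wedgeOne α β u v = α u * β v - β u * α v := by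
  simp [wedgeOne]

lemma wedgeOne_self (α β : TangentSpace (𝓡 4) x →L[ℝ] ℝ) (v : TangentSpace (𝓡 4) x) :
    wedgeOne α β v v = 0 := by
  rw [wedgeOne_apply]; ring

lemma bilin_ext_basis {G : Type*} [AddCommGroup G] [Module ℝ G] [TopologicalSpace G]
    [IsTopologicalAddGroup G] [ContinuousSMul ℝ G] (b : Basis (Fin 4) ℝ (TangentSpace (𝓡 4) x))
    {θ η : TangentSpace (𝓡 4) x →L[ℝ] TangentSpace (𝓡 4) x →L[ℝ] G}
    (h : ∀ i j, θ (b i) (b j) = η (b i) (b j)) : θ = η := by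
  refine ContinuousLinearMap.coe_injective (b.ext fun i ↦ ?_)
  exact ContinuousLinearMap.coe_injective (b.ext fun j ↦ h i j)

lemma alternating_ext_basis (b : Basis (Fin 4) ℝ (TangentSpace (𝓡 4) x))
    {θ η : TangentBilin x} (hθ : ∀ v, θ v v = 0) (hη : ∀ v, η v v = 0)
    (h : ∀ i j, i < j → θ (b i) (b j) = η (b i) (b j)) : θ = η := by
  refine bilin_ext_basis b fun i j ↦ ?_
  rcases lt_trichotomy i j with hij | rfl | hij
  · exact h i j hij
  · rw [hθ, hη]
  · rw [alternating_swap hθ, alternating_swap hη, h j i hij]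

/-- An alternating form is degenerate if its Pfaffian vanishes. -/
lemma exists_kernel_of_wedge_self {θ : TangentBilin x} (hθ : ∀ v, θ v v = 0)
    (h : wedge θ θ = 0) : ∃ w ≠ 0, θ w = 0 := by
  set M : Matrix (Fin 4) (Fin 4) ℝ := Matrix.of fun i j ↦ θ (tangentBasis x i) (tangentBasis x j)
  have e := alternating_swap hθ
  have hdet : M.det = (wedge θ θ / 2) ^ 2 := by
    rw [Matrix.det_succ_row_zero]
    simp only [Fin.sum_univ_four, Matrix.det_fin_three, Matrix.submatrix_apply, M, Matrix.of_apply,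
      wedge]
    simp [Fin.succAbove, hθ]
    rw [e (tangentBasis x 1) (tangentBasis x 0), e (tangentBasis x 2) (tangentBasis x 0),
      e (tangentBasis x 3) (tangentBasis x 0), e (tangentBasis x 2) (tangentBasis x 1),
      e (tangentBasis x 3) (tangentBasis x 1), e (tangentBasis x 3) (tangentBasis x 2)]
    ring
  rw [h, zero_div, zero_pow two_ne_zero] at hdet
  obtain ⟨w, hw, hwM⟩ := Matrix.exists_vecMul_eq_zero_iff.2 hdet
  refine ⟨∑ i, w i • tangentBasis x i, fun h0 ↦ hw ?_, ?_⟩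
  · rw [← coe_tangentBasisFun] at h0
    exact funext (Fintype.linearIndependent_iff.1 (tangentBasisFun x).linearIndependent w h0)
  · refine ContinuousLinearMap.coe_injective ((tangentBasisFun x).ext fun j ↦ ?_)
    have := congrFun hwM j
    simpa [Matrix.vecMul, dotProduct, M, tangentBasisFun_apply] using this

/-- A positive definite symmetric bilinear form has an orthonormal basis. -/
lemma exists_basis_orthonormal {V : Type*} [AddCommGroup V] [Module ℝ V] [FiniteDimensional ℝ V]
    {n : ℕ} (hn : finrank ℝ V = n) (B : V →ₗ[ℝ] V →ₗ[ℝ] ℝ) (hsymm : ∀ u v, B u v = B v u)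
    (hpos : ∀ v, v ≠ 0 → 0 < B v v) :
    ∃ b : Basis (Fin n) ℝ V, ∀ i j, B (b i) (b j) = if i = j then 1 else 0 := by
  subst hn
  obtain ⟨v, hv⟩ := LinearMap.BilinForm.exists_orthogonal_basis (B := B) ⟨fun u v ↦ by simp [hsymm u v]⟩
  have hp (i) : 0 < B (v i) (v i) := hpos _ (v.ne_zero i)
  refine ⟨v.unitsSMul fun i ↦ (Real.sqrt_pos.2 (hp i)).ne'.isUnit.unit⁻¹, fun i j ↦ ?_⟩
  simp only [Basis.unitsSMul_apply, Units.smul_def, map_smul, LinearMap.smul_apply, smul_eq_mul]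
  split_ifs with h
  · subst h
    have := Real.mul_self_sqrt (hp i).le
    have h0 := (Real.sqrt_pos.2 (hp i)).ne'
    simp only [Units.val_inv_eq_inv_val, IsUnit.unit_spec]
    field_simp
    nlinarith
  · rw [show B (v i) (v j) = 0 from hv h]
    simp

end FormAlgebra

/-! ### Self-dual 2-forms and the metric determined by them -/

section SelfDual

variable {X : Type*} [TopologicalSpace X] [ChartedSpace R4 X] {x : X}

/-- The coordinates with respect to a basis of `T_x X`. -/
def coordForm (b : Basis (Fin 4) ℝ (TangentSpace (𝓡 4) x)) (i : Fin 4) :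
    TangentSpace (𝓡 4) x →L[ℝ] ℝ :=
  ∑ j, b.repr (tangentBasis x j) i • tangentCoord x j

@[simp]
lemma coordForm_apply (b : Basis (Fin 4) ℝ (TangentSpace (𝓡 4) x)) (i : Fin 4)
    (v : TangentSpace (𝓡 4) x) : coordForm b i v = b.repr v i := by
  conv_rhs => rw [← sum_tangentCoord_smul v]
  simp [coordForm, mul_comm]

lemma gram_eq_mul (g : TangentBilin x) (c : Basis (Fin 4) ℝ (TangentSpace (𝓡 4) x))
    (d : Fin 4 → TangentSpace (𝓡 4) x) :
    gram g d = (c.toMatrix d).transpose * gram g c * c.toMatrix d := by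
  ext i j
  conv_lhs => rw [gram, Matrix.of_apply, ← c.sum_toMatrix_smul_self d i,
    ← c.sum_toMatrix_smul_self d j]
  simp only [Matrix.mul_apply, Matrix.transpose_apply, gram, Matrix.of_apply, map_sum, map_smul,
    _root_.sum_apply, _root_.smul_apply, smul_eq_mul, Finset.sum_mul]
  refine Finset.sum_congr rfl fun k _ ↦ ?_
  rw [Finset.mul_sum]
  refine Finset.sum_congr rfl fun l _ ↦ by ring

lemma det_gram_eq (g : TangentBilin x) (d : Fin 4 → TangentSpace (𝓡 4) x) :
    (gram g d).det = (tangentBasisFun x).det d ^ 2 * (gram g (tangentBasis x)).det := by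
  rw [gram_eq_mul g (tangentBasisFun x), Matrix.det_mul, Matrix.det_mul, Matrix.det_transpose,
    Basis.det_apply, coe_tangentBasisFun]
  ring

/-- The basis `b` is orthonormal for the bilinear form `g`. -/
def IsOrthonormalFor (g : TangentBilin x) (b : Basis (Fin 4) ℝ (TangentSpace (𝓡 4) x)) : Prop :=
  ∀ i j, g (b i) (b j) = if i = j then 1 else 0

lemma IsOrthonormalFor.gram_eq_one {g : TangentBilin x}
    {b : Basis (Fin 4) ℝ (TangentSpace (𝓡 4) x)} (hb : IsOrthonormalFor g b) : gram g b = 1 := by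
  ext i j
  rw [gram, Matrix.of_apply, hb, Matrix.one_apply]

lemma IsOrthonormalFor.apply_self {g : TangentBilin x}
    {b : Basis (Fin 4) ℝ (TangentSpace (𝓡 4) x)} (hb : IsOrthonormalFor g b)
    (v : TangentSpace (𝓡 4) x) : g v v = ∑ i, b.repr v i ^ 2 := by
  conv_lhs => rw [← b.sum_repr v]
  simp only [map_sum, map_smul, _root_.sum_apply, _root_.smul_apply, smul_eq_mul, hb _ _, pow_two]
  simp

lemma IsOrthonormalFor.pos {g : TangentBilin x}
    {b : Basis (Fin 4) ℝ (TangentSpace (𝓡 4) x)} (hb : IsOrthonormalFor g b)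
    {v : TangentSpace (𝓡 4) x} (hv : v ≠ 0) : 0 < g v v := by
  rw [hb.apply_self]
  obtain ⟨i, hi⟩ : ∃ i, b.repr v i ≠ 0 := by
    by_contra! h
    exact hv (b.repr.map_eq_zero_iff.1 (Finsupp.ext h))
  exact Finset.sum_pos' (fun _ _ ↦ sq_nonneg _) ⟨i, Finset.mem_univ _, by positivity⟩

/-- The metric contraction computed with the inverse Gram matrix of a basis is the trace over an
orthonormal basis. -/
lemma sum_gram_basis_inv {H : Type*} [AddCommGroup H] [Module ℝ H] {g : TangentBilin x}
    {b : Basis (Fin 4) ℝ (TangentSpace (𝓡 4) x)} (hb : IsOrthonormalFor g b)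
    (c : Basis (Fin 4) ℝ (TangentSpace (𝓡 4) x))
    (β : TangentSpace (𝓡 4) x →ₗ[ℝ] TangentSpace (𝓡 4) x →ₗ[ℝ] H) :
    ∑ i, ∑ j, (gram g c)⁻¹ i j • β (c i) (c j) = ∑ k, β (b k) (b k) := by
  set M := c.toMatrix b
  have hM : M.transpose * gram g c * M = 1 := by
    rw [← gram_eq_mul, hb.gram_eq_one]
  have hinv : (gram g c)⁻¹ = M * M.transpose :=
    Matrix.inv_eq_left_inv (by rw [Matrix.mul_assoc]; exact mul_eq_one_comm.1 hM)
  have hk (k) : β (b k) (b k) = ∑ i, ∑ j, (M i k * M j k) • β (c i) (c j) := by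
    conv_lhs => rw [← c.sum_toMatrix_smul_self b k]
    simp only [map_sum, map_smul, LinearMap.sum_apply, LinearMap.smul_apply, smul_smul,
      Finset.smul_sum]
    rw [Finset.sum_comm]
    exact Finset.sum_congr rfl fun i _ ↦ Finset.sum_congr rfl fun j _ ↦ by rw [mul_comm]
  simp only [hk, hinv, Matrix.mul_apply, Matrix.transpose_apply, Finset.sum_smul]
  rw [Finset.sum_comm' (t' := Finset.univ) (s' := fun _ ↦ Finset.univ) (by simp)]
  conv_rhs => rw [Finset.sum_comm]
  conv_lhs => rw [Finset.sum_comm]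
  refine Finset.sum_congr rfl fun i _ ↦ ?_
  rw [Finset.sum_comm]

lemma sum_gram_inv {H : Type*} [AddCommGroup H] [Module ℝ H] {g : TangentBilin x}
    {b : Basis (Fin 4) ℝ (TangentSpace (𝓡 4) x)} (hb : IsOrthonormalFor g b)
    (β : TangentSpace (𝓡 4) x →ₗ[ℝ] TangentSpace (𝓡 4) x →ₗ[ℝ] H) :
    ∑ i, ∑ j, (gram g (tangentBasis x))⁻¹ i j • β (tangentBasis x i) (tangentBasis x j) =
      ∑ k, β (b k) (b k) := by
  have h := sum_gram_basis_inv hb (tangentBasisFun x) β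
  rwa [coe_tangentBasisFun] at h

lemma twoFormInner_eq {g : TangentBilin x} {b : Basis (Fin 4) ℝ (TangentSpace (𝓡 4) x)}
    (hb : IsOrthonormalFor g b) (θ η : TangentBilin x) :
    twoFormInner g θ η = (1 / 2) * ∑ k, ∑ l, θ (b k) (b l) * η (b k) (b l) := by
  let β (u v : TangentSpace (𝓡 4) x) :
      TangentSpace (𝓡 4) x →ₗ[ℝ] TangentSpace (𝓡 4) x →ₗ[ℝ] ℝ :=
    LinearMap.mk₂ ℝ (fun w z ↦ θ u w * η v z) (by intros; simp; ring) (by intros; simp; ring)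
      (by intros; simp; ring) (by intros; simp; ring)
  let γ : TangentSpace (𝓡 4) x →ₗ[ℝ] TangentSpace (𝓡 4) x →ₗ[ℝ] ℝ :=
    LinearMap.mk₂ ℝ (fun u v ↦ ∑ l, θ u (b l) * η v (b l))
      (by intros; simp [add_mul, Finset.sum_add_distrib])
      (by intros; simp [Finset.mul_sum, mul_assoc])
      (by intros; simp [mul_add, Finset.sum_add_distrib])
      (by intros; simp [Finset.mul_sum]; exact Finset.sum_congr rfl fun _ _ ↦ by ring)
  have h := sum_gram_inv hb γ
  simp only [γ, LinearMap.mk₂_apply] at h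
  rw [← h, twoFormInner]
  congr 1
  refine Finset.sum_congr rfl fun i _ ↦ ?_
  rw [Finset.sum_comm]
  refine Finset.sum_congr rfl fun k _ ↦ ?_
  have h' := sum_gram_inv hb (β (tangentBasis x i) (tangentBasis x k))
  simp only [β, LinearMap.mk₂_apply] at h'
  rw [← h', smul_eq_mul, Finset.mul_sum]
  refine Finset.sum_congr rfl fun j _ ↦ ?_
  rw [Finset.mul_sum]
  exact Finset.sum_congr rfl fun l _ ↦ by rw [smul_eq_mul]; ring

lemma oneFormInner_eq {G : Type*} [NormedAddCommGroup G] [InnerProductSpace ℝ G]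
    {g : TangentBilin x} {b : Basis (Fin 4) ℝ (TangentSpace (𝓡 4) x)}
    (hb : IsOrthonormalFor g b) (a c : TangentSpace (𝓡 4) x →L[ℝ] G) :
    oneFormInner g a c = ∑ k, inner ℝ (a (b k)) (c (b k)) :=
  sum_gram_inv hb (LinearMap.mk₂ ℝ (fun u v ↦ inner ℝ (a u) (c v)) (by simp [inner_add_left])
    (by simp [inner_smul_left]) (by simp [inner_add_right]) (by simp [inner_smul_right]))

/-- The equations of the self-dual forms in an oriented orthonormal basis. -/
def IsSelfDualOn (b : Fin 4 → TangentSpace (𝓡 4) x) (θ : TangentBilin x) : Prop :=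
  θ (b 2) (b 3) = θ (b 0) (b 1) ∧ θ (b 1) (b 3) = -θ (b 0) (b 2) ∧ θ (b 1) (b 2) = θ (b 0) (b 3)

lemma mem_selfDualForms_iff {g : TangentBilin x} {b : Basis (Fin 4) ℝ (TangentSpace (𝓡 4) x)}
    (hb : IsOrthonormalFor g b) {ν : ℝ} (hν : (tangentBasisFun x).det b * ν = 1)
    {θ : TangentBilin x} :
    θ ∈ selfDualForms g ν ↔ (∀ v, θ v v = 0) ∧ IsSelfDualOn b θ := by
  change ((∀ v, θ v v = 0) ∧ ∀ η : TangentBilin x, (∀ v, η v v = 0) →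
    wedge η θ = twoFormInner g η θ * ν) ↔ _
  refine and_congr_right fun hθ ↦ ?_
  have hν0 : ν ≠ 0 := right_ne_zero_of_mul_eq_one hν
  have key {η : TangentBilin x} (hη : ∀ v, η v v = 0) :
      wedge η θ = twoFormInner g η θ * ν ↔ wedgeOn b η θ =
        η (b 0) (b 1) * θ (b 0) (b 1) + η (b 0) (b 2) * θ (b 0) (b 2) +
        η (b 0) (b 3) * θ (b 0) (b 3) + η (b 1) (b 2) * θ (b 1) (b 2) +
        η (b 1) (b 3) * θ (b 1) (b 3) + η (b 2) (b 3) * θ (b 2) (b 3) := by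
    have h1 : wedge η θ = wedgeOn b η θ * ν := by
      rw [wedgeOn_eq_det_mul hη hθ, mul_right_comm, hν, one_mul]
    rw [h1, mul_left_inj' hν0, twoFormInner_eq hb]
    have e := alternating_swap hθ
    have e' := alternating_swap hη
    simp only [Fin.sum_univ_four, hθ, hη]
    rw [e (b 1) (b 0), e (b 2) (b 0), e (b 3) (b 0), e (b 2) (b 1), e (b 3) (b 1), e (b 3) (b 2),
      e' (b 1) (b 0), e' (b 2) (b 0), e' (b 3) (b 0), e' (b 2) (b 1), e' (b 3) (b 1),
      e' (b 3) (b 2)]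
    ring_nf
  constructor
  · intro h
    have h' (i j) := (key (wedgeOne_self (coordForm b i) (coordForm b j))).1
      (h _ (wedgeOne_self _ _))
    have h1 := h' 0 1
    have h2 := h' 0 2
    have h3 := h' 0 3
    simp [wedgeOn] at h1 h2 h3
    exact ⟨by linarith, by linarith, by linarith⟩
  · rintro ⟨h1, h2, h3⟩ η hη
    rw [key hη, h1, h2, h3, wedgeOn, h1, h2, h3]
    ring

lemma IsSelfDualOn.ext {b : Basis (Fin 4) ℝ (TangentSpace (𝓡 4) x)} {θ η : TangentBilin x}
    (hθ : ∀ v, θ v v = 0) (hη : ∀ v, η v v = 0) (h : IsSelfDualOn b θ) (h' : IsSelfDualOn b η)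
    (h0 : ∀ j : Fin 3, θ (b 0) (b j.succ) = η (b 0) (b j.succ)) : θ = η := by
  have h1 : θ (b 0) (b 1) = η (b 0) (b 1) := h0 0
  have h2 : θ (b 0) (b 2) = η (b 0) (b 2) := h0 1
  have h3 : θ (b 0) (b 3) = η (b 0) (b 3) := h0 2
  refine alternating_ext_basis b hθ hη fun i j hij ↦ ?_
  fin_cases i <;> fin_cases j <;> simp at hij ⊢
  · exact h1
  · exact h2
  · exact h3
  · rw [h.2.2, h'.2.2, h3]
  · rw [h.2.1, h'.2.1, h2]
  · rw [h.1, h'.1, h1]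

/-- Urbantke's expression `∑ sgn(ijk) (ι_u Φᵢ ∧ ι_v Φⱼ) ∧ Φₖ`, a 4-form evaluated on `d`. -/
def urbantke (d : Fin 4 → TangentSpace (𝓡 4) x) (Φ : Fin 3 → TangentBilin x)
    (u v : TangentSpace (𝓡 4) x) : ℝ :=
  wedgeOn d (wedgeOne (Φ 0 u) (Φ 1 v)) (Φ 2) + wedgeOn d (wedgeOne (Φ 1 u) (Φ 2 v)) (Φ 0) +
  wedgeOn d (wedgeOne (Φ 2 u) (Φ 0 v)) (Φ 1) - wedgeOn d (wedgeOne (Φ 1 u) (Φ 0 v)) (Φ 2) -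
  wedgeOn d (wedgeOne (Φ 0 u) (Φ 2 v)) (Φ 1) - wedgeOn d (wedgeOne (Φ 2 u) (Φ 1 v)) (Φ 0)

/-- Urbantke's expression as a bilinear form. -/
def urbantkeBilin (d : Fin 4 → TangentSpace (𝓡 4) x) (Φ : Fin 3 → TangentBilin x) :
    TangentSpace (𝓡 4) x →ₗ[ℝ] TangentSpace (𝓡 4) x →ₗ[ℝ] ℝ :=
  LinearMap.mk₂ ℝ (urbantke d Φ) (by intros; simp [urbantke, wedgeOn]; ring)
    (by intros; simp [urbantke, wedgeOn]; ring) (by intros; simp [urbantke, wedgeOn]; ring)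
    (by intros; simp [urbantke, wedgeOn]; ring)

lemma urbantke_eq_det_mul {Φ : Fin 3 → TangentBilin x} (hΦ : ∀ i v, Φ i v v = 0)
    (d : Fin 4 → TangentSpace (𝓡 4) x) (u v : TangentSpace (𝓡 4) x) :
    urbantke d Φ u v = (tangentBasisFun x).det d * urbantke (tangentBasis x) Φ u v := by
  simp only [urbantke, ← wedge_eq_wedgeOn,
    wedgeOn_eq_det_mul (wedgeOne_self _ _) (hΦ _) d]
  ring

/-- Urbantke's formula: for self-dual forms `Φᵢ` the expression `urbantke` is a multiple of the
metric. -/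
lemma urbantke_eq_metric {g : TangentBilin x} {b : Basis (Fin 4) ℝ (TangentSpace (𝓡 4) x)}
    (hb : IsOrthonormalFor g b) {Φ : Fin 3 → TangentBilin x} (hΦ : ∀ i v, Φ i v v = 0)
    (h : ∀ i, IsSelfDualOn b (Φ i)) (u v : TangentSpace (𝓡 4) x) :
    urbantke b Φ u v =
      6 * (Matrix.of fun i j : Fin 3 ↦ Φ i (b 0) (b j.succ)).det * g u v := by
  set c := 6 * (Matrix.of fun i j : Fin 3 ↦ Φ i (b 0) (b j.succ)).det with hc
  have e (i) := alternating_swap (hΦ i)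
  suffices H : urbantkeBilin b Φ = c • LinearMap.mk₂ ℝ (fun u v ↦ g u v) (by simp) (by simp)
      (by simp) (by simp) from LinearMap.congr_fun (LinearMap.congr_fun H u) v
  refine b.ext fun k ↦ b.ext fun l ↦ ?_
  change urbantke b Φ (b k) (b l) = c * g (b k) (b l)
  have e10 (i) := e i (b 1) (b 0)
  have e20 (i) := e i (b 2) (b 0)
  have e30 (i) := e i (b 3) (b 0)
  have e21 (i) := (e i (b 2) (b 1)).trans (congrArg _ (h i).2.2)
  have e31 (i) := (e i (b 3) (b 1)).trans (congrArg _ (h i).2.1)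
  have e32 (i) := (e i (b 3) (b 2)).trans (congrArg _ (h i).1)
  rw [hb k l, hc, Matrix.det_fin_three]
  simp only [Matrix.of_apply, Fin.succ_zero_eq_one, Fin.succ_one_eq_two,
    show (2 : Fin 3).succ = (3 : Fin 4) from rfl]
  fin_cases k <;> fin_cases l <;> simp only [urbantke, wedgeOn, wedgeOne_apply, Fin.zero_eta,
    Fin.mk_one, Fin.reduceFinMk, hΦ, e10, e20, e30, e21, e31, e32, (h _).1, (h _).2.1,
    (h _).2.2] <;> simp <;> ring

end SelfDual

/-! ### Definite triples of 2-forms -/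

section DefiniteTriple

variable {X : Type*} [TopologicalSpace X] [ChartedSpace R4 X] {x : X}
  {G : Type*} [AddCommGroup G] [Module ℝ G]

/-- A linear map `G → Λ²` such that no tangent 2-plane is annihilated by all the forms in its
image. -/
structure IsDefiniteMap (F : G →ₗ[ℝ] TangentBilin x) : Prop where
  self : ∀ e v, F e v v = 0
  exists_ne : ∀ u v, LinearIndependent ℝ ![u, v] → ∃ e, F e u v ≠ 0

namespace IsDefiniteMap

variable {F : G →ₗ[ℝ] TangentBilin x} [FiniteDimensional ℝ G]

/-- For `u ≠ 0` the map `v ↦ F(u, v)` to the three-dimensional space `G*` has kernel `ℝ u`, so it is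
surjective. -/
lemma exists_apply_eq (hF : IsDefiniteMap F) (hG : finrank ℝ G = 3)
    {u : TangentSpace (𝓡 4) x} (hu : u ≠ 0) (φ : Dual ℝ G) : ∃ v, ∀ e, F e u v = φ e := by
  let L : TangentSpace (𝓡 4) x →ₗ[ℝ] Dual ℝ G :=
    LinearMap.mk₂ ℝ (fun v e ↦ F e u v) (by simp) (by simp) (by simp) (by simp)
  have hker : LinearMap.ker L ≤ Submodule.span ℝ {u} := by
    intro v hv
    by_contra hvu
    have hli : LinearIndependent ℝ ![u, v] := by
      refine (LinearIndependent.pair_iff' hu).2 fun c hc ↦ hvu ?_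
      exact hc ▸ Submodule.smul_mem _ _ (Submodule.mem_span_singleton_self u)
    obtain ⟨e, he⟩ := hF.exists_ne u v hli
    exact he (LinearMap.congr_fun hv e)
  have h1 := Submodule.finrank_mono hker
  rw [finrank_span_singleton hu] at h1
  have h2 := L.finrank_range_add_finrank_ker
  rw [finrank_tangentSpace] at h2
  have h3 : LinearMap.range L = ⊤ := Submodule.eq_top_of_finrank_eq (by
    have := Submodule.finrank_le (LinearMap.range L)
    rw [Subspace.dual_finrank_eq, hG] at this ⊢
    omega)
  obtain ⟨v, hv⟩ := LinearMap.range_eq_top.1 h3 φ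
  exact ⟨v, fun e ↦ LinearMap.congr_fun hv e⟩

lemma wedge_self_ne_zero (hF : IsDefiniteMap F) (hG : finrank ℝ G = 3) {e : G} (he : e ≠ 0) :
    wedge (F e) (F e) ≠ 0 := by
  intro h
  obtain ⟨w, hw, hw0⟩ := exists_kernel_of_wedge_self (hF.self e) h
  refine he ((forall_dual_apply_eq_zero_iff ℝ e).1 fun φ ↦ ?_)
  obtain ⟨v, hv⟩ := hF.exists_apply_eq hG hw φ
  rw [← hv e, hw0, _root_.zero_apply]

/-- The form `(e, f) ↦ F(e) ∧ F(f)` is anisotropic, hence definite. -/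
lemma exists_sign (hF : IsDefiniteMap F) (hG : finrank ℝ G = 3) :
    ∃ ε : ℝ, (ε = 1 ∨ ε = -1) ∧ ∀ e, e ≠ 0 → 0 < ε * wedge (F e) (F e) := by
  by_contra! H
  obtain ⟨c, hc, hc'⟩ := H 1 (Or.inl rfl)
  obtain ⟨d, hd, hd'⟩ := H (-1) (Or.inr rfl)
  have hp : wedge (F c) (F c) < 0 := lt_of_le_of_ne (by linarith) (hF.wedge_self_ne_zero hG hc)
  have hq : 0 < wedge (F d) (F d) := lt_of_le_of_ne (by linarith) (hF.wedge_self_ne_zero hG hd).symm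
  set r := wedge (F c) (F d) with hr
  have hexp (t : ℝ) : wedge (F (c + t • d)) (F (c + t • d)) =
      wedge (F d) (F d) * (t * t) + 2 * r * t + wedge (F c) (F c) := by
    rw [hr]
    simp only [wedge, map_add, map_smul, _root_.add_apply, _root_.smul_apply, smul_eq_mul]
    ring
  obtain ⟨t, ht⟩ := exists_quadratic_eq_zero (a := wedge (F d) (F d)) (b := 2 * r)
    (c := wedge (F c) (F c)) hq.ne'
    ⟨Real.sqrt (discrim (wedge (F d) (F d)) (2 * r) (wedge (F c) (F c))), by
      rw [Real.mul_self_sqrt]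
      rw [discrim]
      nlinarith [sq_nonneg r, mul_pos hq (neg_pos.2 hp)]⟩
  rw [← hexp] at ht
  have h0 : c + t • d = 0 := by
    by_contra h0
    exact hF.wedge_self_ne_zero hG h0 ht
  have : wedge (F c) (F c) = t ^ 2 * wedge (F d) (F d) := by
    rw [eq_neg_of_add_eq_zero_left h0, ← neg_smul]
    simp only [wedge, map_smul, _root_.smul_apply, smul_eq_mul]
    ring
  nlinarith [sq_nonneg t]

/-- A basis of `T_x X` in which all the forms `F(e)` satisfy the equations of the self-dual forms.
Let `fᵢ` be a basis of `G` with `F(fᵢ) ∧ F(fⱼ) = 2 ε δᵢⱼ`, choose `u ≠ 0` and `vⱼ` with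
`F(fᵢ)(u, vⱼ) = δᵢⱼ`. Adding multiples of `u` to the `vⱼ` makes the matrix of the components
`F(fᵢ)(vⱼ, vₖ)` diagonal, and a rescaling finishes the construction. -/
lemma exists_selfDual_basis (hF : IsDefiniteMap F) (hG : finrank ℝ G = 3) {ν : ℝ}
    (hν : ∀ e, e ≠ 0 → 0 < ν * wedge (F e) (F e)) (hν0 : ν ≠ 0) :
    ∃ b : Basis (Fin 4) ℝ (TangentSpace (𝓡 4) x), (tangentBasisFun x).det b * ν = 1 ∧
      ∀ e, IsSelfDualOn b (F e) := by
  have hν1 : 0 < |ν| := abs_pos.2 hν0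
  set ε : ℝ := ν / |ν| with hε
  have hε2 : ε * ε = 1 := by
    rw [hε, div_mul_div_comm, abs_mul_abs_self, div_self (mul_ne_zero hν0 hν0)]
  have hεν : ε * ν = |ν| := by
    rw [hε, div_mul_eq_mul_div, ← abs_mul_abs_self, mul_div_assoc, div_self hν1.ne', mul_one]
  obtain ⟨f, hf⟩ := exists_basis_orthonormal hG
    ((ε / 2) • LinearMap.compl₁₂ (wedgeOnBilin (tangentBasis x)) F F)
    (fun u v ↦ by
      change ε / 2 * wedgeOn _ _ _ = ε / 2 * wedgeOn _ _ _
      rw [wedgeOn_comm])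
    (fun v hv ↦ by
      change 0 < ε / 2 * wedge (F v) (F v)
      have := hν v hv
      have h2 : ε / 2 * wedge (F v) (F v) = (ν * wedge (F v) (F v)) / (2 * |ν|) := by
        rw [hε]; field_simp
      rw [h2]
      positivity)
  replace hf (i j) : wedge (F (f i)) (F (f j)) = if i = j then 2 * ε else 0 := by
    have h : ε / 2 * wedge (F (f i)) (F (f j)) = if i = j then 1 else 0 := hf i j
    split_ifs at h ⊢ <;> linear_combination 2 * ε * h - wedge (F (f i)) (F (f j)) * hε2
  set u := tangentBasis x 0 with hu_def
  have hu : u ≠ 0 := by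
    rw [hu_def, ← tangentBasisFun_apply]
    exact (tangentBasisFun x).ne_zero 0
  choose v hv using fun j ↦ hF.exists_apply_eq hG hu (f.coord j)
  have hv' (i j) : F (f i) u (v j) = if i = j then 1 else 0 := by
    rw [hv j (f i), f.coord_apply, f.repr_self, Finsupp.single_apply]
  have hself (i) := hF.self (f i)
  have hsw (i) := alternating_swap (hself i)
  have hv'' (i j) : F (f i) (v j) u = if i = j then -1 else 0 := by
    rw [hsw, hv']; split_ifs <;> simp
  -- the correction of the `vⱼ`
  let w0 : TangentSpace (𝓡 4) x := v 0 - F (f 1) (v 0) (v 1) • u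
  let w1 : TangentSpace (𝓡 4) x := v 1 + F (f 0) (v 0) (v 1) • u
  let w2 : TangentSpace (𝓡 4) x := v 2 + F (f 0) (v 0) (v 2) • u
  set D := (tangentBasisFun x).det ![u, w0, w1, w2] with hD
  have hW (i j) : wedgeOn ![u, w0, w1, w2] (F (f i)) (F (f j)) = if i = j then 2 * ε * D else 0 := by
    rw [wedgeOn_eq_det_mul (hself i) (hself j), hf, ← hD]
    split_ifs <;> ring
  have c0 (i) : F (f i) u w0 = if i = 0 then 1 else 0 := by simp [w0, hself, hv']
  have c1 (i) : F (f i) u w1 = if i = 1 then 1 else 0 := by simp [w1, hself, hv']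
  have c2 (i) : F (f i) u w2 = if i = 2 then 1 else 0 := by simp [w2, hself, hv']
  have g0 : F (f 0) w0 w1 = 0 := by simp [w0, w1, hself, hv', hv'']
  have g1 : F (f 1) w0 w1 = 0 := by simp [w0, w1, hself, hv', hv'']
  have b0 : F (f 0) w0 w2 = 0 := by simp [w0, w2, hself, hv', hv'']
  have hW' (i j) := hW i j
  simp only [wedgeOn, Matrix.cons_val, c0, c1, c2] at hW'
  have W00 := hW' 0 0
  have W11 := hW' 1 1
  have W22 := hW' 2 2
  have W01 := hW' 0 1
  have W02 := hW' 0 2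
  have W12 := hW' 1 2
  simp [g0, g1, b0] at W00 W11 W22 W01 W02 W12
  have g2 : F (f 2) w0 w1 = ε * D := by linarith
  have b1 : F (f 1) w0 w2 = -(ε * D) := by linarith
  have a0 : F (f 0) w1 w2 = ε * D := by linarith
  have hli : LinearIndependent ℝ ![u, w0, w1, w2] := by
    rw [Fintype.linearIndependent_iff]
    intro c hc
    have hc' (i) := congrArg (F (f i) u) hc
    simp [Fin.sum_univ_four, hself, c0, c1, c2] at hc'
    have e0 := hc' 0
    have e1 := hc' 1
    have e2 := hc' 2
    simp at e0 e1 e2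
    simp [Fin.sum_univ_four, e0, e1, e2, hu] at hc
    intro i
    fin_cases i <;> simp [e0, e1, e2, hc]
  have hD0 : D ≠ 0 := by
    have h := ((tangentBasisFun x).is_basis_iff_det (v := ![u, w0, w1, w2])).1
      ⟨hli, hli.span_eq_top_of_card_eq_finrank (by simp [finrank_tangentSpace])⟩
    exact h.ne_zero
  set κ : ℝ := Real.sqrt (Real.sqrt (1 / (D ^ 2 * |ν|))) with hκ
  have hκ4 : κ ^ 4 * (D ^ 2 * |ν|) = 1 := by
    have h0 : 0 < D ^ 2 * |ν| := by positivity
    rw [hκ, show 4 = 2 * 2 from rfl, pow_mul, Real.sq_sqrt (Real.sqrt_nonneg _),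
      Real.sq_sqrt (by positivity), one_div, inv_mul_cancel₀ h0.ne']
  let y : Fin 4 → TangentSpace (𝓡 4) x :=
    fun i ↦ (![κ * (ε * D), κ, κ, κ] : Fin 4 → ℝ) i • (![u, w0, w1, w2] :
      Fin 4 → TangentSpace (𝓡 4) x) i
  have hy : (tangentBasisFun x).det y * ν = 1 := by
    have h := (tangentBasisFun x).det.map_smul_univ (![κ * (ε * D), κ, κ, κ] : Fin 4 → ℝ)
      ![u, w0, w1, w2]
    change (tangentBasisFun x).det (fun i ↦ _ • _) * ν = 1
    rw [h, ← hD, Fin.prod_univ_four, ← hκ4, ← hεν]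
    simp only [Matrix.cons_val, smul_eq_mul]
    ring
  obtain ⟨hy1, hy2⟩ := ((tangentBasisFun x).is_basis_iff_det (v := y)).2
    (IsUnit.of_mul_eq_one _ hy)
  refine ⟨Basis.mk hy1 hy2.ge, by rwa [Basis.coe_mk], fun e ↦ ?_⟩
  rw [Basis.coe_mk, IsSelfDualOn, ← f.sum_repr e]
  simp only [Fin.sum_univ_three, map_add, map_smul, _root_.add_apply, _root_.smul_apply, y,
    Matrix.cons_val, smul_eq_mul, c0, c1, c2, g0, g1, g2, b0, b1, a0,
    show F (f 1) w1 w2 = 0 by linarith, show F (f 2) w1 w2 = 0 by linarith,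
    show F (f 2) w0 w2 = 0 by linarith]
  simp only [Fin.isValue, Fin.reduceEq, reduceIte]
  refine ⟨?_, ?_, ?_⟩ <;> ring

/-- If all the forms `F(e)` are self-dual, they are all the self-dual forms. -/
lemma range_eq_selfDualForms (hF : IsDefiniteMap F) (hG : finrank ℝ G = 3) {g : TangentBilin x}
    {b : Basis (Fin 4) ℝ (TangentSpace (𝓡 4) x)} (hb : IsOrthonormalFor g b) {ν : ℝ}
    (hν : (tangentBasisFun x).det b * ν = 1) (h : ∀ e, IsSelfDualOn b (F e)) :
    LinearMap.range F = selfDualForms g ν := by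
  refine le_antisymm ?_ fun θ hθ ↦ ?_
  · rintro _ ⟨e, rfl⟩
    exact (mem_selfDualForms_iff hb hν).2 ⟨hF.self e, h e⟩
  obtain ⟨hθ1, hθ2⟩ := (mem_selfDualForms_iff hb hν).1 hθ
  let L : G →ₗ[ℝ] (Fin 3 → ℝ) := LinearMap.pi fun j ↦
    { toFun := fun e ↦ F e (b 0) (b j.succ)
      map_add' := by simp
      map_smul' := by simp }
  have hL : Function.Injective L := by
    rw [injective_iff_map_eq_zero]
    intro e he
    have h0 : F e = 0 := (h e).ext (hF.self e) (by simp) (by simp [IsSelfDualOn])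
      fun j ↦ congrFun he j
    by_contra hne
    exact hF.wedge_self_ne_zero hG hne (by simp [h0, wedge])
  obtain ⟨e, he⟩ := (LinearMap.injective_iff_surjective_of_finrank_eq_finrank
    (by simp [hG])).1 hL fun j ↦ θ (b 0) (b j.succ)
  exact ⟨e, (h e).ext (hF.self e) hθ1 hθ2 fun j ↦ congrFun he j⟩

lemma urbantke_eq (hF : IsDefiniteMap F) (hG : finrank ℝ G = 3) {g : TangentBilin x}
    {b : Basis (Fin 4) ℝ (TangentSpace (𝓡 4) x)} (hb : IsOrthonormalFor g b)
    (h : ∀ e, IsSelfDualOn b (F e)) (d : Basis (Fin 4) ℝ (TangentSpace (𝓡 4) x))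
    {e : Fin 3 → G} (he : LinearIndependent ℝ e) :
    ∃ k : ℝ, k ≠ 0 ∧ ∀ u v, urbantke d (fun i ↦ F (e i)) u v = k * g u v := by
  set M : Matrix (Fin 3) (Fin 3) ℝ := Matrix.of fun i j ↦ F (e i) (b 0) (b j.succ)
  have hM : M.det ≠ 0 := by
    intro hM
    obtain ⟨c, hc, hc'⟩ := Matrix.exists_vecMul_eq_zero_iff.2 hM
    have h0 : F (∑ i, c i • e i) = 0 := (h _).ext (hF.self _) (by simp) (by simp [IsSelfDualOn])
      fun j ↦ by
        have := congrFun hc' j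
        simpa [Matrix.vecMul, dotProduct, M] using this
    have h1 : ∑ i, c i • e i = 0 := by
      by_contra hne
      exact hF.wedge_self_ne_zero hG hne (by simp [h0, wedge])
    exact hc (funext (Fintype.linearIndependent_iff.1 he c h1))
  have hdet (y : Basis (Fin 4) ℝ (TangentSpace (𝓡 4) x)) : (tangentBasisFun x).det y ≠ 0 :=
    ((tangentBasisFun x).isUnit_det y).ne_zero
  refine ⟨(tangentBasisFun x).det d * ((tangentBasisFun x).det b)⁻¹ * (6 * M.det), by
    have := hdet d
    have := hdet b
    positivity, fun u v ↦ ?_⟩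
  have h1 := urbantke_eq_metric hb (fun i ↦ hF.self (e i)) (fun i ↦ h (e i)) u v
  rw [urbantke_eq_det_mul (fun i ↦ hF.self (e i))] at h1 ⊢
  rw [mul_assoc _ (6 * M.det), ← h1, ← mul_assoc, mul_assoc _ _ ((tangentBasisFun x).det b),
    inv_mul_cancel₀ (hdet b), mul_one]

/-- An expression of the metric in terms of the forms `F(eᵢ)` and the volume form. -/
lemma metric_eq (hF : IsDefiniteMap F) (hG : finrank ℝ G = 3) {g : TangentBilin x}
    {b : Basis (Fin 4) ℝ (TangentSpace (𝓡 4) x)} (hb : IsOrthonormalFor g b)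
    (h : ∀ e, IsSelfDualOn b (F e)) {ν : ℝ} (hν : (tangentBasisFun x).det b * ν = 1)
    (d : Basis (Fin 4) ℝ (TangentSpace (𝓡 4) x)) {e : Fin 3 → G} (he : LinearIndependent ℝ e) :
    let U := urbantke d (fun i ↦ F (e i))
    let κ := U (d 0) (d 0) * (Real.sqrt (U (d 0) (d 0) ^ 2))⁻¹ * Real.sqrt (Real.sqrt
      ((Matrix.of fun i j ↦ U (d i) (d j)).det * (((tangentBasisFun x).det d * ν) ^ 2)⁻¹))
    U (d 0) (d 0) ≠ 0 ∧ (Matrix.of fun i j ↦ U (d i) (d j)).det ≠ 0 ∧ κ ≠ 0 ∧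
      ∀ u v, g u v = U u v * κ⁻¹ := by
  intro U κ
  obtain ⟨k, hk, hU⟩ := hF.urbantke_eq hG hb h d he
  have hd := ((tangentBasisFun x).isUnit_det d).ne_zero
  have hν0 : ν ≠ 0 := right_ne_zero_of_mul_eq_one hν
  have hg00 : 0 < g (d 0) (d 0) := hb.pos (d.ne_zero 0)
  have hgram : (gram g d).det = ((tangentBasisFun x).det d * ν) ^ 2 := by
    have h1 := det_gram_eq g b
    rw [hb.gram_eq_one, Matrix.det_one] at h1
    rw [det_gram_eq, mul_pow]
    congr 1
    linear_combination -(gram g (tangentBasis x)).det *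
      (((tangentBasisFun x).det b * ν) + 1) * hν - ν ^ 2 * h1
  have hdetU : (Matrix.of fun i j ↦ U (d i) (d j)).det =
      k ^ 4 * ((tangentBasisFun x).det d * ν) ^ 2 := by
    rw [← hgram, show (Matrix.of fun i j ↦ U (d i) (d j)) = k • gram g d by
      ext i j; simp [U, hU, gram], Matrix.det_smul]
    simp
  have hκ : κ = k := by
    have h1 : (Matrix.of fun i j ↦ U (d i) (d j)).det *
        (((tangentBasisFun x).det d * ν) ^ 2)⁻¹ = (|k| ^ 2) ^ 2 := by
      rw [hdetU, mul_assoc, mul_inv_cancel₀ (pow_ne_zero 2 (mul_ne_zero hd hν0)), mul_one, sq_abs]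
      ring
    have h2 : U (d 0) (d 0) = k * g (d 0) (d 0) := hU _ _
    change U (d 0) (d 0) * (Real.sqrt (U (d 0) (d 0) ^ 2))⁻¹ * Real.sqrt (Real.sqrt _) = k
    rw [h1, Real.sqrt_sq (sq_nonneg |k|), Real.sqrt_sq (abs_nonneg k), Real.sqrt_sq_eq_abs, h2,
      abs_mul, abs_of_pos hg00]
    have : |k| ≠ 0 := abs_ne_zero.2 hk
    field_simp
  refine ⟨?_, ?_, hκ ▸ hk, fun u v ↦ ?_⟩
  · rw [show U (d 0) (d 0) = k * g (d 0) (d 0) from hU _ _]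
    positivity
  · rw [hdetU]
    positivity
  · rw [show U u v = k * g u v from hU _ _, hκ]
    field_simp

end IsDefiniteMap

/-- The inner product with a given orthonormal basis. -/
def metricOfBasis (b : Basis (Fin 4) ℝ (TangentSpace (𝓡 4) x)) : TangentBilin x :=
  ∑ i, (coordForm b i).smulRight (coordForm b i)

lemma isOrthonormalFor_metricOfBasis (b : Basis (Fin 4) ℝ (TangentSpace (𝓡 4) x)) :
    IsOrthonormalFor (metricOfBasis b) b := by
  intro i j
  simp [metricOfBasis, Finsupp.single_apply, eq_comm]

/-- A metric with volume form `|ν|` has an orthonormal basis that is oriented by `ν`. -/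
lemma exists_oriented_orthonormal_basis {g : TangentBilin x} (hsymm : ∀ u v, g u v = g v u)
    (hpos : ∀ v, v ≠ 0 → 0 < g v v) {ν : ℝ} (hν0 : ν ≠ 0)
    (hν : |ν| = Real.sqrt (gram g (tangentBasis x)).det) :
    ∃ b : Basis (Fin 4) ℝ (TangentSpace (𝓡 4) x), IsOrthonormalFor g b ∧
      (tangentBasisFun x).det b * ν = 1 := by
  obtain ⟨b, hb⟩ := exists_basis_orthonormal finrank_tangentSpace
    (LinearMap.mk₂ ℝ (fun u v ↦ g u v) (by simp) (by simp) (by simp) (by simp)) hsymm hpos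
  replace hb : IsOrthonormalFor g b := hb
  have h1 := det_gram_eq g b
  rw [hb.gram_eq_one, Matrix.det_one] at h1
  have h2 : ν ^ 2 = (gram g (tangentBasis x)).det := by
    rw [← sq_abs, hν, Real.sq_sqrt]
    by_contra! hneg
    rw [Real.sqrt_eq_zero_of_nonpos hneg.le, abs_eq_zero] at hν
    exact hν0 hν
  have h3 : ((tangentBasisFun x).det b * ν) ^ 2 = 1 := by rw [mul_pow, h2, ← h1]
  rcases mul_self_eq_one_iff.1 ((sq _).symm.trans h3) with h4 | h4
  · exact ⟨b, hb, h4⟩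
  let w : Fin 4 → ℝˣ := ![-1, 1, 1, 1]
  refine ⟨b.unitsSMul w, fun i j ↦ ?_, ?_⟩
  · have := hb i j
    fin_cases i <;> fin_cases j <;> simp_all [Basis.unitsSMul_apply, w]
  · have h := (tangentBasisFun x).det.map_smul_univ (fun i ↦ ((w i : ℝˣ) : ℝ)) b
    have h5 : ⇑(b.unitsSMul w) = fun i ↦ ((w i : ℝˣ) : ℝ) • b i := by
      funext i; rw [Basis.unitsSMul_apply]; rfl
    rw [h5, h, Fin.prod_univ_four]
    simp [w, h4]

end DefiniteTriple

/-! ### The metric of a definite connection -/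

section AssociatedMetric

variable {X : Type*} [TopologicalSpace X] [ChartedSpace R4 X] [IsManifold (𝓡 4) ∞ X] [T2Space X]
  {E : X → Type*} [TopologicalSpace (TotalSpace R3 E)]
  [∀ x, NormedAddCommGroup (E x)] [∀ x, InnerProductSpace ℝ (E x)]
  [FiberBundle R3 E] [VectorBundle ℝ R3 E] [ContMDiffVectorBundle ∞ R3 E (𝓡 4)]
  [IsContMDiffRiemannianBundle (𝓡 4) ∞ R3 E]

variable {o : FibreOrientation E} {A : CovariantDerivative (𝓡 4) R3 E}

lemma volumeForm_eq {x : X} (b : OrthonormalBasis (Fin 3) ℝ (E x)) :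
    volumeForm o A x = (1 / 3) *
      ∑ i, wedge (curvatureForm o A x (b i)) (curvatureForm o A x (b i)) := by
  rw [volumeForm, sum_stdOrthonormalBasis x
    fun e ↦ wedge (curvatureForm o A x e) (curvatureForm o A x e)]
  congr 1
  exact sum_orthonormalBasis_eq (LinearMap.compl₁₂ (wedgeOnBilin (tangentBasis x))
    (curvatureForm o A x) (curvatureForm o A x)) _ _

variable [A.ContMDiffCovariantDerivative ∞]

lemma contMDiff_curvatureForm_apply {e : Π x, E x} {U V : Π x : X, TangentSpace (𝓡 4) x}
    (he : e ∈ smoothSections R3 E) (hU : U ∈ vectorFields X) (hV : V ∈ vectorFields X) :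
    ContMDiff (𝓡 4) 𝓘(ℝ, ℝ) ∞ (fun x ↦ curvatureForm o A x (e x) (U x) (V x)) := by
  simp only [curvatureForm_apply]
  exact ContMDiff.inner_bundle (curvature_apply_mem A o hU hV) he

lemma contMDiff_wedgeOn {θ η : Π x : X, TangentBilin x}
    (hθ : ∀ U ∈ vectorFields X, ∀ V ∈ vectorFields X,
      ContMDiff (𝓡 4) 𝓘(ℝ, ℝ) ∞ (fun x ↦ θ x (U x) (V x)))
    (hη : ∀ U ∈ vectorFields X, ∀ V ∈ vectorFields X,
      ContMDiff (𝓡 4) 𝓘(ℝ, ℝ) ∞ (fun x ↦ η x (U x) (V x)))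
    {d : Fin 4 → Π x : X, TangentSpace (𝓡 4) x} (hd : ∀ i, d i ∈ vectorFields X) :
    ContMDiff (𝓡 4) 𝓘(ℝ, ℝ) ∞ (fun x ↦ wedgeOn (fun i ↦ d i x) (θ x) (η x)) := by
  have h (i j) := hθ _ (hd i) _ (hd j)
  have h' (i j) := hη _ (hd i) _ (hd j)
  simp only [wedgeOn]
  exact ((((((h 0 1).mul (h' 2 3)).sub ((h 0 2).mul (h' 1 3))).add
    ((h 0 3).mul (h' 1 2))).add ((h 1 2).mul (h' 0 3))).sub
    ((h 1 3).mul (h' 0 2))).add ((h 2 3).mul (h' 0 1))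

lemma contMDiff_urbantke {e : Fin 3 → Π x, E x} {d : Fin 4 → Π x : X, TangentSpace (𝓡 4) x}
    {U V : Π x : X, TangentSpace (𝓡 4) x} (he : ∀ i, e i ∈ smoothSections R3 E)
    (hd : ∀ i, d i ∈ vectorFields X) (hU : U ∈ vectorFields X) (hV : V ∈ vectorFields X) :
    ContMDiff (𝓡 4) 𝓘(ℝ, ℝ) ∞ (fun x ↦ urbantke (fun i ↦ d i x)
      (fun i ↦ curvatureForm o A x (e i x)) (U x) (V x)) := by
  have h (i j k) := contMDiff_curvatureForm_apply (o := o) (A := A) (he i) (hd j) (hd k)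
  have hu (i j) := contMDiff_curvatureForm_apply (o := o) (A := A) (he i) hU (hd j)
  have hv (i j) := contMDiff_curvatureForm_apply (o := o) (A := A) (he i) hV (hd j)
  have hw (i j k) : ContMDiff (𝓡 4) 𝓘(ℝ, ℝ) ∞ (fun x ↦ wedgeOn (fun i ↦ d i x)
      (wedgeOne (curvatureForm o A x (e i x) (U x)) (curvatureForm o A x (e j x) (V x)))
      (curvatureForm o A x (e k x))) := by
    have hp (l m) := ((hu i l).mul (hv j m)).sub ((hv j l).mul (hu i m))
    simp only [wedgeOn, wedgeOne_apply]
    exact ((((((hp 0 1).mul (h k 2 3)).sub ((hp 0 2).mul (h k 1 3))).add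
      ((hp 0 3).mul (h k 1 2))).add ((hp 1 2).mul (h k 0 3))).sub
      ((hp 1 3).mul (h k 0 2))).add ((hp 2 3).mul (h k 0 1))
  exact (((((hw 0 1 2).add (hw 1 2 0)).add (hw 2 0 1)).sub (hw 1 0 2)).sub (hw 0 2 1)).sub
    (hw 2 1 0)

lemma IsDefinite.isDefiniteMap (hdef : IsDefinite o A) (x : X) :
    IsDefiniteMap (curvatureForm o A x) where
  self e v := curvatureForm_self A o e v
  exists_ne u v h := ⟨curvature o A x u v, by
    rw [curvatureForm_apply]
    exact inner_self_ne_zero.2 (hdef x u v h)⟩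

lemma IsDefinite.volumeForm_mul_wedge_pos (hdef : IsDefinite o A) {x : X} {e : E x} (he : e ≠ 0) :
    0 < volumeForm o A x * wedge (curvatureForm o A x e) (curvatureForm o A x e) := by
  have := finiteDimensional_fibre (E := E) x
  obtain ⟨ε, hε, h⟩ := (hdef.isDefiniteMap x).exists_sign (finrank_fibre x)
  have h1 : 0 < ε * volumeForm o A x := by
    rw [volumeForm_eq (fibreBasis x), mul_left_comm, Finset.mul_sum]
    have : 0 < ∑ i, ε * wedge (curvatureForm o A x (fibreBasis x i))
        (curvatureForm o A x (fibreBasis x i)) :=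
      Finset.sum_pos (fun i _ ↦ h _ ((fibreBasis x).orthonormal.ne_zero i)) Finset.univ_nonempty
    positivity
  have h2 : ε * ε = 1 := by rcases hε with rfl | rfl <;> norm_num
  have h3 := mul_pos h1 (h e he)
  rwa [mul_mul_mul_comm, h2, one_mul] at h3

lemma IsDefinite.volumeForm_ne_zero (hdef : IsDefinite o A) (x : X) : volumeForm o A x ≠ 0 :=
  left_ne_zero_of_mul (hdef.volumeForm_mul_wedge_pos
    ((fibreBasis (E := E) x).orthonormal.ne_zero 0)).ne'

lemma IsDefinite.exists_selfDual_basis (hdef : IsDefinite o A) (x : X) :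
    ∃ b : Basis (Fin 4) ℝ (TangentSpace (𝓡 4) x),
      (tangentBasisFun x).det b * volumeForm o A x = 1 ∧
      ∀ e, IsSelfDualOn b (curvatureForm o A x e) := by
  have := finiteDimensional_fibre (E := E) x
  exact (hdef.isDefiniteMap x).exists_selfDual_basis (finrank_fibre x)
    (fun e he ↦ hdef.volumeForm_mul_wedge_pos he) (hdef.volumeForm_ne_zero x)

/-- An oriented basis of `T_x X` in which all `F_A(e)` are self-dual. -/
def IsDefinite.selfDualBasis (hdef : IsDefinite o A) (x : X) :
    Basis (Fin 4) ℝ (TangentSpace (𝓡 4) x) :=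
  (hdef.exists_selfDual_basis x).choose

/-- The inner product on `T_x X` given by the definite connection. -/
def IsDefinite.inner (hdef : IsDefinite o A) (x : X) : TangentBilin x :=
  metricOfBasis (hdef.selfDualBasis x)

/-- The expression of the metric by the curvature in local frames shows that it is smooth. -/
lemma IsDefinite.contMDiff_inner_apply (hdef : IsDefinite o A)
    {U V : Π x : X, TangentSpace (𝓡 4) x} (hU : U ∈ vectorFields X) (hV : V ∈ vectorFields X) :
    ContMDiff (𝓡 4) 𝓘(ℝ, ℝ) ∞ (fun x ↦ hdef.inner x (U x) (V x)) := by
  intro x₀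
  obtain ⟨d, hd, hdli⟩ := exists_frame (F := R4) (V := (TangentSpace (𝓡 4) : X → Type _))
    (EuclideanSpace.basisFun (Fin 4) ℝ).toBasis x₀
  obtain ⟨e, he, hon⟩ := exists_orthonormal_frame (E := E) x₀
  let u (U V : Π x : X, TangentSpace (𝓡 4) x) (x : X) : ℝ := urbantke (fun i ↦ d i x)
    (fun i ↦ curvatureForm o A x (e i x)) (U x) (V x)
  let m (x : X) : ℝ := (1 / 3) * ∑ i, wedgeOn (fun i ↦ d i x)
    (curvatureForm o A x (e i x)) (curvatureForm o A x (e i x))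
  have hm : ContMDiff (𝓡 4) 𝓘(ℝ, ℝ) ∞ m := contMDiff_const.mul
    (contMDiff_finsetSum fun i _ ↦ contMDiff_wedgeOn
      (fun _ hU _ hV ↦ contMDiff_curvatureForm_apply (he i) hU hV)
      (fun _ hU _ hV ↦ contMDiff_curvatureForm_apply (he i) hU hV) hd)
  have hu {U V : Π x : X, TangentSpace (𝓡 4) x} (hU : U ∈ vectorFields X)
      (hV : V ∈ vectorFields X) : ContMDiff (𝓡 4) 𝓘(ℝ, ℝ) ∞ (u U V) :=
    contMDiff_urbantke he hd hU hV
  let κ (x : X) : ℝ := u (d 0) (d 0) x * (Real.sqrt (u (d 0) (d 0) x ^ 2))⁻¹ *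
    Real.sqrt (Real.sqrt ((Matrix.of fun i j ↦ u (d i) (d j) x).det * ((m x) ^ 2)⁻¹))
  have key : ∀ᶠ x in 𝓝 x₀, u (d 0) (d 0) x ≠ 0 ∧ (Matrix.of fun i j ↦ u (d i) (d j) x).det ≠ 0 ∧
      m x ≠ 0 ∧ κ x ≠ 0 ∧ hdef.inner x (U x) (V x) = u U V x * (κ x)⁻¹ := by
    filter_upwards [hdli, hon] with x hx hx'
    have := finiteDimensional_fibre (E := E) x
    have hb := (hdef.exists_selfDual_basis x).choose_spec
    have hmx : m x = (tangentBasisFun x).det (fun i ↦ d i x) * volumeForm o A x := by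
      rw [volumeForm_eq (orthonormalBasisOf hx')]
      simp only [m, orthonormalBasisOf_apply, wedgeOn_eq_det_mul (curvatureForm_self A o _)
        (curvatureForm_self A o _) fun i ↦ d i x]
      rw [← Finset.mul_sum]
      ring
    let D := Basis.mk hx.1 hx.2
    have hD : ⇑D = fun i ↦ d i x := Basis.coe_mk _ _
    obtain ⟨h1, h2, h3, h4⟩ := (hdef.isDefiniteMap x).metric_eq (finrank_fibre x)
      (isOrthonormalFor_metricOfBasis _) hb.2 hb.1 D hx'.linearIndependent
    rw [hD, ← hmx] at h3 h4
    rw [hD] at h1 h2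
    refine ⟨h1, h2, ?_, h3, h4 (U x) (V x)⟩
    rw [hmx, ← hD]
    exact mul_ne_zero ((tangentBasisFun x).isUnit_det D).ne_zero (hdef.volumeForm_ne_zero x)
  obtain ⟨h1, h2, h3, h4, -⟩ := key.self_of_nhds
  have hu00 := hu (hd 0) (hd 0) x₀
  have hdet : ContMDiffAt (𝓡 4) 𝓘(ℝ, ℝ) ∞
      (fun x ↦ (Matrix.of fun i j ↦ u (d i) (d j) x).det * ((m x) ^ 2)⁻¹) x₀ :=
    (contMDiffAt_det fun i j ↦ hu (hd i) (hd j) x₀).mul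
      (contMDiffAt_inv ((hm x₀).pow 2) (pow_ne_zero 2 h3))
  have hκ0 := right_ne_zero_of_mul h4
  have hκ1 : Real.sqrt ((Matrix.of fun i j ↦ u (d i) (d j) x₀).det * ((m x₀) ^ 2)⁻¹) ≠ 0 := by
    intro h
    rw [h, Real.sqrt_zero] at hκ0
    exact hκ0 rfl
  have hκ : ContMDiffAt (𝓡 4) 𝓘(ℝ, ℝ) ∞ κ x₀ := by
    refine (hu00.mul (contMDiffAt_inv (contMDiffAt_sqrt (hu00.pow 2) (pow_ne_zero 2 h1)) ?_)).mul
      (contMDiffAt_sqrt (contMDiffAt_sqrt hdet ?_) hκ1)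
    · rw [Real.sqrt_sq_eq_abs]
      exact abs_ne_zero.2 h1
    · intro h
      rw [h, Real.sqrt_zero] at hκ1
      exact hκ1 rfl
  refine ((hu hU hV x₀).mul (contMDiffAt_inv hκ h4)).congr_of_eventuallyEq ?_
  filter_upwards [key] with x hx using hx.2.2.2.2

/-- The unit ball of an inner product on `T_x X` is bounded. -/
lemma isVonNBounded_of_isOrthonormalFor {x : X} {g : TangentBilin x}
    {b : Basis (Fin 4) ℝ (TangentSpace (𝓡 4) x)} (hb : IsOrthonormalFor g b) :
    Bornology.IsVonNBounded ℝ {v | g v v < 1} := by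
  have hsub : {v | g v v < 1} ⊆
      (fun c : Fin 4 → ℝ ↦ ∑ i, c i • b i) '' Set.pi Set.univ fun _ ↦ Set.Icc (-1) 1 := by
    intro v hv
    refine ⟨fun i ↦ b.repr v i, fun i _ ↦ ?_, b.sum_repr v⟩
    rw [mem_ofPred_eq, hb.apply_self] at hv
    have h1 := Finset.single_le_sum (f := fun i ↦ b.repr v i ^ 2) (fun i _ ↦ sq_nonneg _)
      (Finset.mem_univ i)
    exact abs_le.1 (abs_le_one_iff_mul_self_le_one.2 (by nlinarith))
  refine Bornology.IsVonNBounded.subset hsub ?_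
  have hc : IsCompact ((fun c : Fin 4 → ℝ ↦ ∑ i, c i • b i) ''
      Set.pi Set.univ fun _ ↦ Set.Icc (-1) 1) :=
    (isCompact_univ_pi fun _ ↦ isCompact_Icc).image
      (continuous_finsetSum _ fun i _ ↦ (continuous_apply i).smul continuous_const)
  exact (NormedSpace.isVonNBounded_iff ℝ (E := R4)).2 (IsCompact.isBounded (α := R4) hc)

/-- The Riemannian metric `g_A` of a definite connection. -/
def IsDefinite.metric (hdef : IsDefinite o A) :
    ContMDiffRiemannianMetric (𝓡 4) ∞ R4 (TangentSpace (𝓡 4) : X → Type _) where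
  inner := hdef.inner
  symm x v w := by
    simp [IsDefinite.inner, metricOfBasis, mul_comm]
  pos x v hv := (isOrthonormalFor_metricOfBasis _).pos hv
  isVonNBounded x := isVonNBounded_of_isOrthonormalFor (isOrthonormalFor_metricOfBasis _)
  contMDiff := hom_mem_smoothSections (F := R4) (V := (TangentSpace (𝓡 4) : X → Type _))
    (V' := fun x ↦ TangentSpace (𝓡 4) x →L[ℝ] ℝ) fun U hU ↦
    hom_mem_smoothSections (F := R4) (V := (TangentSpace (𝓡 4) : X → Type _))
    (V' := Bundle.Trivial X ℝ) fun V hV x₀ ↦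
      contMDiffAt_section_trivial_iff.2 (hdef.contMDiff_inner_apply hU hV x₀)

lemma IsDefinite.exists_orthonormal_selfDual (hdef : IsDefinite o A)
    {g : ContMDiffRiemannianMetric (𝓡 4) ∞ R4 (TangentSpace (𝓡 4) : X → Type _)}
    (hg : IsAssociatedMetric o A g) (x : X) :
    ∃ b : Basis (Fin 4) ℝ (TangentSpace (𝓡 4) x), IsOrthonormalFor (g.inner x) b ∧
      (tangentBasisFun x).det b * volumeForm o A x = 1 ∧
      ∀ e, IsSelfDualOn b (curvatureForm o A x e) := by
  obtain ⟨b, hb, hν⟩ := exists_oriented_orthonormal_basis (g.symm x) (g.pos x)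
    (hdef.volumeForm_ne_zero x) (hg x).1
  refine ⟨b, hb, hν, fun e ↦ ((mem_selfDualForms_iff hb hν).1 ?_).2⟩
  rw [← (hg x).2]
  exact LinearMap.mem_range_self _ e

lemma IsDefinite.isAssociatedMetric_metric (hdef : IsDefinite o A) :
    IsAssociatedMetric o A hdef.metric := by
  intro x
  have := finiteDimensional_fibre (E := E) x
  have hb := (hdef.exists_selfDual_basis x).choose_spec
  have hbo := isOrthonormalFor_metricOfBasis (hdef.selfDualBasis x)
  refine ⟨?_, (hdef.isDefiniteMap x).range_eq_selfDualForms (finrank_fibre x) hbo hb.1 hb.2⟩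
  have h1 := det_gram_eq (hdef.inner x) (hdef.selfDualBasis x)
  rw [show gram (hdef.inner x) (hdef.selfDualBasis x) = 1 from hbo.gram_eq_one,
    Matrix.det_one] at h1
  change _ = Real.sqrt (gram (hdef.inner x) (tangentBasis x)).det
  have h2 : (tangentBasisFun x).det (hdef.selfDualBasis x) * volumeForm o A x = 1 := hb.1
  rw [← Real.sqrt_sq_eq_abs]
  congr 1
  linear_combination (gram (hdef.inner x) (tangentBasis x)).det *
      (((tangentBasisFun x).det (hdef.selfDualBasis x) * volumeForm o A x) + 1) * h2 +
      volumeForm o A x ^ 2 * h1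

lemma IsDefinite.eq_of_isAssociatedMetric (hdef : IsDefinite o A)
    {g g' : ContMDiffRiemannianMetric (𝓡 4) ∞ R4 (TangentSpace (𝓡 4) : X → Type _)}
    (hg : IsAssociatedMetric o A g) (hg' : IsAssociatedMetric o A g') : g = g' := by
  have h : g.inner = g'.inner := by
    funext x
    have := finiteDimensional_fibre (E := E) x
    obtain ⟨b, hb, hν, hs⟩ := hdef.exists_orthonormal_selfDual hg x
    obtain ⟨b', hb', hν', hs'⟩ := hdef.exists_orthonormal_selfDual hg' x
    have h1 := ((hdef.isDefiniteMap x).metric_eq (finrank_fibre x) hb hs hν (tangentBasisFun x)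
      (fibreBasis x).orthonormal.linearIndependent).2.2.2
    have h2 := ((hdef.isDefiniteMap x).metric_eq (finrank_fibre x) hb' hs' hν' (tangentBasisFun x)
      (fibreBasis x).orthonormal.linearIndependent).2.2.2
    ext u v
    rw [h1, h2]
  cases g
  cases g'
  congr

end AssociatedMetric

/-! ### The linearisation of `Q` -/

section Linearisation

variable {X : Type*} [TopologicalSpace X] [ChartedSpace R4 X] [IsManifold (𝓡 4) ∞ X] [T2Space X]
  {E : X → Type*} [TopologicalSpace (TotalSpace R3 E)]
  [∀ x, NormedAddCommGroup (E x)] [∀ x, InnerProductSpace ℝ (E x)]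
  [FiberBundle R3 E] [VectorBundle ℝ R3 E] [ContMDiffVectorBundle ∞ R3 E (𝓡 4)]
  [IsContMDiffRiemannianBundle (𝓡 4) ∞ R3 E]

/-- The map `e ↦ ⟨β, e⟩` from `E_x` to bilinear forms on `T_x X` defined by `β ∈ T* ⊗ T* ⊗ E`. -/
def pairForm {x : X} (β : TangentSpace (𝓡 4) x →L[ℝ] TangentSpace (𝓡 4) x →L[ℝ] E x) :
    E x →ₗ[ℝ] TangentBilin x where
  toFun e := bilinOfBasis x fun i j ↦ inner ℝ (β (tangentBasis x i) (tangentBasis x j)) e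
  map_add' e f := by
    ext u v
    simp [bilinOfBasis, inner_add_right, mul_add, Finset.sum_add_distrib]
  map_smul' c e := by
    ext u v
    simp [bilinOfBasis, inner_smul_right, Finset.mul_sum]
    exact Finset.sum_congr rfl fun i _ ↦ Finset.sum_congr rfl fun j _ ↦ by ring

lemma pairForm_apply {x : X} (β : TangentSpace (𝓡 4) x →L[ℝ] TangentSpace (𝓡 4) x →L[ℝ] E x)
    (e : E x) (u v : TangentSpace (𝓡 4) x) : pairForm β e u v = inner ℝ (β u v) e :=
  bilinOfBasis_apply_eq (LinearMap.mk₂ ℝ (fun u v ↦ inner ℝ (β u v) e)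
    (by simp [inner_add_left]) (by simp [inner_smul_left]) (by simp [inner_add_left])
    (by simp [inner_smul_left])) u v

/-- Bilinear forms on the fibre, as continuous bilinear forms. -/
def fibreBilin {x : X} (β : E x →ₗ[ℝ] E x →ₗ[ℝ] ℝ) : FibreBilin E x :=
  haveI := finiteDimensional_fibre (E := E) x
  β.toContinuousBilinearMap

@[simp]
lemma fibreBilin_apply {x : X} (β : E x →ₗ[ℝ] E x →ₗ[ℝ] ℝ) (e f : E x) :
    fibreBilin β e f = β e f := rfl

lemma fibreBilin_mem {B : Π x, FibreBilin E x}
    (h : ∀ s ∈ smoothSections R3 E, ∀ t ∈ smoothSections R3 E,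
      ContMDiff (𝓡 4) 𝓘(ℝ, ℝ) ∞ (fun x ↦ B x (s x) (t x))) :
    B ∈ smoothSections (R3 →L[ℝ] R3 →L[ℝ] ℝ) (FibreBilin E) :=
  hom_mem_smoothSections (F := R3) (V := E) (V' := fun x ↦ E x →L[ℝ] ℝ) fun s hs ↦
    hom_mem_smoothSections (F := R3) (V := E) (V' := Bundle.Trivial X ℝ) fun t ht x₀ ↦
      contMDiffAt_section_trivial_iff.2 (h s hs t ht x₀)

variable (o : FibreOrientation E) (A : CovariantDerivative (𝓡 4) R3 E)

/-- `Q(A)` as a bilinear form on the fibre. -/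
def QBilin (x : X) : E x →ₗ[ℝ] E x →ₗ[ℝ] ℝ :=
  (volumeForm o A x)⁻¹ • (wedgeOnBilin (tangentBasis x)).compl₁₂
    (curvatureForm o A x) (curvatureForm o A x)

lemma QBilin_apply (x : X) (e f : E x) : QBilin o A x e f = Q o A x e f := by
  rw [Q, div_eq_inv_mul]
  rfl

/-- The derivative of `F(e) ∧ F(f)` with respect to `F`, in the direction `β`. -/
def wedgeVar {x : X} (β : TangentSpace (𝓡 4) x →L[ℝ] TangentSpace (𝓡 4) x →L[ℝ] E x) :
    E x →ₗ[ℝ] E x →ₗ[ℝ] ℝ :=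
  (wedgeOnBilin (tangentBasis x)).compl₁₂ (pairForm β) (curvatureForm o A x) +
    (wedgeOnBilin (tangentBasis x)).compl₁₂ (curvatureForm o A x) (pairForm β)

lemma wedgeVar_apply {x : X} (β : TangentSpace (𝓡 4) x →L[ℝ] TangentSpace (𝓡 4) x →L[ℝ] E x)
    (e f : E x) : wedgeVar o A β e f =
      wedge (pairForm β e) (curvatureForm o A x f) +
      wedge (curvatureForm o A x e) (pairForm β f) := rfl

lemma wedgeVar_comm {x : X} (β : TangentSpace (𝓡 4) x →L[ℝ] TangentSpace (𝓡 4) x →L[ℝ] E x)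
    (e f : E x) : wedgeVar o A β e f = wedgeVar o A β f e := by
  rw [wedgeVar_apply, wedgeVar_apply, wedge_eq_wedgeOn, wedge_eq_wedgeOn, wedge_eq_wedgeOn,
    wedge_eq_wedgeOn, wedgeOn_comm, add_comm, wedgeOn_comm]

lemma wedgeVar_add {x : X} (β γ : TangentSpace (𝓡 4) x →L[ℝ] TangentSpace (𝓡 4) x →L[ℝ] E x) :
    wedgeVar o A (β + γ) = wedgeVar o A β + wedgeVar o A γ := by
  ext e f
  simp only [wedgeVar_apply, LinearMap.add_apply, wedge, pairForm_apply, _root_.add_apply,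
    inner_add_left]
  ring

lemma wedgeVar_smul {x : X} (c : ℝ)
    (β : TangentSpace (𝓡 4) x →L[ℝ] TangentSpace (𝓡 4) x →L[ℝ] E x) :
    wedgeVar o A (c • β) = c • wedgeVar o A β := by
  ext e f
  simp only [wedgeVar_apply, LinearMap.smul_apply, wedge, pairForm_apply, _root_.smul_apply,
    real_inner_smul_left, smul_eq_mul]
  ring

/-- The trace of the bilinear form `β` on the fibre. -/
def fibreTrace {x : X} (β : E x →ₗ[ℝ] E x →ₗ[ℝ] ℝ) : ℝ :=
  ∑ i, β (fibreBasis x i) (fibreBasis x i)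

lemma fibreTrace_eq {x : X} (β : E x →ₗ[ℝ] E x →ₗ[ℝ] ℝ) (b : OrthonormalBasis (Fin 3) ℝ (E x)) :
    fibreTrace β = ∑ i, β (b i) (b i) := sum_orthonormalBasis_eq β _ _

/-- The derivative of `Q` with respect to the curvature, in the direction `β ∈ Λ² ⊗ E`. -/
def QVarBilin {x : X} (β : TangentSpace (𝓡 4) x →L[ℝ] TangentSpace (𝓡 4) x →L[ℝ] E x) :
    E x →ₗ[ℝ] E x →ₗ[ℝ] ℝ :=
  (volumeForm o A x)⁻¹ • (wedgeVar o A β - ((1 / 3) * fibreTrace (wedgeVar o A β)) • QBilin o A x)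

lemma QVarBilin_apply {x : X}
    (β : TangentSpace (𝓡 4) x →L[ℝ] TangentSpace (𝓡 4) x →L[ℝ] E x) (e f : E x) :
    QVarBilin o A β e f = (volumeForm o A x)⁻¹ *
      (wedgeVar o A β e f - ((1 / 3) * fibreTrace (wedgeVar o A β)) * Q o A x e f) := by
  rw [← QBilin_apply]
  rfl

lemma Q_comm (x : X) (e f : E x) : Q o A x e f = Q o A x f e := by
  rw [Q, Q, wedge_eq_wedgeOn, wedge_eq_wedgeOn, wedgeOn_comm]

variable {o A} in
lemma sum_Q_eq_three {x : X} (h : volumeForm o A x ≠ 0) (b : OrthonormalBasis (Fin 3) ℝ (E x)) :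
    ∑ i, Q o A x (b i) (b i) = 3 := by
  have h' := volumeForm_eq (o := o) (A := A) b
  simp only [Q]
  rw [← Finset.sum_div, div_eq_iff h, h']
  ring

variable {o A} in
/-- The derivative of `Q` with respect to the curvature. Its values are trace-free because
`Q(A)` has trace `3`. -/
def QVar {x : X} (h : volumeForm o A x ≠ 0) :
    (TangentSpace (𝓡 4) x →L[ℝ] TangentSpace (𝓡 4) x →L[ℝ] E x) →ₗ[ℝ] traceFreeSymForms E x where
  toFun β := ⟨fibreBilin (QVarBilin o A β), fun e f ↦ by
      simp only [fibreBilin_apply, QVarBilin_apply, wedgeVar_comm o A β e f, Q_comm o A x e f],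
    fun b ↦ by
      simp only [fibreBilin_apply, QVarBilin_apply]
      rw [← Finset.mul_sum, Finset.sum_sub_distrib, ← Finset.mul_sum, sum_Q_eq_three h,
        fibreTrace_eq _ b]
      ring⟩
  map_add' β γ := by
    ext e f
    simp only [Submodule.coe_add, _root_.add_apply, fibreBilin_apply, QVarBilin_apply,
      wedgeVar_add, LinearMap.add_apply, fibreTrace, Finset.sum_add_distrib]
    ring
  map_smul' c β := by
    ext e f
    simp only [Submodule.coe_smul, _root_.smul_apply, fibreBilin_apply, QVarBilin_apply,
      wedgeVar_smul, LinearMap.smul_apply, fibreTrace, smul_eq_mul, ← Finset.mul_sum,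
      RingHom.id_apply]
    ring

variable {o A} in
lemma QVar_apply {x : X} (h : volumeForm o A x ≠ 0)
    (β : TangentSpace (𝓡 4) x →L[ℝ] TangentSpace (𝓡 4) x →L[ℝ] E x) (e f : E x) :
    (QVar h β : FibreBilin E x) e f = (volumeForm o A x)⁻¹ *
      (wedgeVar o A β e f - ((1 / 3) * fibreTrace (wedgeVar o A β)) * Q o A x e f) :=
  QVarBilin_apply o A β e f

lemma hasDerivAt_wedge {x : X} {θ η : ℝ → TangentBilin x} {θ' η' : TangentBilin x} {t : ℝ}
    (hθ : ∀ u v, HasDerivAt (fun s ↦ θ s u v) (θ' u v) t)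
    (hη : ∀ u v, HasDerivAt (fun s ↦ η s u v) (η' u v) t) :
    HasDerivAt (fun s ↦ wedge (θ s) (η s)) (wedge θ' (η t) + wedge (θ t) η') t := by
  have h (u v w z : TangentSpace (𝓡 4) x) := (hθ u v).mul (hη w z)
  let b := tangentBasis x
  refine (((((((h (b 0) (b 1) (b 2) (b 3)).sub (h (b 0) (b 2) (b 1) (b 3))).add
    (h (b 0) (b 3) (b 1) (b 2))).add (h (b 1) (b 2) (b 0) (b 3))).sub
    (h (b 1) (b 3) (b 0) (b 2))).add (h (b 2) (b 3) (b 0) (b 1)))).congr_deriv ?_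
  simp only [wedge, b]
  ring

variable [A.ContMDiffCovariantDerivative ∞]

variable {o A} in
lemma hasDerivAt_Q (hdef : IsDefinite o A) {a : Π x : X, OneForm E x} (ha : a ∈ OneForms E)
    (x : X) (e f : E x) :
    HasDerivAt (fun t : ℝ ↦ Q o (addForm o A (t • a)) x e f)
      ((QVar (hdef.volumeForm_ne_zero x) (curvatureVar o A a x) : FibreBilin E x) e f) 0 := by
  have hμ := hdef.volumeForm_ne_zero x
  have hc (e : E x) (u v : TangentSpace (𝓡 4) x) :
      HasDerivAt (fun t : ℝ ↦ curvatureForm o (addForm o A (t • a)) x e u v)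
        (pairForm (curvatureVar o A a x) e u v) 0 := by
    have h1 : (fun t : ℝ ↦ curvatureForm o (addForm o A (t • a)) x e u v) = fun t ↦
        curvatureForm o A x e u v + t * pairForm (curvatureVar o A a x) e u v +
          t ^ 2 * inner ℝ (curvatureQuad o a u v) e := by
      funext t
      rw [curvatureForm_apply, curvature_addForm o A ha, inner_add_left, inner_add_left,
        real_inner_smul_left, real_inner_smul_left, curvatureForm_apply, pairForm_apply]
    rw [h1]
    refine ((((hasDerivAt_id (0 : ℝ)).mul_const _).const_add _).add
      (((hasDerivAt_id (0 : ℝ)).pow 2).mul_const _)).congr_deriv ?_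
    simp
  have h0 : addForm o A ((0 : ℝ) • a) = A := by
    ext S y u
    rw [addForm_apply]
    simp
  have hw (e f : E x) := hasDerivAt_wedge (hc e) (hc f)
  rw [h0] at hw
  have hv : HasDerivAt (fun t : ℝ ↦ volumeForm o (addForm o A (t • a)) x)
      ((1 / 3) * fibreTrace (wedgeVar o A (curvatureVar o A a x))) 0 := by
    simp only [volumeForm_eq (fibreBasis x)]
    exact (HasDerivAt.fun_sum fun i _ ↦ hw (fibreBasis x i) (fibreBasis x i)).const_mul _
  refine ((hw e f).div hv (by rwa [h0])).congr_deriv ?_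
  rw [h0, QVar_apply, ← wedgeVar_apply, Q]
  field_simp

variable {o A} in
/-- The quotient of `θ ∧ η` and the volume form is smooth. In a local frame `d` it is the quotient
of the values of the two 4-forms on `d`. -/
lemma contMDiff_wedge_div_volumeForm (hdef : IsDefinite o A) {θ η : Π x : X, TangentBilin x}
    (hθs : ∀ x v, θ x v v = 0) (hηs : ∀ x v, η x v v = 0)
    (hθ : ∀ U ∈ vectorFields X, ∀ V ∈ vectorFields X,
      ContMDiff (𝓡 4) 𝓘(ℝ, ℝ) ∞ (fun x ↦ θ x (U x) (V x)))
    (hη : ∀ U ∈ vectorFields X, ∀ V ∈ vectorFields X,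
      ContMDiff (𝓡 4) 𝓘(ℝ, ℝ) ∞ (fun x ↦ η x (U x) (V x))) :
    ContMDiff (𝓡 4) 𝓘(ℝ, ℝ) ∞ (fun x ↦ (volumeForm o A x)⁻¹ * wedge (θ x) (η x)) := by
  intro x₀
  obtain ⟨d, hd, hdli⟩ := exists_frame (F := R4) (V := (TangentSpace (𝓡 4) : X → Type _))
    (EuclideanSpace.basisFun (Fin 4) ℝ).toBasis x₀
  obtain ⟨e, he, hon⟩ := exists_orthonormal_frame (E := E) x₀
  let m (x : X) : ℝ := (1 / 3) * ∑ i, wedgeOn (fun i ↦ d i x)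
    (curvatureForm o A x (e i x)) (curvatureForm o A x (e i x))
  have hm : ContMDiff (𝓡 4) 𝓘(ℝ, ℝ) ∞ m := contMDiff_const.mul
    (contMDiff_finsetSum fun i _ ↦ contMDiff_wedgeOn
      (fun _ hU _ hV ↦ contMDiff_curvatureForm_apply (he i) hU hV)
      (fun _ hU _ hV ↦ contMDiff_curvatureForm_apply (he i) hU hV) hd)
  have key : ∀ᶠ x in 𝓝 x₀, m x ≠ 0 ∧ (volumeForm o A x)⁻¹ * wedge (θ x) (η x) =
      (m x)⁻¹ * wedgeOn (fun i ↦ d i x) (θ x) (η x) := by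
    filter_upwards [hdli, hon] with x hx hx'
    have hmx : m x = (tangentBasisFun x).det (fun i ↦ d i x) * volumeForm o A x := by
      rw [volumeForm_eq (orthonormalBasisOf hx')]
      simp only [m, orthonormalBasisOf_apply, wedgeOn_eq_det_mul (curvatureForm_self A o _)
        (curvatureForm_self A o _) fun i ↦ d i x]
      rw [← Finset.mul_sum]
      ring
    have hdet : (tangentBasisFun x).det (fun i ↦ d i x) ≠ 0 := by
      have h := (tangentBasisFun x).isUnit_det (Basis.mk hx.1 hx.2)
      rw [Basis.coe_mk] at h
      exact h.ne_zero
    have hμ := hdef.volumeForm_ne_zero x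
    rw [hmx, wedgeOn_eq_det_mul (hθs x) (hηs x)]
    refine ⟨mul_ne_zero hdet hμ, ?_⟩
    field_simp
  refine ((contMDiffAt_inv (hm x₀) key.self_of_nhds.1).mul
    (contMDiff_wedgeOn hθ hη hd x₀)).congr_of_eventuallyEq ?_
  filter_upwards [key] with x hx using hx.2

variable {o A} in
lemma contMDiff_Q (hdef : IsDefinite o A) {s t : Π x, E x} (hs : s ∈ smoothSections R3 E)
    (ht : t ∈ smoothSections R3 E) :
    ContMDiff (𝓡 4) 𝓘(ℝ, ℝ) ∞ (fun x ↦ Q o A x (s x) (t x)) := by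
  simp only [Q, div_eq_inv_mul]
  exact contMDiff_wedge_div_volumeForm hdef (fun x ↦ curvatureForm_self A o _)
    (fun x ↦ curvatureForm_self A o _) (fun _ hU _ hV ↦ contMDiff_curvatureForm_apply hs hU hV)
    (fun _ hU _ hV ↦ contMDiff_curvatureForm_apply ht hU hV)

variable {o A} in
lemma contMDiff_QVar (hdef : IsDefinite o A) {a : Π x : X, OneForm E x} (ha : a ∈ OneForms E)
    {s t : Π x, E x} (hs : s ∈ smoothSections R3 E) (ht : t ∈ smoothSections R3 E) :
    ContMDiff (𝓡 4) 𝓘(ℝ, ℝ) ∞ (fun x ↦ (QVar (hdef.volumeForm_ne_zero x)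
      (curvatureVar o A a x) : FibreBilin E x) (s x) (t x)) := by
  have hw {s t : Π x, E x} (hs : s ∈ smoothSections R3 E) (ht : t ∈ smoothSections R3 E) :
      ContMDiff (𝓡 4) 𝓘(ℝ, ℝ) ∞ (fun x ↦
        (volumeForm o A x)⁻¹ * wedgeVar o A (curvatureVar o A a x) (s x) (t x)) := by
    have h1 {s : Π x, E x} (hs : s ∈ smoothSections R3 E) (U) (hU : U ∈ vectorFields X) (V)
        (hV : V ∈ vectorFields X) : ContMDiff (𝓡 4) 𝓘(ℝ, ℝ) ∞
          (fun x ↦ pairForm (curvatureVar o A a x) (s x) (U x) (V x)) := by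
      simp only [pairForm_apply]
      exact ContMDiff.inner_bundle (curvatureVar_apply_mem o A ha hU hV) hs
    have h2 (s : Π x, E x) (x) (v : TangentSpace (𝓡 4) x) :
        pairForm (curvatureVar o A a x) (s x) v v = 0 := by
      rw [pairForm_apply, curvatureVar_self o A ha, inner_zero_left]
    simp only [wedgeVar_apply, mul_add]
    exact (contMDiff_wedge_div_volumeForm hdef (h2 s) (fun x ↦ curvatureForm_self A o _) (h1 hs)
      (fun _ hU _ hV ↦ contMDiff_curvatureForm_apply ht hU hV)).add
      (contMDiff_wedge_div_volumeForm hdef (fun x ↦ curvatureForm_self A o _) (h2 t)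
      (fun _ hU _ hV ↦ contMDiff_curvatureForm_apply hs hU hV) (h1 ht))
  intro x₀
  obtain ⟨e, he, hon⟩ := exists_orthonormal_frame (E := E) x₀
  have hsum : ContMDiff (𝓡 4) 𝓘(ℝ, ℝ) ∞ (fun x ↦ ∑ i, (volumeForm o A x)⁻¹ *
      wedgeVar o A (curvatureVar o A a x) (e i x) (e i x)) :=
    contMDiff_finsetSum fun i _ ↦ hw (he i) (he i)
  refine ((hw hs ht x₀).sub (((contMDiff_const (c := (1 / 3 : ℝ))).mul hsum x₀).mul
    (contMDiff_Q hdef hs ht x₀))).congr_of_eventuallyEq ?_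
  filter_upwards [hon] with x hx
  rw [QVar_apply, fibreTrace_eq _ (orthonormalBasisOf hx)]
  simp only [orthonormalBasisOf_apply, Pi.mul_apply]
  rw [← Finset.mul_sum]
  ring

variable {o A} in
/-- The linearisation `δ_A Q`. -/
def linearisation (hdef : IsDefinite o A) : OneForms E →ₗ[ℝ] TraceFreeSymSections E where
  toFun a := ⟨fun x ↦ QVar (hdef.volumeForm_ne_zero x) (curvatureVar o A a x),
    fibreBilin_mem fun _ hs _ ht ↦ contMDiff_QVar hdef a.2 hs ht⟩
  map_add' a b := by
    refine Subtype.ext (funext fun x ↦ ?_)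
    change QVar _ (curvatureVar o A ((a : Π x, OneForm E x) + b) x) = _
    rw [curvatureVar_add o A a.2 b.2, map_add]
    rfl
  map_smul' c a := by
    refine Subtype.ext (funext fun x ↦ ?_)
    change QVar _ (curvatureVar o A (c • (a : Π x, OneForm E x)) x) = _
    rw [curvatureVar_smul o A c a.2, map_smul]
    rfl

variable {o A} in
lemma isLinearisation_linearisation (hdef : IsDefinite o A) :
    IsLinearisation o A (linearisation hdef) :=
  fun a x e f ↦ hasDerivAt_Q hdef a.2 x e f

end Linearisation

/-! ### The principal symbol of the linearisation -/

section Symbol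

variable {X : Type*} [TopologicalSpace X] [ChartedSpace R4 X] [IsManifold (𝓡 4) ∞ X] [T2Space X]
  {E : X → Type*} [TopologicalSpace (TotalSpace R3 E)]
  [∀ x, NormedAddCommGroup (E x)] [∀ x, InnerProductSpace ℝ (E x)]
  [FiberBundle R3 E] [VectorBundle ℝ R3 E] [ContMDiffVectorBundle ∞ R3 E (𝓡 4)]
  [IsContMDiffRiemannianBundle (𝓡 4) ∞ R3 E]

variable (E) in
/-- A 1-form with values in `E_x` is given by its values on the basis `∂ᵢ`. -/
def oneFormEquiv (x : X) : OneForm E x ≃ₗ[ℝ] (Fin 4 → E x) where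
  toFun a i := a (tangentBasis x i)
  map_add' _ _ := rfl
  map_smul' _ _ := rfl
  invFun c := ∑ i, (tangentCoord x i).smulRight (c i)
  left_inv a := by
    ext v
    conv_rhs => rw [← sum_tangentCoord_smul v]
    simp
  right_inv c := by
    funext i
    have h (j) : tangentCoord x j (tangentBasis x i) = if i = j then 1 else 0 := by
      change EuclideanSpace.single i (1 : ℝ) j = _
      rw [PiLp.single_apply]
      simp [eq_comm]
    simp [h]

instance finiteDimensional_oneForm (x : X) : FiniteDimensional ℝ (OneForm E x) :=
  haveI := finiteDimensional_fibre (E := E) x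
  (oneFormEquiv E x).symm.finiteDimensional

lemma finrank_oneForm (x : X) : finrank ℝ (OneForm E x) = 12 := by
  have := finiteDimensional_fibre (E := E) x
  rw [(oneFormEquiv E x).finrank_eq, Module.finrank_pi_fintype]
  simp [finrank_fibre]

/-- The `E_x`-valued 2-form `α ∧ a`. -/
def wedgeOneForm (x : X) : (TangentSpace (𝓡 4) x →L[ℝ] ℝ) →ₗ[ℝ] OneForm E x →ₗ[ℝ]
    (TangentSpace (𝓡 4) x →L[ℝ] TangentSpace (𝓡 4) x →L[ℝ] E x) :=
  LinearMap.mk₂ ℝ (fun α a ↦ bilinOfBasis x fun i j ↦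
      α (tangentBasis x i) • a (tangentBasis x j) - α (tangentBasis x j) • a (tangentBasis x i))
    (fun α α' a ↦ by
      ext u v
      simp only [bilinOfBasis, _root_.sum_apply, _root_.add_apply,
        ContinuousLinearMap.smulRight_apply, _root_.smul_apply, ← Finset.sum_add_distrib]
      exact Finset.sum_congr rfl fun i _ ↦ Finset.sum_congr rfl fun j _ ↦ by module)
    (fun c α a ↦ by
      ext u v
      simp only [bilinOfBasis, _root_.sum_apply, smul_eq_mul,
        ContinuousLinearMap.smulRight_apply, _root_.smul_apply, Finset.smul_sum]
      exact Finset.sum_congr rfl fun i _ ↦ Finset.sum_congr rfl fun j _ ↦ by module)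
    (fun α a a' ↦ by
      ext u v
      simp only [bilinOfBasis, _root_.sum_apply, _root_.add_apply,
        ContinuousLinearMap.smulRight_apply, _root_.smul_apply, ← Finset.sum_add_distrib]
      exact Finset.sum_congr rfl fun i _ ↦ Finset.sum_congr rfl fun j _ ↦ by module)
    (fun c α a ↦ by
      ext u v
      simp only [bilinOfBasis, _root_.sum_apply,
        ContinuousLinearMap.smulRight_apply, _root_.smul_apply, Finset.smul_sum]
      exact Finset.sum_congr rfl fun i _ ↦ Finset.sum_congr rfl fun j _ ↦ by module)

lemma wedgeOneForm_apply {x : X} (α : TangentSpace (𝓡 4) x →L[ℝ] ℝ) (a : OneForm E x)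
    (u v : TangentSpace (𝓡 4) x) : wedgeOneForm x α a u v = α u • a v - α v • a u :=
  bilinOfBasis_apply_eq (LinearMap.mk₂ ℝ (fun u v ↦ α u • a v - α v • a u)
    (by intros; simp only [map_add]; module) (by intros; simp only [map_smul, smul_eq_mul]; module)
    (by intros; simp only [map_add]; module) (by intros; simp only [map_smul, smul_eq_mul]; module))
    u v

/-- The pairing of `a ∈ Λ¹ ⊗ E` with `e ∈ E_x`. -/
def pairOne {x : X} (a : OneForm E x) (e : E x) : TangentSpace (𝓡 4) x →L[ℝ] ℝ :=
  (innerSL ℝ e).comp a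

@[simp]
lemma pairOne_apply {x : X} (a : OneForm E x) (e : E x) (u : TangentSpace (𝓡 4) x) :
    pairOne a e u = inner ℝ e (a u) := rfl

lemma pairForm_wedgeOneForm {x : X} (α : TangentSpace (𝓡 4) x →L[ℝ] ℝ) (a : OneForm E x)
    (e : E x) : pairForm (wedgeOneForm x α a) e = wedgeOne α (pairOne a e) := by
  ext u v
  rw [pairForm_apply, wedgeOneForm_apply, inner_sub_left, real_inner_smul_left,
    real_inner_smul_left, wedgeOne_apply, pairOne_apply, pairOne_apply, real_inner_comm,
    real_inner_comm e]
  ring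

/-- The contraction of the vanishing 5-form `α ∧ θ ∧ η` with `u`. -/
lemma wedge_wedgeOne_contract {x : X} {θ η : TangentBilin x} (hθ : ∀ v, θ v v = 0)
    (hη : ∀ v, η v v = 0) (α : TangentSpace (𝓡 4) x →L[ℝ] ℝ) (u : TangentSpace (𝓡 4) x) :
    wedge (wedgeOne α (θ u)) η + wedge θ (wedgeOne α (η u)) = α u * wedge θ η := by
  have e := alternating_swap hθ
  have e' := alternating_swap hη
  rw [← sum_tangentCoord_smul u]
  generalize tangentCoord x = c
  simp only [Fin.sum_univ_four, wedge, wedgeOne_apply, map_add, map_smul, _root_.add_apply,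
    _root_.smul_apply, smul_eq_mul, hθ, hη]
  generalize tangentBasis x = b
  rw [e (b 1) (b 0), e (b 2) (b 0), e (b 3) (b 0), e (b 2) (b 1), e (b 3) (b 1), e (b 3) (b 2),
    e' (b 1) (b 0), e' (b 2) (b 0), e' (b 3) (b 0), e' (b 2) (b 1), e' (b 3) (b 1),
    e' (b 3) (b 2)]
  ring

variable {o : FibreOrientation E} {A : CovariantDerivative (𝓡 4) R3 E}
  [A.ContMDiffCovariantDerivative ∞]

/-- The principal symbol of `δ_A Q`. -/
def linearisationSymbol (hdef : IsDefinite o A) (x : X) :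
    (TangentSpace (𝓡 4) x →L[ℝ] ℝ) →ₗ[ℝ] OneForm E x →ₗ[ℝ] traceFreeSymForms E x :=
  (wedgeOneForm x).compr₂ (QVar (hdef.volumeForm_ne_zero x))

lemma linearisationSymbol_apply (hdef : IsDefinite o A) (x : X)
    (α : TangentSpace (𝓡 4) x →L[ℝ] ℝ) (a : OneForm E x) :
    linearisationSymbol hdef x α a = QVar (hdef.volumeForm_ne_zero x) (wedgeOneForm x α a) := rfl

lemma hasPrincipalSymbol_linearisation (hdef : IsDefinite o A) :
    HasPrincipalSymbol ((TraceFreeSymSections E).subtype ∘ₗ linearisation hdef)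
      (linearisationSymbol hdef) := by
  intro x f hf hx a b hab
  have hb : (b : Π x, OneForm E x) = fun y ↦ f y • (a : Π x, OneForm E x) y := funext hab
  rw [linearisationSymbol_apply]
  change QVar (hdef.volumeForm_ne_zero x) (curvatureVar o A (b : Π x, OneForm E x) x) = _
  congr 1
  ext u v
  rw [hb, curvatureVar_symbol o A hf a.2 hx, wedgeOneForm_apply]

lemma gaugeSymbol_injective (hdef : IsDefinite o A) (x : X)
    {α : TangentSpace (𝓡 4) x →L[ℝ] ℝ} (hα : α ≠ 0) :
    Function.Injective (gaugeSymbol o A x α) := by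
  rw [injective_iff_map_eq_zero]
  rintro ⟨u, ξ⟩ h
  have hw (w) : curvature o A x u w + α w • ξ = 0 := DFunLike.congr_fun h w
  have hu : u = 0 := by
    by_contra hu
    -- the kernel of `α` is not contained in the line spanned by `u`
    obtain ⟨w, hw0, hwu⟩ : ∃ w ∈ LinearMap.ker (α : TangentSpace (𝓡 4) x →ₗ[ℝ] ℝ),
        w ∉ Submodule.span ℝ {u} := by
      by_contra! hle
      have h1 := Submodule.finrank_mono (show LinearMap.ker (α : TangentSpace (𝓡 4) x →ₗ[ℝ] ℝ) ≤ _
        from hle)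
      have h2 := (α : TangentSpace (𝓡 4) x →ₗ[ℝ] ℝ).finrank_range_add_finrank_ker
      have h3 := Submodule.finrank_le (LinearMap.range (α : TangentSpace (𝓡 4) x →ₗ[ℝ] ℝ))
      rw [finrank_span_singleton hu] at h1
      rw [finrank_tangentSpace] at h2
      rw [finrank_self] at h3
      omega
    refine hdef x u w ((LinearIndependent.pair_iff' hu).2 fun c hc ↦ hwu ?_) ?_
    · exact hc ▸ Submodule.smul_mem _ _ (Submodule.mem_span_singleton_self u)
    · have h1 := hw w
      rwa [show α w = 0 from hw0, zero_smul, add_zero] at h1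
  obtain ⟨w, hw0⟩ : ∃ w, α w ≠ 0 := by
    by_contra! h0
    exact hα (ContinuousLinearMap.ext h0)
  have h1 := hw w
  rw [hu, map_zero, _root_.zero_apply, zero_add] at h1
  rw [hu, (smul_eq_zero.1 h1).resolve_left hw0]
  rfl

lemma linearisationSymbol_gaugeSymbol (hdef : IsDefinite o A) (x : X)
    (α : TangentSpace (𝓡 4) x →L[ℝ] ℝ) (p : TangentSpace (𝓡 4) x × E x) :
    linearisationSymbol hdef x α (gaugeSymbol o A x α p) = 0 := by
  have hμ := hdef.volumeForm_ne_zero x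
  have hw (e f : E x) : wedgeVar o A (wedgeOneForm x α (gaugeSymbol o A x α p)) e f =
      α p.1 * wedge (curvatureForm o A x e) (curvatureForm o A x f) := by
    have hp (e : E x) : wedgeOne α (pairOne (gaugeSymbol o A x α p) e) =
        wedgeOne α (curvatureForm o A x e p.1) := by
      ext u v
      have hg (w : TangentSpace (𝓡 4) x) : inner ℝ e (gaugeSymbol o A x α p w) =
          curvatureForm o A x e p.1 w + α w * inner ℝ e p.2 := by
        change inner ℝ e (curvature o A x p.1 w + α w • p.2) = _
        rw [inner_add_right, real_inner_smul_right, curvatureForm_apply, real_inner_comm]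
      rw [wedgeOne_apply, wedgeOne_apply, pairOne_apply, pairOne_apply, hg, hg]
      ring
    rw [wedgeVar_apply, pairForm_wedgeOneForm, pairForm_wedgeOneForm, hp, hp,
      wedge_wedgeOne_contract (curvatureForm_self A o _) (curvatureForm_self A o _)]
  rw [linearisationSymbol_apply]
  ext e f
  rw [QVar_apply, hw, fibreTrace]
  simp only [hw]
  rw [← Finset.mul_sum, mul_left_comm, ← volumeForm_eq (fibreBasis x), Q]
  change _ = (0 : ℝ)
  field_simp
  ring

/-- For `α ≠ 0` the pairing `(β, f) ↦ α ∧ β ∧ F_A(f)` induces a surjection `Λ¹ → E*`: otherwise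
`α ∧ F_A(f) = 0` for some `f ≠ 0`, and then `F_A(f) ∧ F_A(f) = 0`. -/
lemma exists_wedge_eq (hdef : IsDefinite o A) (x : X)
    {α : TangentSpace (𝓡 4) x →L[ℝ] ℝ} (hα : α ≠ 0) (φ : Dual ℝ (E x)) :
    ∃ β : TangentSpace (𝓡 4) x →L[ℝ] ℝ, ∀ f,
      wedge (wedgeOne α β) (curvatureForm o A x f) = φ f := by
  have := finiteDimensional_fibre (E := E) x
  let L : (TangentSpace (𝓡 4) x →L[ℝ] ℝ) →ₗ[ℝ] Dual ℝ (E x) :=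
    LinearMap.mk₂ ℝ (fun β f ↦ wedge (wedgeOne α β) (curvatureForm o A x f))
      (by intros; simp [wedge]; ring) (by intros; simp [wedge]; ring)
      (by intros; simp [wedge]; ring) (by intros; simp [wedge]; ring)
  have hL : LinearMap.range L = ⊤ := by
    by_contra hne
    obtain ⟨ψ, hψ, hψL⟩ := Submodule.exists_le_ker_of_lt_top _ (lt_top_iff_ne_top.2 hne)
    obtain ⟨f, rfl⟩ := (evalEquiv ℝ (E x)).surjective ψ
    have hf : f ≠ 0 := fun h ↦ hψ (by rw [h, map_zero])
    obtain ⟨u, hu⟩ : ∃ u, α u ≠ 0 := by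
      by_contra! h0
      exact hα (ContinuousLinearMap.ext h0)
    have h1 : wedge (wedgeOne α (curvatureForm o A x f u)) (curvatureForm o A x f) = 0 :=
      hψL (LinearMap.mem_range_self L (curvatureForm o A x f u))
    have h2 := wedge_wedgeOne_contract (curvatureForm_self A o f) (curvatureForm_self A o f) α u
    rw [wedge_eq_wedgeOn (curvatureForm o A x f) (wedgeOne _ _), wedgeOn_comm,
      ← wedge_eq_wedgeOn, h1, add_zero] at h2
    exact (right_ne_zero_of_mul (hdef.volumeForm_mul_wedge_pos hf).ne')
      ((mul_eq_zero.1 h2.symm).resolve_left hu)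
  obtain ⟨β, hβ⟩ := LinearMap.range_eq_top.1 hL φ
  exact ⟨β, fun f ↦ LinearMap.congr_fun hβ f⟩

lemma linearisationSymbol_surjective (hdef : IsDefinite o A) (x : X)
    {α : TangentSpace (𝓡 4) x →L[ℝ] ℝ} (hα : α ≠ 0) :
    Function.Surjective (linearisationSymbol hdef x α) := by
  rintro ⟨B, hB, hBt⟩
  have hμ := hdef.volumeForm_ne_zero x
  let b := fibreBasis (E := E) x
  choose β hβ using fun i ↦ exists_wedge_eq hdef x hα
    ((volumeForm o A x / 2) • (B (b i) : E x →ₗ[ℝ] ℝ))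
  replace hβ (i f) : wedge (wedgeOne α (β i)) (curvatureForm o A x f) =
    volumeForm o A x / 2 * B (b i) f := hβ i f
  let a : OneForm E x := ∑ i, (β i).smulRight (b i)
  have ha (e f : E x) : wedge (wedgeOne α (pairOne a e)) (curvatureForm o A x f) =
      volumeForm o A x / 2 * B e f := by
    have h1 : wedge (wedgeOne α (pairOne a e)) (curvatureForm o A x f) =
        ∑ i, inner ℝ (b i) e * wedge (wedgeOne α (β i)) (curvatureForm o A x f) := by
      have h2 (w : TangentSpace (𝓡 4) x) : pairOne a e w = ∑ i, inner ℝ (b i) e * β i w := by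
        change inner ℝ e ((∑ i, (β i).smulRight (b i)) w) = _
        rw [_root_.sum_apply, inner_sum]
        refine Finset.sum_congr rfl fun i _ ↦ ?_
        rw [ContinuousLinearMap.smulRight_apply, real_inner_smul_right, real_inner_comm, mul_comm]
      simp only [wedge, wedgeOne_apply, h2, Fin.sum_univ_three]
      ring
    conv_rhs => rw [← b.sum_repr' e]
    rw [h1]
    simp only [hβ, map_sum, map_smul, _root_.sum_apply, _root_.smul_apply, smul_eq_mul,
      Finset.mul_sum]
    exact Finset.sum_congr rfl fun i _ ↦ by ring
  have hw (e f : E x) : wedgeVar o A (wedgeOneForm x α a) e f = volumeForm o A x * B e f := by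
    rw [wedgeVar_apply, pairForm_wedgeOneForm, pairForm_wedgeOneForm, ha,
      wedge_eq_wedgeOn (curvatureForm o A x e), wedgeOn_comm, ← wedge_eq_wedgeOn, ha, hB f e]
    ring
  refine ⟨a, Subtype.ext ?_⟩
  ext e f
  rw [linearisationSymbol_apply, QVar_apply, hw, fibreTrace]
  simp only [hw]
  rw [← Finset.mul_sum, hBt]
  field_simp
  ring

variable (E) in
lemma five_le_finrank_traceFreeSymForms (x : X) : 5 ≤ finrank ℝ (traceFreeSymForms E x) := by
  have := finiteDimensional_fibre (E := E) x
  let b := fibreBasis (E := E) x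
  let y (i : Fin 3) (e : E x) : ℝ := inner ℝ (b i) e
  let β (c : Fin 5 → ℝ) : E x →ₗ[ℝ] E x →ₗ[ℝ] ℝ := LinearMap.mk₂ ℝ (fun e f ↦
      c 0 * (y 0 e * y 1 f + y 1 e * y 0 f) + c 1 * (y 0 e * y 2 f + y 2 e * y 0 f) +
      c 2 * (y 1 e * y 2 f + y 2 e * y 1 f) + c 3 * (y 0 e * y 0 f - y 1 e * y 1 f) +
      c 4 * (y 1 e * y 1 f - y 2 e * y 2 f))
    (by intros; simp only [y, inner_add_right]; ring)
    (by intros; simp only [y, inner_smul_right, smul_eq_mul]; ring)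
    (by intros; simp only [y, inner_add_right]; ring)
    (by intros; simp only [y, inner_smul_right, smul_eq_mul]; ring)
  have hy (i j) : y i (b j) = if i = j then 1 else 0 :=
    orthonormal_iff_ite.1 b.orthonormal i j
  let L : (Fin 5 → ℝ) →ₗ[ℝ] traceFreeSymForms E x :=
    { toFun := fun c ↦ ⟨fibreBilin (β c), fun e f ↦ by
          simp only [fibreBilin_apply, β, LinearMap.mk₂_apply]; ring,
        fun b' ↦ by
          simp only [fibreBilin_apply]
          rw [sum_orthonormalBasis_eq (β c) b' b, Fin.sum_univ_three]
          simp [β, hy]⟩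
      map_add' := fun c c' ↦ by
        ext e f
        change β (c + c') e f = β c e f + β c' e f
        simp only [β, LinearMap.mk₂_apply, Pi.add_apply]
        ring
      map_smul' := fun r c ↦ by
        ext e f
        change β (r • c) e f = r * β c e f
        simp only [β, LinearMap.mk₂_apply, Pi.smul_apply, smul_eq_mul]
        ring }
  have hL : Function.Injective L := by
    rw [injective_iff_map_eq_zero]
    intro c hc
    have h (i j) : β c (b i) (b j) = 0 :=
      DFunLike.congr_fun (DFunLike.congr_fun (congrArg Subtype.val hc) (b i)) (b j)
    have h01 := h 0 1
    have h02 := h 0 2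
    have h12 := h 1 2
    have h00 := h 0 0
    have h22 := h 2 2
    simp [β, hy] at h01 h02 h12 h00 h22
    funext i
    fin_cases i <;> simp_all
  simpa using LinearMap.finrank_le_finrank_of_injective hL

/-- The symbol sequence is exact in the middle by counting dimensions: `12 = 7 + 5`. -/
lemma exact_gaugeSymbol_linearisationSymbol (hdef : IsDefinite o A) (x : X)
    {α : TangentSpace (𝓡 4) x →L[ℝ] ℝ} (hα : α ≠ 0) :
    Function.Exact (gaugeSymbol o A x α) (linearisationSymbol hdef x α) := by
  have := finiteDimensional_fibre (E := E) x
  rw [LinearMap.exact_iff]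
  refine (Submodule.eq_of_le_of_finrank_le ?_ ?_).symm
  · rintro _ ⟨p, rfl⟩
    exact linearisationSymbol_gaugeSymbol hdef x α p
  · have h1 := (linearisationSymbol hdef x α).finrank_range_add_finrank_ker
    rw [LinearMap.range_eq_top.2 (linearisationSymbol_surjective hdef x hα), finrank_top,
      finrank_oneForm] at h1
    rw [LinearMap.finrank_range_of_inj (gaugeSymbol_injective hdef x hα), finrank_prod,
      finrank_tangentSpace, finrank_fibre]
    have := five_le_finrank_traceFreeSymForms E x
    omega

lemma finrank_traceFreeSymForms (hdef : IsDefinite o A) (x : X) :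
    finrank ℝ (traceFreeSymForms E x) = 5 := by
  have := finiteDimensional_fibre (E := E) x
  have hα : tangentCoord x 0 ≠ 0 := by
    intro h
    have h1 := DFunLike.congr_fun h (tangentBasis x 0)
    change EuclideanSpace.single (0 : Fin 4) (1 : ℝ) 0 = 0 at h1
    simp at h1
  have h1 := (linearisationSymbol hdef x (tangentCoord x 0)).finrank_range_add_finrank_ker
  rw [LinearMap.range_eq_top.2 (linearisationSymbol_surjective hdef x hα), finrank_top,
    finrank_oneForm, LinearMap.exact_iff.1 (exact_gaugeSymbol_linearisationSymbol hdef x hα),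
    LinearMap.finrank_range_of_inj (gaugeSymbol_injective hdef x hα), finrank_prod,
    finrank_tangentSpace, finrank_fibre] at h1
  omega

end Symbol

/-! ### Contractions with a Riemannian metric, and the subbundle `V_A` -/

section Contraction

variable {X : Type*} [TopologicalSpace X] [ChartedSpace R4 X] [IsManifold (𝓡 4) ∞ X]
  (g : ContMDiffRiemannianMetric (𝓡 4) ∞ R4 (TangentSpace (𝓡 4) : X → Type _))

lemma exists_isOrthonormalFor (x : X) :
    ∃ b : Basis (Fin 4) ℝ (TangentSpace (𝓡 4) x), IsOrthonormalFor (g.inner x) b :=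
  exists_basis_orthonormal finrank_tangentSpace
    (LinearMap.mk₂ ℝ (fun u v ↦ g.inner x u v) (by simp) (by simp) (by simp) (by simp))
    (g.symm x) (g.pos x)

lemma det_gram_pos (x : X) {d : Fin 4 → TangentSpace (𝓡 4) x} (hd : LinearIndependent ℝ d) :
    0 < (gram (g.inner x) d).det := by
  obtain ⟨b, hb⟩ := exists_isOrthonormalFor g x
  rw [gram_eq_mul _ b, hb.gram_eq_one, mul_one, Matrix.det_mul, Matrix.det_transpose,
    ← Basis.det_apply, ← sq]
  have h := b.isUnit_det (basisOfLinearIndependentOfCardEqFinrank hd (by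
    rw [finrank_tangentSpace, Fintype.card_fin]))
  rw [coe_basisOfLinearIndependentOfCardEqFinrank] at h
  exact sq_pos_of_ne_zero h.ne_zero

/-- The metric contraction may be computed in any basis of `T_x X`. -/
lemma sum_gram_inv_of_linearIndependent {x : X} {H : Type*} [AddCommGroup H] [Module ℝ H]
    {d : Fin 4 → TangentSpace (𝓡 4) x} (hd : LinearIndependent ℝ d)
    (β : TangentSpace (𝓡 4) x →ₗ[ℝ] TangentSpace (𝓡 4) x →ₗ[ℝ] H) :
    ∑ i, ∑ j, (gram (g.inner x) d)⁻¹ i j • β (d i) (d j) =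
      ∑ i, ∑ j, (gram (g.inner x) (tangentBasis x))⁻¹ i j •
        β (tangentBasis x i) (tangentBasis x j) := by
  obtain ⟨b, hb⟩ := exists_isOrthonormalFor g x
  have h := sum_gram_basis_inv hb (basisOfLinearIndependentOfCardEqFinrank hd (by
    rw [finrank_tangentSpace, Fintype.card_fin])) β
  rw [coe_basisOfLinearIndependentOfCardEqFinrank] at h
  rw [h, sum_gram_inv hb]

lemma contMDiff_metric_apply {U V : Π x : X, TangentSpace (𝓡 4) x} (hU : U ∈ vectorFields X)
    (hV : V ∈ vectorFields X) : ContMDiff (𝓡 4) 𝓘(ℝ, ℝ) ∞ (fun x ↦ g.inner x (U x) (V x)) := by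
  have h1 := apply_mem_smoothSections (F := R4) (V := (TangentSpace (𝓡 4) : X → Type _))
    (V' := fun x ↦ TangentSpace (𝓡 4) x →L[ℝ] ℝ) g.contMDiff hU
  have h2 := apply_mem_smoothSections (F := R4) (V := (TangentSpace (𝓡 4) : X → Type _))
    (V' := Bundle.Trivial X ℝ) h1 hV
  exact fun x ↦ contMDiffAt_section_trivial_iff.1 (h2 x)

end Contraction

/-- The dimension of the orthogonal complement of the image of an injective map `j : T → V`. -/
lemma finrank_ker_compl₂ {V T : Type*} [AddCommGroup V] [Module ℝ V] [FiniteDimensional ℝ V]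
    [AddCommGroup T] [Module ℝ T] [FiniteDimensional ℝ T] (B : V →ₗ[ℝ] V →ₗ[ℝ] ℝ)
    (hB : ∀ v, v ≠ 0 → 0 < B v v) (j : T →ₗ[ℝ] V) (hj : ∀ u, u ≠ 0 → j u ≠ 0) :
    finrank ℝ (LinearMap.ker (B.compl₂ j)) + finrank ℝ T = finrank ℝ V := by
  have hL : Function.Injective (B.compl₂ j ∘ₗ j) := by
    rw [injective_iff_map_eq_zero]
    intro u hu
    by_contra hu0
    exact (hB _ (hj u hu0)).ne' (LinearMap.congr_fun hu u)
  have hsurj : Function.Surjective (B.compl₂ j) :=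
    Function.Surjective.of_comp (g := j) ((LinearMap.injective_iff_surjective_of_finrank_eq_finrank
      Subspace.dual_finrank_eq.symm).1 hL)
  have h := (B.compl₂ j).finrank_range_add_finrank_ker
  rw [LinearMap.range_eq_top.2 hsurj, finrank_top] at h
  have hd : finrank ℝ (T →ₗ[ℝ] ℝ) = finrank ℝ T := Subspace.dual_finrank_eq
  omega

section GaugeFixed

variable {X : Type*} [TopologicalSpace X] [ChartedSpace R4 X] [IsManifold (𝓡 4) ∞ X] [T2Space X]
  {E : X → Type*} [TopologicalSpace (TotalSpace R3 E)]
  [∀ x, NormedAddCommGroup (E x)] [∀ x, InnerProductSpace ℝ (E x)]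
  [FiberBundle R3 E] [VectorBundle ℝ R3 E] [ContMDiffVectorBundle ∞ R3 E (𝓡 4)]
  [IsContMDiffRiemannianBundle (𝓡 4) ∞ R3 E]
  (g : ContMDiffRiemannianMetric (𝓡 4) ∞ R4 (TangentSpace (𝓡 4) : X → Type _))

/-- The bilinear map `(u, v) ↦ ⟨a(u), c(v)⟩` on `T_x X`. -/
def innerBilin {x : X} (a c : OneForm E x) :
    TangentSpace (𝓡 4) x →ₗ[ℝ] TangentSpace (𝓡 4) x →ₗ[ℝ] ℝ :=
  LinearMap.mk₂ ℝ (fun u v ↦ inner ℝ (a u) (c v)) (by simp [inner_add_left])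
    (by simp [inner_smul_left]) (by simp [inner_add_right]) (by simp [inner_smul_right])

lemma oneFormInner_eq_sum_gram_inv {x : X} {d : Fin 4 → TangentSpace (𝓡 4) x}
    (hd : LinearIndependent ℝ d) (a c : OneForm E x) : oneFormInner (g.inner x) a c =
      ∑ i, ∑ j, (gram (g.inner x) d)⁻¹ i j * inner ℝ (a (d i)) (c (d j)) :=
  (sum_gram_inv_of_linearIndependent g hd (innerBilin a c)).symm

/-- The inner product of `Λ¹ ⊗ E` as a bilinear form. -/
def oneFormBilin (x : X) : OneForm E x →ₗ[ℝ] OneForm E x →ₗ[ℝ] ℝ :=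
  LinearMap.mk₂ ℝ (oneFormInner (g.inner x))
    (by intros; simp [oneFormInner, inner_add_left, mul_add, Finset.sum_add_distrib])
    (by intros; simp [oneFormInner, inner_smul_left, Finset.mul_sum, mul_left_comm])
    (by intros; simp [oneFormInner, inner_add_right, mul_add, Finset.sum_add_distrib])
    (by intros; simp [oneFormInner, inner_smul_right, Finset.mul_sum, mul_left_comm])

lemma oneFormBilin_apply {x : X} (a c : OneForm E x) :
    oneFormBilin g x a c = oneFormInner (g.inner x) a c := rfl

lemma oneFormBilin_comm {x : X} (a c : OneForm E x) :
    oneFormBilin g x a c = oneFormBilin g x c a := by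
  obtain ⟨b, hb⟩ := exists_isOrthonormalFor g x
  rw [oneFormBilin_apply, oneFormBilin_apply, oneFormInner_eq hb, oneFormInner_eq hb]
  exact Finset.sum_congr rfl fun _ _ ↦ real_inner_comm _ _

lemma oneFormBilin_self_pos {x : X} {a : OneForm E x} (ha : a ≠ 0) : 0 < oneFormBilin g x a a := by
  obtain ⟨b, hb⟩ := exists_isOrthonormalFor g x
  rw [oneFormBilin_apply, oneFormInner_eq hb]
  obtain ⟨k, hk⟩ : ∃ k, a (b k) ≠ 0 := by
    by_contra! h
    exact ha (ContinuousLinearMap.coe_injective (b.ext h))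
  exact Finset.sum_pos' (fun _ _ ↦ real_inner_self_nonneg)
    ⟨k, Finset.mem_univ _, real_inner_self_pos.2 hk⟩

lemma contMDiff_oneFormInner {a c : Π x : X, OneForm E x} (ha : a ∈ OneForms E)
    (hc : c ∈ OneForms E) :
    ContMDiff (𝓡 4) 𝓘(ℝ, ℝ) ∞ (fun x ↦ oneFormInner (g.inner x) (a x) (c x)) := by
  intro x₀
  obtain ⟨d, hd, hdli⟩ := exists_frame (F := R4) (V := (TangentSpace (𝓡 4) : X → Type _))
    (EuclideanSpace.basisFun (Fin 4) ℝ).toBasis x₀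
  have hsm : ContMDiffAt (𝓡 4) 𝓘(ℝ, ℝ) ∞ (fun x ↦ ∑ i, ∑ j,
      (gram (g.inner x) fun i ↦ d i x)⁻¹ i j * inner ℝ (a x (d i x)) (c x (d j x))) x₀ := by
    refine ContMDiffAt.sum fun i _ ↦ ContMDiffAt.sum fun j _ ↦ ContMDiffAt.mul ?_ ?_
    · exact contMDiffAt_matrix_inv (fun i j ↦ contMDiff_metric_apply g (hd i) (hd j) x₀)
        (det_gram_pos g x₀ hdli.self_of_nhds.1).ne' i j
    · exact ContMDiff.inner_bundle (apply_mem_smoothSections ha (hd i))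
        (apply_mem_smoothSections hc (hd j)) x₀
  refine hsm.congr_of_eventuallyEq ?_
  filter_upwards [hdli] with x hx using oneFormInner_eq_sum_gram_inv g hx.1 _ _

variable {o : FibreOrientation E} {A : CovariantDerivative (𝓡 4) R3 E}

lemma IsDefinite.curvature_ne_zero (hdef : IsDefinite o A) {x : X} {u : TangentSpace (𝓡 4) x}
    (hu : u ≠ 0) : curvature o A x u ≠ 0 := by
  intro h
  obtain ⟨w, hw⟩ : ∃ w, w ∉ Submodule.span ℝ {u} := by
    by_contra! hle
    have h1 := finrank_span_singleton (K := ℝ) hu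
    rw [(Submodule.eq_top_iff').2 hle, finrank_top, finrank_tangentSpace] at h1
    norm_num at h1
  refine hdef x u w ((LinearIndependent.pair_iff' hu).2 fun c hc ↦ hw ?_) (by rw [h]; rfl)
  exact hc ▸ Submodule.smul_mem _ _ (Submodule.mem_span_singleton_self u)

variable (o A) in
/-- The restriction of the linear form `(a, ·)` to the image of `u ↦ ι_u F_A`. -/
def curvaturePairing (x : X) : OneForm E x →ₗ[ℝ] Dual ℝ (TangentSpace (𝓡 4) x) :=
  (oneFormBilin g x).compl₂ (curvature o A x : TangentSpace (𝓡 4) x →ₗ[ℝ] OneForm E x)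

lemma gaugeFixedForms_eq_ker (x : X) :
    gaugeFixedForms o A g x = LinearMap.ker (curvaturePairing g o A x) := by
  ext a
  rw [LinearMap.mem_ker, LinearMap.ext_iff]
  rfl

lemma finrank_gaugeFixedForms (hdef : IsDefinite o A) (x : X) :
    finrank ℝ (gaugeFixedForms o A g x) = 8 := by
  have h := finrank_ker_compl₂ (oneFormBilin g x) (fun _ ↦ oneFormBilin_self_pos g)
    (curvature o A x : TangentSpace (𝓡 4) x →ₗ[ℝ] OneForm E x) fun _ ↦ hdef.curvature_ne_zero
  rw [finrank_oneForm, finrank_tangentSpace] at h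
  rw [gaugeFixedForms_eq_ker]
  exact Nat.add_right_cancel h

variable [A.ContMDiffCovariantDerivative ∞]

/-- A vector of `V_A` extends to a section of `V_A`: extend it to a section of `Λ¹ ⊗ E` and
subtract the orthogonal projection to the span of the forms `ι_{dᵢ} F_A` for a local frame `dᵢ`. -/
lemma exists_gaugeFixed_section (hdef : IsDefinite o A) (x₀ : X)
    (v : gaugeFixedForms o A g x₀) :
    ∃ s ∈ subSections (R4 →L[ℝ] R3) (OneForm E) (gaugeFixedForms o A g), s x₀ = v := by
  obtain ⟨a, ha, hav⟩ := exists_smoothSection_apply_eq (F := R4 →L[ℝ] R3) (v : OneForm E x₀)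
  obtain ⟨d, hd, hdli⟩ := exists_frame (F := R4) (V := (TangentSpace (𝓡 4) : X → Type _))
    (EuclideanSpace.basisFun (Fin 4) ℝ).toBasis x₀
  let Φ (i : Fin 4) (x : X) : OneForm E x := curvature o A x (d i x)
  have hΦ (i) : Φ i ∈ OneForms E := curvature_mem_oneForms A o (hd i)
  let M (x : X) : Matrix (Fin 4) (Fin 4) ℝ :=
    Matrix.of fun i j ↦ oneFormBilin g x (Φ i x) (Φ j x)
  have hM (i j) : ContMDiff (𝓡 4) 𝓘(ℝ, ℝ) ∞ fun x ↦ M x i j :=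
    contMDiff_oneFormInner g (hΦ i) (hΦ j)
  have hdet {x : X} (hx : LinearIndependent ℝ fun i ↦ d i x) : (M x).det ≠ 0 := by
    refine fun h0 ↦ ?_
    obtain ⟨w, hw0, hw⟩ := Matrix.exists_mulVec_eq_zero_iff.2 h0
    refine hw0 (funext (Fintype.linearIndependent_iff.1 hx w ?_))
    by_contra hne
    have h1 := oneFormBilin_self_pos g (hdef.curvature_ne_zero hne)
    refine h1.ne' ?_
    have h2 (i) : oneFormBilin g x (Φ i x) (curvature o A x (∑ j, w j • d j x)) = 0 := by
      rw [← show (M x).mulVec w i = 0 from congrFun hw i]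
      simp [Matrix.mulVec, dotProduct, M, Φ, mul_comm]
    have h3 (y : OneForm E x) : oneFormBilin g x (curvature o A x (∑ i, w i • d i x)) y =
        ∑ i, w i * oneFormBilin g x (Φ i x) y := by simp [Φ]
    rw [h3]
    exact Finset.sum_eq_zero fun i _ ↦ by rw [h2, mul_zero]
  let s (x : X) : OneForm E x :=
    a x - ∑ i, (∑ j, (M x)⁻¹ i j * oneFormInner (g.inner x) (a x) (Φ j x)) • Φ i x
  let u : Set X := interior {x | LinearIndependent ℝ fun i ↦ d i x}
  have hu : u ∈ 𝓝 x₀ := interior_mem_nhds.2 (by filter_upwards [hdli] with x hx using hx.1)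
  have hux {x : X} (hx : x ∈ u) : LinearIndependent ℝ fun i ↦ d i x := interior_subset hx
  have hs : ContMDiffOn (𝓡 4) ((𝓡 4).prod 𝓘(ℝ, R4 →L[ℝ] R3)) ∞
      (fun x ↦ TotalSpace.mk' (R4 →L[ℝ] R3) x (s x)) u := fun x hx ↦ by
    refine ContMDiffAt.contMDiffWithinAt (ContMDiffAt.sub_section (ha x)
      (ContMDiffAt.sum_section fun i _ ↦ ContMDiffAt.smul_section ?_ (hΦ i x)))
    exact ContMDiffAt.sum fun j _ ↦ (contMDiffAt_matrix_inv (fun i j ↦ hM i j x)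
      (hdet (hux hx)) i j).mul (contMDiff_oneFormInner g ha (hΦ j) x)
  have hmem {x : X} (hx : x ∈ u) : s x ∈ gaugeFixedForms o A g x := by
    intro w
    have hk (k) : oneFormBilin g x (s x) (Φ k x) = 0 := by
      have h2 (j) : ∑ i, (M x)⁻¹ i j * M x i k = if j = k then 1 else 0 := by
        have hT : (M x).transpose = M x := by
          ext i j
          exact oneFormBilin_comm g _ _
        have h3 := congrFun (congrFun (Matrix.mul_nonsing_inv (M x)
          (isUnit_iff_ne_zero.2 (hdet (hux hx)))) k) j
        rw [Matrix.mul_apply, Matrix.one_apply] at h3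
        simp only [eq_comm (a := j), ← h3]
        exact Finset.sum_congr rfl fun i _ ↦ by
          rw [mul_comm, ← congrFun (congrFun hT k) i, Matrix.transpose_apply]
      simp only [s, map_sub, map_sum, map_smul, LinearMap.sub_apply, LinearMap.sum_apply,
        LinearMap.smul_apply, smul_eq_mul, Finset.sum_mul]
      rw [Finset.sum_comm, sub_eq_zero]
      have h4 (j) : ∑ i, (M x)⁻¹ i j * oneFormInner (g.inner x) (a x) (Φ j x) *
          oneFormBilin g x (Φ i x) (Φ k x) =
          (if j = k then 1 else 0) * oneFormInner (g.inner x) (a x) (Φ j x) := by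
        rw [← h2, Finset.sum_mul]
        exact Finset.sum_congr rfl fun i _ ↦ by simp only [M, Matrix.of_apply]; ring
      simp only [h4]
      simp [oneFormBilin_apply]
    have hspan : w ∈ Submodule.span ℝ (Set.range fun i ↦ d i x) := by
      rw [(hux hx).span_eq_top_of_card_eq_finrank (by rw [finrank_tangentSpace, Fintype.card_fin])]
      trivial
    obtain ⟨c, rfl⟩ := (Submodule.mem_span_range_iff_exists_fun ℝ).1 hspan
    rw [← oneFormBilin_apply]
    simp only [map_sum, map_smul]
    exact Finset.sum_eq_zero fun k _ ↦ by
      rw [show oneFormBilin g x (s x) (curvature o A x (d k x)) = 0 from hk k, smul_zero]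
  obtain ⟨f, hf, hfu, -, -, h1⟩ := exists_cutoff (x₀ := x₀) hu
  refine ⟨fun x ↦ ⟨f x • s x, ?_⟩, smul_mem_smoothSections_of_tsupport hf isOpen_interior hfu hs,
    Subtype.ext ?_⟩
  · by_cases hx : x ∈ tsupport f
    · exact Submodule.smul_mem _ _ (hmem (hfu hx))
    · rw [image_eq_zero_of_notMem_tsupport hx, zero_smul]
      exact Submodule.zero_mem _
  · have h2 (j) : oneFormInner (g.inner x₀) (a x₀) (Φ j x₀) = 0 := by
      rw [hav]
      exact v.2 (d j x₀)
    change f x₀ • s x₀ = _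
    rw [h1.self_of_nhds, one_smul, ← hav]
    simp [s, h2]

lemma isSubbundleOfRank_gaugeFixedForms (hdef : IsDefinite o A) :
    IsSubbundleOfRank (R4 →L[ℝ] R3) (OneForm E) (gaugeFixedForms o A g) 8 :=
  fun x ↦ ⟨finrank_gaugeFixedForms g hdef x, exists_gaugeFixed_section g hdef x⟩

end GaugeFixed

/-! ### Coordinate frames and the Riemannian volume measure -/

section ChartFrame

variable {X : Type*} [TopologicalSpace X] [ChartedSpace R4 X] [IsManifold (𝓡 4) ∞ X]

/-- The coordinate vector fields `∂ᵢ` of the preferred chart at `x₀`, on the domain of the chart. -/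
def chartFrame (x₀ : X) (i : Fin 4) (x : X) : TangentSpace (𝓡 4) x :=
  tangentCoordChange (𝓡 4) x₀ x x (EuclideanSpace.single i (1 : ℝ))

lemma chartFrame_eq_symmL {x₀ x : X} (hx : x ∈ (chartAt R4 x₀).source) (i : Fin 4) :
    chartFrame x₀ i x = (trivializationAt R4 (TangentSpace (𝓡 4)) x₀).symmL ℝ x
      (EuclideanSpace.single i (1 : ℝ)) := by
  rw [TangentBundle.symmL_trivializationAt_eq_core hx]
  rfl

lemma chartFrame_eq_localFrame {x₀ x : X} (hx : x ∈ (chartAt R4 x₀).source) (i : Fin 4) :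
    chartFrame x₀ i x = (trivializationAt R4 (TangentSpace (𝓡 4) : X → Type _) x₀).localFrame
      (EuclideanSpace.basisFun (Fin 4) ℝ).toBasis i x := by
  rw [chartFrame_eq_symmL hx, Trivialization.localFrame_apply_of_mem_baseSet _ _ (by simpa using hx)]
  simp [Trivialization.basisAt]
  exact Trivialization.symmL_apply (R := ℝ) _ (by simpa using hx) _

lemma contMDiffOn_chartFrame (x₀ : X) (i : Fin 4) :
    ContMDiffOn (𝓡 4) ((𝓡 4).prod 𝓘(ℝ, R4)) ∞
      (fun x ↦ TotalSpace.mk' R4 x (chartFrame x₀ i x)) (chartAt R4 x₀).source := by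
  have h := (trivializationAt R4 (TangentSpace (𝓡 4) : X → Type _) x₀).contMDiffOn_localFrame_baseSet
    (I := 𝓡 4) ∞ (EuclideanSpace.basisFun (Fin 4) ℝ).toBasis i
  rw [TangentBundle.trivializationAt_baseSet] at h
  exact h.congr fun x hx ↦ by rw [chartFrame_eq_localFrame hx]

lemma linearIndependent_chartFrame {x₀ x : X} (hx : x ∈ (chartAt R4 x₀).source) :
    LinearIndependent ℝ (fun i ↦ chartFrame x₀ i x) := by
  simp only [chartFrame_eq_localFrame hx]
  exact ((trivializationAt R4 (TangentSpace (𝓡 4) : X → Type _) x₀).isLocalFrameOn_localFrame_baseSet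
    (𝓡 4) ∞ (EuclideanSpace.basisFun (Fin 4) ℝ).toBasis).linearIndependent (by simpa using hx)

lemma chartFrame_eq_sum {x₀ x₁ x : X} (hx : x ∈ (chartAt R4 x₀).source)
    (hx' : x ∈ (chartAt R4 x₁).source) (i : Fin 4) :
    chartFrame x₀ i x = ∑ j, tangentCoordChange (𝓡 4) x₀ x₁ x (EuclideanSpace.single i (1 : ℝ)) j •
      chartFrame x₁ j x := by
  have h := tangentCoordChange_comp (I := 𝓡 4) (w := x₀) (x := x₁) (y := x) (z := x)
    (v := EuclideanSpace.single i (1 : ℝ)) (by simp [hx, hx'])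
  rw [chartFrame, ← h]
  conv_lhs => rw [← (EuclideanSpace.basisFun (Fin 4) ℝ).sum_repr
    (tangentCoordChange (𝓡 4) x₀ x₁ x (EuclideanSpace.single i (1 : ℝ)))]
  rw [map_sum]
  refine Finset.sum_congr rfl fun j _ ↦ ?_
  rw [map_smul, EuclideanSpace.basisFun_apply, EuclideanSpace.basisFun_repr]
  rfl

lemma mfderiv_chart_symm_single {x₀ : X} {y : R4} (hy : y ∈ (chartAt R4 x₀).target) (i : Fin 4) :
    mfderiv 𝓘(ℝ, R4) (𝓡 4) (chartAt R4 x₀).symm y (EuclideanSpace.single i (1 : ℝ)) =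
      chartFrame x₀ i ((chartAt R4 x₀).symm y) := by
  have hx := (chartAt R4 x₀).map_target hy
  rw [chartFrame_eq_symmL hx, TangentBundle.symmL_trivializationAt hx]
  have h1 : extChartAt (𝓡 4) x₀ ((chartAt R4 x₀).symm y) = y := by
    simp [mfld_simps, hy]
  have h2 : ⇑(extChartAt (𝓡 4) x₀).symm = (chartAt R4 x₀).symm := by
    simp [mfld_simps]
  rw [h1, h2]
  simp [mfderivWithin_univ]
  rfl

lemma fderiv_comp_chart_symm {x₀ : X} {h : X → ℝ} {y : R4} (hy : y ∈ (chartAt R4 x₀).target)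
    (hh : MDifferentiableAt (𝓡 4) 𝓘(ℝ, ℝ) h ((chartAt R4 x₀).symm y)) (i : Fin 4) :
    fderiv ℝ (h ∘ (chartAt R4 x₀).symm) y (EuclideanSpace.single i (1 : ℝ)) =
      mvfderiv (𝓡 4) h ((chartAt R4 x₀).symm y) (chartFrame x₀ i ((chartAt R4 x₀).symm y)) := by
  have h1 : MDifferentiableAt 𝓘(ℝ, R4) (𝓡 4) (chartAt R4 x₀).symm y :=
    ((contMDiffOn_chart_symm (I := 𝓡 4) (n := ∞) y hy).contMDiffAt
      ((chartAt R4 x₀).open_target.mem_nhds hy)).mdifferentiableAt (by simp)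
  rw [← mfderiv_eq_fderiv, mfderiv_comp y hh h1, ← mfderiv_chart_symm_single hy]
  rfl

end ChartFrame

section Volume

variable {X : Type*} [TopologicalSpace X] [ChartedSpace R4 X] [IsManifold (𝓡 4) ∞ X]
  (g : ContMDiffRiemannianMetric (𝓡 4) ∞ R4 (TangentSpace (𝓡 4) : X → Type _))

/-- The density of the Riemannian volume with respect to the coordinates of the preferred chart
at `x₀`. -/
def chartDensity (x₀ x : X) : ℝ := Real.sqrt (gram (g.inner x) fun i ↦ chartFrame x₀ i x).det

lemma chartDensity_pos {x₀ x : X} (hx : x ∈ (chartAt R4 x₀).source) : 0 < chartDensity g x₀ x :=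
  Real.sqrt_pos.2 (det_gram_pos g x (linearIndependent_chartFrame hx))

lemma contMDiffOn_gram_chartFrame (x₀ : X) (i j : Fin 4) :
    ContMDiffOn (𝓡 4) 𝓘(ℝ, ℝ) ∞ (fun x ↦ gram (g.inner x) (fun i ↦ chartFrame x₀ i x) i j)
      (chartAt R4 x₀).source := by
  have h1 := ContMDiffOn.clm_bundle_apply (F₁ := R4) (E₁ := (TangentSpace (𝓡 4) : X → Type _))
    (F₂ := R4 →L[ℝ] ℝ) (E₂ := fun x ↦ TangentSpace (𝓡 4) x →L[ℝ] ℝ) (b := id) (ϕ := g.inner)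
    (g.contMDiff.contMDiffOn) (contMDiffOn_chartFrame x₀ i)
  have h2 := ContMDiffOn.clm_bundle_apply (F₁ := R4) (E₁ := (TangentSpace (𝓡 4) : X → Type _))
    (F₂ := ℝ) (E₂ := Bundle.Trivial X ℝ) (b := id) h1 (contMDiffOn_chartFrame x₀ j)
  intro x hx
  exact (contMDiffAt_section_trivial_iff.1 ((h2 x hx).contMDiffAt
    ((chartAt R4 x₀).open_source.mem_nhds hx))).contMDiffWithinAt

lemma contMDiffOn_chartDensity (x₀ : X) : ContMDiffOn (𝓡 4) 𝓘(ℝ, ℝ) ∞ (chartDensity g x₀)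
    (chartAt R4 x₀).source := by
  intro x hx
  refine ContMDiffAt.contMDiffWithinAt (contMDiffAt_sqrt (contMDiffAt_det fun i j ↦ ?_)
    (det_gram_pos g x (linearIndependent_chartFrame hx)).ne')
  exact (contMDiffOn_gram_chartFrame g x₀ i j x hx).contMDiffAt
    ((chartAt R4 x₀).open_source.mem_nhds hx)

lemma chartDensity_eq_abs_det_mul {x₀ x₁ x : X} (hx : x ∈ (chartAt R4 x₀).source)
    (hx' : x ∈ (chartAt R4 x₁).source) : chartDensity g x₀ x =
      |(tangentCoordChange (𝓡 4) x₀ x₁ x).det| * chartDensity g x₁ x := by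
  have hli := linearIndependent_chartFrame hx'
  let c := basisOfLinearIndependentOfCardEqFinrank hli (by
    rw [finrank_tangentSpace, Fintype.card_fin])
  have hc : ⇑c = fun i ↦ chartFrame x₁ i x := coe_basisOfLinearIndependentOfCardEqFinrank _ _
  have hM : (c.toMatrix fun i ↦ chartFrame x₀ i x) =
      LinearMap.toMatrix (EuclideanSpace.basisFun (Fin 4) ℝ).toBasis
        (EuclideanSpace.basisFun (Fin 4) ℝ).toBasis
        (tangentCoordChange (𝓡 4) x₀ x₁ x : R4 →ₗ[ℝ] R4) := by
    ext j i
    rw [Basis.toMatrix_apply, chartFrame_eq_sum hx hx', LinearMap.toMatrix_apply]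
    have h (k) : chartFrame x₁ k x = c k := by rw [hc]
    simp only [h, map_sum, map_smul, Basis.repr_self]
    simp [Finsupp.single_apply]
  rw [chartDensity, gram_eq_mul _ c, Matrix.det_mul, Matrix.det_mul, Matrix.det_transpose, hM,
    LinearMap.det_toMatrix, mul_right_comm, ← sq, Real.sqrt_mul (sq_nonneg _), Real.sqrt_sq_eq_abs,
    chartDensity, hc]

variable [MeasurableSpace X] [BorelSpace X]

lemma aemeasurable_chart_symm (x₀ : X) (f : R4 → ENNReal) :
    AEMeasurable (chartAt R4 x₀).symm ((volume.restrict (chartAt R4 x₀).target).withDensity f) :=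
  ((chartAt R4 x₀).continuousOn_symm.aemeasurable
    (chartAt R4 x₀).open_target.measurableSet).mono_ac (withDensity_absolutelyContinuous _ _)

lemma chartVolume_eq_map (x₀ : X) : chartVolume g x₀ = Measure.map (chartAt R4 x₀).symm
    ((volume.restrict (chartAt R4 x₀).target).withDensity fun y ↦
      ENNReal.ofReal (chartDensity g x₀ ((chartAt R4 x₀).symm y))) := by
  unfold chartVolume
  refine congrArg _ (withDensity_congr_ae ?_)
  filter_upwards [ae_restrict_mem (chartAt R4 x₀).open_target.measurableSet] with y hy
  simp only [chartDensity, mfderiv_chart_symm_single hy]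

lemma measurableSet_chart_target_inter (x₀ : X) {s : Set X} (hs : MeasurableSet s) :
    MeasurableSet ((chartAt R4 x₀).target ∩ (chartAt R4 x₀).symm ⁻¹' s) := by
  have h1 := (continuousOn_iff_continuous_domRestrict.1
    (chartAt R4 x₀).continuousOn_symm).measurable hs
  have h2 := (MeasurableEmbedding.subtype_coe
    (chartAt R4 x₀).open_target.measurableSet).measurableSet_image.2 h1
  convert h2 using 1
  ext y
  simp [and_comm]

lemma chartVolume_apply (x₀ : X) {s : Set X} (hs : MeasurableSet s) :
    chartVolume g x₀ s = ∫⁻ y in (chartAt R4 x₀).target ∩ (chartAt R4 x₀).symm ⁻¹' s,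
      ENNReal.ofReal (chartDensity g x₀ ((chartAt R4 x₀).symm y)) := by
  rw [chartVolume_eq_map, Measure.map_apply_of_aemeasurable (aemeasurable_chart_symm x₀ _) hs,
    withDensity_apply', Measure.restrict_restrict' (chartAt R4 x₀).open_target.measurableSet,
    inter_comm]

/-- The measures `chartVolume` agree on overlaps of charts, by the change of variables formula. -/
lemma chartVolume_inter_source_le (x₀ x₁ : X) {s : Set X} (hs : MeasurableSet s) :
    chartVolume g x₁ (s ∩ (chartAt R4 x₀).source) ≤ chartVolume g x₀ s := by
  set φ := chartAt R4 x₀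
  set ψ := chartAt R4 x₁
  have hT := measurableSet_chart_target_inter x₀ (hs.inter ψ.open_source.measurableSet)
  set T := φ.target ∩ φ.symm ⁻¹' (s ∩ ψ.source)
  have him : ψ.target ∩ ψ.symm ⁻¹' (s ∩ φ.source) = (fun y ↦ ψ (φ.symm y)) '' T := by
    ext z
    constructor
    · rintro ⟨hz, hzs, hzφ⟩
      refine ⟨φ (ψ.symm z), ⟨φ.map_source hzφ, ?_⟩, ?_⟩
      · rw [mem_preimage, φ.left_inv hzφ]
        exact ⟨hzs, ψ.map_target hz⟩
      · simp only [φ.left_inv hzφ, ψ.right_inv hz]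
    · rintro ⟨y, ⟨hy, hys, hyψ⟩, rfl⟩
      refine ⟨ψ.map_source hyψ, ?_⟩
      rw [mem_preimage, ψ.left_inv hyψ]
      exact ⟨hys, φ.map_target hy⟩
  have hinj : InjOn (fun y ↦ ψ (φ.symm y)) T := fun y hy z hz h ↦
    φ.symm.injOn hy.1 hz.1 (ψ.injOn hy.2.2 hz.2.2 h)
  have hder (y) (hy : y ∈ T) : HasFDerivWithinAt (fun y ↦ ψ (φ.symm y))
      (tangentCoordChange (𝓡 4) x₀ x₁ (φ.symm y)) T y := by
    have h := hasFDerivWithinAt_tangentCoordChange (I := 𝓡 4) (x := x₀) (y := x₁)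
      (z := φ.symm y) (by simpa using ⟨φ.map_target hy.1, hy.2.2⟩)
    have h1 : extChartAt (𝓡 4) x₀ (φ.symm y) = y := by
      simp [mfld_simps, φ, φ.right_inv hy.1]
    have h2 : extChartAt (𝓡 4) x₁ ∘ (extChartAt (𝓡 4) x₀).symm = fun y ↦ ψ (φ.symm y) := by
      funext y
      simp [mfld_simps, φ, ψ]
    rw [h1, h2] at h
    exact h.mono (by simp)
  rw [chartVolume_apply g x₁ (hs.inter φ.open_source.measurableSet), him,
    lintegral_image_eq_lintegral_abs_det_fderiv_mul _ hT hder hinj, chartVolume_apply g x₀ hs]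
  refine le_trans (le_of_eq (setLIntegral_congr_fun hT fun y hy ↦ ?_))
    (lintegral_mono_set (inter_subset_inter_right _ (preimage_mono inter_subset_left)))
  rw [chartDensity_eq_abs_det_mul g (φ.map_target hy.1) hy.2.2, ENNReal.ofReal_mul (abs_nonneg _)]
  rw [show (chartAt R4 x₁).symm (ψ (φ.symm y)) = φ.symm y from ψ.left_inv hy.2.2]

lemma chartVolume_source_compl (x₀ : X) : chartVolume g x₀ (chartAt R4 x₀).sourceᶜ = 0 := by
  rw [chartVolume_apply g x₀ (chartAt R4 x₀).open_source.measurableSet.compl]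
  have : (chartAt R4 x₀).target ∩ (chartAt R4 x₀).symm ⁻¹' (chartAt R4 x₀).sourceᶜ = ∅ := by
    ext y
    simpa using (chartAt R4 x₀).map_target
  rw [this, Measure.restrict_empty, lintegral_zero_measure]

lemma riemannianVolume_restrict (x₀ : X) :
    (riemannianVolume g).restrict (chartAt R4 x₀).source = chartVolume g x₀ := by
  have hU := (chartAt R4 x₀).open_source.measurableSet
  have hc : (chartVolume g x₀).restrict (chartAt R4 x₀).source = chartVolume g x₀ :=
    Measure.restrict_eq_self_of_ae_mem (mem_ae_iff.2 (chartVolume_source_compl g x₀))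
  refine le_antisymm ?_ ?_
  · -- an upper bound of all the measures `chartVolume g x₁` which is the right one on the chart
    have h : riemannianVolume g ≤
        chartVolume g x₀ + (riemannianVolume g).restrict (chartAt R4 x₀).sourceᶜ := by
      refine iSup_le fun x₁ ↦ Measure.le_iff.2 fun s hs ↦ ?_
      rw [← measure_inter_add_sdiff s hU, Measure.add_apply, Measure.restrict_apply hs]
      exact add_le_add (chartVolume_inter_source_le g x₀ x₁ hs)
        (le_iSup (chartVolume g) x₁ _)
    refine (Measure.restrict_mono_measure h _).trans ?_
    rw [Measure.restrict_add, Measure.restrict_restrict hU, inter_compl_self,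
      Measure.restrict_empty, add_zero, hc]
  · rw [← hc]
    exact Measure.restrict_mono_measure (le_iSup (chartVolume g) x₀) _

lemma riemannianVolume_apply {x₀ : X} {s : Set X} (hs : MeasurableSet s)
    (hsub : s ⊆ (chartAt R4 x₀).source) : riemannianVolume g s = chartVolume g x₀ s := by
  rw [← riemannianVolume_restrict, Measure.restrict_apply hs, inter_eq_left.2 hsub]

instance isOpenPosMeasure_riemannianVolume : (riemannianVolume g).IsOpenPosMeasure := by
  refine ⟨fun U hU hne h0 ↦ ?_⟩
  obtain ⟨x, hx⟩ := hne
  set φ := chartAt R4 x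
  have h1 : chartVolume g x (U ∩ φ.source) = 0 := by
    rw [← riemannianVolume_apply g (hU.inter φ.open_source).measurableSet inter_subset_right]
    exact measure_mono_null inter_subset_left h0
  have hT := φ.isOpen_inter_preimage_symm (hU.inter φ.open_source)
  rw [chartVolume_apply g x (hU.inter φ.open_source).measurableSet] at h1
  have hcont : ContinuousOn (fun y ↦ ENNReal.ofReal (chartDensity g x (φ.symm y)))
      (φ.target ∩ φ.symm ⁻¹' (U ∩ φ.source)) :=
    ENNReal.continuous_ofReal.comp_continuousOn ((contMDiffOn_chartDensity g x).continuousOn.comp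
      (φ.continuousOn_symm.mono inter_subset_left) fun y hy ↦ hy.2.2)
  rw [lintegral_eq_zero_iff' (hcont.aemeasurable hT.measurableSet), Filter.EventuallyEq,
    ae_restrict_iff' hT.measurableSet] at h1
  refine (hT.measure_pos volume ⟨φ x, φ.map_source (mem_chart_source R4 x), ?_⟩).ne' ?_
  · rw [mem_preimage, φ.left_inv (mem_chart_source R4 x)]
    exact ⟨hx, mem_chart_source R4 x⟩
  · refine measure_mono_null (fun y hy ↦ ?_) h1
    simpa using ⟨hy.1, hy.2.1, hy.2.2, chartDensity_pos g hy.2.2⟩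

/-- The volume is finite near each point, because the density is continuous. -/
instance isLocallyFiniteMeasure_riemannianVolume : IsLocallyFiniteMeasure (riemannianVolume g) := by
  refine ⟨fun x ↦ ?_⟩
  set φ := chartAt R4 x
  have hsrc : φ.source ∈ 𝓝 x := φ.open_source.mem_nhds (mem_chart_source R4 x)
  have h1 : ∀ᶠ z in 𝓝 x, chartDensity g x z < chartDensity g x x + 1 :=
    ((contMDiffOn_chartDensity g x).continuousOn.continuousAt hsrc).eventually_lt_const
      (lt_add_one _)
  have h2 : ∀ᶠ z in 𝓝 x, φ z ∈ Metric.ball (φ x) 1 :=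
    (φ.continuousAt (mem_chart_source R4 x)) (Metric.ball_mem_nhds _ one_pos)
  obtain ⟨N, hN, hNo, hxN⟩ := eventually_nhds_iff.1 ((h1.and h2).and hsrc)
  refine ⟨N, hNo.mem_nhds hxN, ?_⟩
  rw [riemannianVolume_apply g hNo.measurableSet fun z hz ↦ (hN z hz).2,
    chartVolume_apply g x hNo.measurableSet]
  have hT := (φ.isOpen_inter_preimage_symm hNo).measurableSet
  calc ∫⁻ y in φ.target ∩ φ.symm ⁻¹' N, ENNReal.ofReal (chartDensity g x (φ.symm y))
      ≤ ∫⁻ _ in φ.target ∩ φ.symm ⁻¹' N, ENNReal.ofReal (chartDensity g x x + 1) :=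
        setLIntegral_mono' hT fun y hy ↦ ENNReal.ofReal_le_ofReal (hN _ hy.2).1.1.le
    _ = ENNReal.ofReal (chartDensity g x x + 1) * volume (φ.target ∩ φ.symm ⁻¹' N) :=
        setLIntegral_const _ _
    _ < ⊤ := ENNReal.mul_lt_top ENNReal.ofReal_lt_top ((measure_mono fun y hy ↦ by
        simpa only [φ.right_inv hy.1] using (hN _ hy.2).1.2).trans_lt measure_ball_lt_top)

end Volume

/-! ### The divergence theorem in a chart -/

section Divergence

variable {X : Type*} [TopologicalSpace X] [ChartedSpace R4 X] [IsManifold (𝓡 4) ∞ X]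
  (g : ContMDiffRiemannianMetric (𝓡 4) ∞ R4 (TangentSpace (𝓡 4) : X → Type _))

/-- The integral of a partial derivative of a compactly supported function vanishes. -/
lemma integral_fderiv_apply_eq_zero {H : R4 → ℝ} (hH : ContDiff ℝ 1 H) (hc : HasCompactSupport H)
    (v : R4) : ∫ y, fderiv ℝ H y v = 0 := by
  have hd : Continuous fun y ↦ fderiv ℝ H y v := (hH.continuous_fderiv one_ne_zero).clm_apply
    continuous_const
  have h := integral_mul_fderiv_eq_neg_fderiv_mul_of_integrable (μ := volume) (𝕜 := ℝ)
    (f := fun _ : R4 ↦ (1 : ℝ)) (g := H) (v := v) (by simp)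
    (by simpa using hd.integrable_of_hasCompactSupport (hc.fderiv_apply ℝ v))
    (by simpa using hH.continuous.integrable_of_hasCompactSupport hc)
    (fun _ _ ↦ differentiableAt_const _) (fun _ _ ↦ hH.differentiable one_ne_zero _)
  simpa using h

lemma contMDiffAt_mvfderiv_chartFrame {h : X → ℝ} (hh : ContMDiff (𝓡 4) 𝓘(ℝ, ℝ) ∞ h) {x₀ x : X}
    (hx : x ∈ (chartAt R4 x₀).source) (i : Fin 4) :
    ContMDiffAt (𝓡 4) 𝓘(ℝ, ℝ) ∞ (fun x ↦ mvfderiv (𝓡 4) h x (chartFrame x₀ i x)) x :=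
  ((contMDiff_snd_tangentBundle_modelSpace ℝ 𝓘(ℝ, ℝ)).comp
    (hh.contMDiff_tangentMap (m := ∞) (by simp))).contMDiffAt.comp x
    ((contMDiffOn_chartFrame x₀ i x hx).contMDiffAt ((chartAt R4 x₀).open_source.mem_nhds hx))

lemma mvfderiv_eq_zero_of_notMem_tsupport {h : X → ℝ} {x : X} (hx : x ∉ tsupport h) :
    mvfderiv (𝓡 4) h x = 0 := by
  have h0 : h =ᶠ[𝓝 x] fun _ ↦ 0 := notMem_tsupport_iff_eventuallyEq.1 hx
  ext v
  rw [mvfderiv, h0.mfderiv_eq, mfderiv_const]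
  rfl

variable [MeasurableSpace X] [BorelSpace X]

lemma integral_riemannianVolume_eq {x₀ : X} {f : X → ℝ} (hf : Continuous f)
    (hsupp : tsupport f ⊆ (chartAt R4 x₀).source) :
    ∫ x, f x ∂(riemannianVolume g) = ∫ y in (chartAt R4 x₀).target,
      chartDensity g x₀ ((chartAt R4 x₀).symm y) * f ((chartAt R4 x₀).symm y) := by
  have hT := (chartAt R4 x₀).open_target.measurableSet
  have hcont : ContinuousOn (fun y ↦ ENNReal.ofReal (chartDensity g x₀ ((chartAt R4 x₀).symm y)))
      (chartAt R4 x₀).target :=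
    ENNReal.continuous_ofReal.comp_continuousOn ((contMDiffOn_chartDensity g x₀).continuousOn.comp
      (chartAt R4 x₀).continuousOn_symm fun y hy ↦ (chartAt R4 x₀).map_target hy)
  rw [← setIntegral_eq_integral_of_forall_compl_eq_zero (s := (chartAt R4 x₀).source) fun x hx ↦
      image_eq_zero_of_notMem_tsupport fun h ↦ hx (hsupp h),
    riemannianVolume_restrict, chartVolume_eq_map, integral_map (aemeasurable_chart_symm x₀ _)
      hf.aestronglyMeasurable,
    integral_withDensity_eq_integral_toReal_smul₀ (hcont.aemeasurable hT)
      (Filter.Eventually.of_forall fun _ ↦ ENNReal.ofReal_lt_top)]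
  refine setIntegral_congr_fun hT fun y hy ↦ ?_
  simp only [smul_eq_mul]
  rw [ENNReal.toReal_ofReal (chartDensity_pos g ((chartAt R4 x₀).map_target hy)).le]

lemma continuous_density_inv_mul_mvfderiv {x₀ : X} {h : X → ℝ}
    (hh : ContMDiff (𝓡 4) 𝓘(ℝ, ℝ) ∞ h) (hsupp : tsupport h ⊆ (chartAt R4 x₀).source) (i : Fin 4) :
    Continuous fun x ↦ (chartDensity g x₀ x)⁻¹ * mvfderiv (𝓡 4) h x (chartFrame x₀ i x) := by
  refine continuous_iff_continuousAt.2 fun x ↦ ?_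
  by_cases hx : x ∈ tsupport h
  · have hx' := hsupp hx
    have hd := ((contMDiffOn_chartDensity g x₀).continuousOn.continuousAt
      ((chartAt R4 x₀).open_source.mem_nhds hx')).inv₀ (chartDensity_pos g hx').ne'
    exact hd.mul (contMDiffAt_mvfderiv_chartFrame hh hx' i).continuousAt
  · refine (continuousAt_const (y := (0 : ℝ))).congr ?_
    filter_upwards [(isClosed_tsupport h).isOpen_compl.mem_nhds hx] with z hz
    rw [mvfderiv_eq_zero_of_notMem_tsupport hz]
    simp

/-- The divergence theorem for the vector field `h ∂ᵢ / √det g`. -/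
lemma integral_density_inv_mul_mvfderiv_eq_zero [T2Space X] {x₀ : X} {h : X → ℝ}
    (hh : ContMDiff (𝓡 4) 𝓘(ℝ, ℝ) ∞ h) (hc : HasCompactSupport h)
    (hsupp : tsupport h ⊆ (chartAt R4 x₀).source) (i : Fin 4) :
    ∫ x, (chartDensity g x₀ x)⁻¹ * mvfderiv (𝓡 4) h x (chartFrame x₀ i x)
      ∂(riemannianVolume g) = 0 := by
  set φ := chartAt R4 x₀
  have hts : tsupport (fun x ↦ (chartDensity g x₀ x)⁻¹ *
      mvfderiv (𝓡 4) h x (chartFrame x₀ i x)) ⊆ tsupport h := by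
    refine closure_minimal (fun x hx ↦ ?_) (isClosed_tsupport h)
    by_contra hxn
    exact hx (by simp [mvfderiv_eq_zero_of_notMem_tsupport hxn])
  let H : R4 → ℝ := φ.target.indicator (h ∘ φ.symm)
  have hHon {y} (hy : y ∈ φ.target) : H =ᶠ[𝓝 y] h ∘ φ.symm := by
    filter_upwards [φ.open_target.mem_nhds hy] with z hz using indicator_of_mem hz _
  have hK : IsCompact (φ '' tsupport h) := hc.isCompact.image_of_continuousOn
    (φ.continuousOn.mono hsupp)
  have hKt : φ '' tsupport h ⊆ φ.target := by
    rintro _ ⟨x, hx, rfl⟩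
    exact φ.map_source (hsupp hx)
  have hH0 {y} (hy : y ∉ φ '' tsupport h) : H y = 0 := by
    refine indicator_apply_eq_zero.2 fun hyt ↦
      image_eq_zero_of_notMem_tsupport (f := h) (x := φ.symm y) fun hmem ↦ hy ?_
    exact ⟨_, hmem, φ.right_inv hyt⟩
  have hHoff {y} (hy : y ∉ φ '' tsupport h) : H =ᶠ[𝓝 y] fun _ ↦ 0 := by
    filter_upwards [hK.isClosed.isOpen_compl.mem_nhds hy] with z hz using hH0 hz
  have hsm : ContDiff ℝ 1 H := by
    refine contDiff_iff_contDiffAt.2 fun y ↦ ?_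
    by_cases hy : y ∈ φ '' tsupport h
    · refine ContDiffAt.congr_of_eventuallyEq ?_ (hHon (hKt hy))
      have h1 : ContMDiffAt 𝓘(ℝ, R4) 𝓘(ℝ, ℝ) ∞ (h ∘ φ.symm) y := (hh _).comp y
        ((contMDiffOn_chart_symm (I := 𝓡 4) (n := ∞) y (hKt hy)).contMDiffAt
          (φ.open_target.mem_nhds (hKt hy)))
      exact h1.contDiffAt.of_le (by simp)
    · exact contDiffAt_const.congr_of_eventuallyEq (hHoff hy)
  have hz : ∫ y in φ.target, fderiv ℝ H y (EuclideanSpace.single i (1 : ℝ)) = 0 := by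
    rw [setIntegral_eq_integral_of_forall_compl_eq_zero fun y hy ↦ by
      rw [(hHoff fun h ↦ hy (hKt h)).fderiv_eq]; simp]
    exact integral_fderiv_apply_eq_zero hsm (HasCompactSupport.intro hK fun _ ↦ hH0) _
  rw [integral_riemannianVolume_eq g (continuous_density_inv_mul_mvfderiv g hh hsupp i)
    (hts.trans hsupp), ← hz]
  refine setIntegral_congr_fun φ.open_target.measurableSet fun y hy ↦ ?_
  have hpos := chartDensity_pos g (φ.map_target hy)
  rw [(hHon hy).fderiv_eq, fderiv_comp_chart_symm hy ((hh _).mdifferentiableAt (by simp)),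
    mul_inv_cancel_left₀ hpos.ne']

end Divergence

/-! ### The formal adjoint of the covariant derivative in a chart -/

section LocalAdjoint

variable {X : Type*} [TopologicalSpace X] [ChartedSpace R4 X] [IsManifold (𝓡 4) ∞ X]
  {E : X → Type*} [TopologicalSpace (TotalSpace R3 E)]
  [∀ x, NormedAddCommGroup (E x)] [∀ x, InnerProductSpace ℝ (E x)]
  [FiberBundle R3 E] [VectorBundle ℝ R3 E] [ContMDiffVectorBundle ∞ R3 E (𝓡 4)]
  [IsContMDiffRiemannianBundle (𝓡 4) ∞ R3 E]
  (g : ContMDiffRiemannianMetric (𝓡 4) ∞ R4 (TangentSpace (𝓡 4) : X → Type _))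

/-- The bilinear map `(u, v) ↦ α(u) a(v)` on `T_x X`. -/
def smulBilin {x : X} (α : TangentSpace (𝓡 4) x →L[ℝ] ℝ) (a : OneForm E x) :
    TangentSpace (𝓡 4) x →ₗ[ℝ] TangentSpace (𝓡 4) x →ₗ[ℝ] E x :=
  LinearMap.mk₂ ℝ (fun u v ↦ α u • a v) (by simp [add_smul]) (by simp [mul_smul])
    (by simp) (fun c u v ↦ by rw [map_smul, smul_comm])

/-- The metric contraction `T*_x X × (T*_x X ⊗ E_x) → E_x`; its negative is the principal symbol of
`d_A^*`. -/
def contraction (x : X) :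
    (TangentSpace (𝓡 4) x →L[ℝ] ℝ) →ₗ[ℝ] OneForm E x →ₗ[ℝ] E x :=
  LinearMap.mk₂ ℝ (fun α a ↦ ∑ i, ∑ j, (gram (g.inner x) (tangentBasis x))⁻¹ i j •
      smulBilin α a (tangentBasis x i) (tangentBasis x j))
    (by intros; simp [smulBilin, add_smul, Finset.sum_add_distrib])
    (fun c α a ↦ by
      simp only [smulBilin, LinearMap.mk₂_apply, _root_.smul_apply, Finset.smul_sum, smul_eq_mul]
      exact Finset.sum_congr rfl fun i _ ↦ Finset.sum_congr rfl fun j _ ↦ by module)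
    (by intros; simp [smulBilin, Finset.sum_add_distrib])
    (fun c α a ↦ by
      simp only [smulBilin, LinearMap.mk₂_apply, _root_.smul_apply, Finset.smul_sum]
      exact Finset.sum_congr rfl fun i _ ↦ Finset.sum_congr rfl fun j _ ↦ by module)

lemma contraction_eq_sum_gram_inv {x : X} {d : Fin 4 → TangentSpace (𝓡 4) x}
    (hd : LinearIndependent ℝ d) (α : TangentSpace (𝓡 4) x →L[ℝ] ℝ) (a : OneForm E x) :
    contraction g x α a = ∑ i, ∑ j, (gram (g.inner x) d)⁻¹ i j • α (d i) • a (d j) :=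
  (sum_gram_inv_of_linearIndependent g hd (smulBilin α a)).symm

lemma inner_contraction {x : X} (α : TangentSpace (𝓡 4) x →L[ℝ] ℝ) (a : OneForm E x) (ξ : E x) :
    inner ℝ (contraction g x α a) ξ = oneFormInner (g.inner x) a (α.smulRight ξ) := by
  obtain ⟨b, hb⟩ := exists_isOrthonormalFor g x
  rw [oneFormInner_eq hb]
  change inner ℝ (∑ i, ∑ j, (gram (g.inner x) (tangentBasis x))⁻¹ i j •
      smulBilin α a (tangentBasis x i) (tangentBasis x j)) ξ = _
  rw [sum_gram_inv hb, sum_inner]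
  refine Finset.sum_congr rfl fun k _ ↦ ?_
  rw [ContinuousLinearMap.smulRight_apply, real_inner_smul_right]
  exact real_inner_smul_left _ _ _

/-- The component `ρ √det g gⁱʲ a(∂ⱼ)` of the 1-form `ρ a`, for a cutoff function `ρ` supported in
the domain of the preferred chart at `x₀`. -/
def weightedComponent (x₀ : X) (ρ : X → ℝ) (a : Π x : X, OneForm E x) (i : Fin 4) (x : X) : E x :=
  (ρ x * chartDensity g x₀ x) •
    ∑ j, (gram (g.inner x) fun i ↦ chartFrame x₀ i x)⁻¹ i j • a x (chartFrame x₀ j x)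

lemma weightedComponent_mem {x₀ : X} {ρ : X → ℝ} (hρ : ContMDiff (𝓡 4) 𝓘(ℝ, ℝ) ∞ ρ)
    (hsupp : tsupport ρ ⊆ (chartAt R4 x₀).source) {a : Π x : X, OneForm E x} (ha : a ∈ OneForms E)
    (i : Fin 4) : weightedComponent g x₀ ρ a i ∈ smoothSections R3 E := by
  have h : ContMDiffOn (𝓡 4) ((𝓡 4).prod 𝓘(ℝ, R3)) ∞ (fun x ↦ TotalSpace.mk' R3 x
      (chartDensity g x₀ x • ∑ j, (gram (g.inner x) fun i ↦ chartFrame x₀ i x)⁻¹ i j •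
        a x (chartFrame x₀ j x))) (chartAt R4 x₀).source := by
    refine ContMDiffOn.smul_section (contMDiffOn_chartDensity g x₀)
      (ContMDiffOn.sum_section fun j _ ↦ ContMDiffOn.smul_section (fun x hx ↦ ?_) ?_)
    · exact (contMDiffAt_matrix_inv (fun i j ↦ (contMDiffOn_gram_chartFrame g x₀ i j x hx).contMDiffAt
        ((chartAt R4 x₀).open_source.mem_nhds hx))
        (det_gram_pos g x (linearIndependent_chartFrame hx)).ne' i j).contMDiffWithinAt
    · exact ContMDiffOn.clm_bundle_apply (F₁ := R4) (E₁ := (TangentSpace (𝓡 4) : X → Type _))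
        (F₂ := R3) (E₂ := E) (b := id) (ϕ := a) ha.contMDiffOn (contMDiffOn_chartFrame x₀ j)
  have h2 := smul_mem_smoothSections_of_tsupport hρ (chartAt R4 x₀).open_source hsupp h
  simp only [smul_smul] at h2
  exact h2

lemma weightedComponent_eq_zero {x₀ x : X} {ρ : X → ℝ} (hx : ρ x = 0)
    (a : Π x : X, OneForm E x) (i : Fin 4) : weightedComponent g x₀ ρ a i x = 0 := by
  rw [weightedComponent, hx, zero_mul, zero_smul]

variable (A : CovariantDerivative (𝓡 4) R3 E)

/-- The formal adjoint of `d_A`, applied to the 1-form `ρ a` and computed in the preferred chart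
at `x₀`. -/
def localAdjoint (x₀ : X) (ρ : X → ℝ) (a : Π x : X, OneForm E x) (x : X) : E x :=
  -(chartDensity g x₀ x)⁻¹ • ∑ i, A (weightedComponent g x₀ ρ a i) x (chartFrame x₀ i x)

lemma covDeriv_eq_zero {s : Π x, E x} {x : X} (h : ∀ᶠ y in 𝓝 x, s y = 0) : A s x = 0 := by
  rw [covDeriv_congr A (Submodule.zero_mem (smoothSections R3 E)) h]
  exact A.isCovariantDerivativeOnUniv.zero

lemma localAdjoint_eq_zero {x₀ x : X} {ρ : X → ℝ} (hx : x ∉ tsupport ρ)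
    (a : Π x : X, OneForm E x) : localAdjoint g A x₀ ρ a x = 0 := by
  rw [localAdjoint]
  have h (i) : A (weightedComponent g x₀ ρ a i) x = 0 := covDeriv_eq_zero A <| by
    filter_upwards [notMem_tsupport_iff_eventuallyEq.1 hx] with y hy
    exact weightedComponent_eq_zero g hy a i
  simp [h]

lemma localAdjoint_add {x₀ : X} {ρ : X → ℝ} (hρ : ContMDiff (𝓡 4) 𝓘(ℝ, ℝ) ∞ ρ)
    (hsupp : tsupport ρ ⊆ (chartAt R4 x₀).source) {a b : Π x : X, OneForm E x}
    (ha : a ∈ OneForms E) (hb : b ∈ OneForms E) (x : X) :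
    localAdjoint g A x₀ ρ (a + b) x = localAdjoint g A x₀ ρ a x + localAdjoint g A x₀ ρ b x := by
  have h (i) : weightedComponent g x₀ ρ (a + b) i = fun x ↦
      weightedComponent g x₀ ρ a i x + weightedComponent g x₀ ρ b i x := by
    funext x
    simp [weightedComponent, Finset.sum_add_distrib]
  simp only [localAdjoint, h, covDeriv_add A (weightedComponent_mem g hρ hsupp ha _)
    (weightedComponent_mem g hρ hsupp hb _), _root_.add_apply, Finset.sum_add_distrib, smul_add]

lemma localAdjoint_smul {x₀ : X} {ρ : X → ℝ} (hρ : ContMDiff (𝓡 4) 𝓘(ℝ, ℝ) ∞ ρ)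
    (hsupp : tsupport ρ ⊆ (chartAt R4 x₀).source) {a : Π x : X, OneForm E x} (ha : a ∈ OneForms E)
    {f : X → ℝ} (hf : ContMDiff (𝓡 4) 𝓘(ℝ, ℝ) ∞ f) (x : X) :
    localAdjoint g A x₀ ρ (fun x ↦ f x • a x) x =
      f x • localAdjoint g A x₀ ρ a x - ρ x • contraction g x (mvfderiv (𝓡 4) f x) (a x) := by
  have h (i) : weightedComponent g x₀ ρ (fun x ↦ f x • a x) i = fun x ↦
      f x • weightedComponent g x₀ ρ a i x := by
    funext x
    simp only [weightedComponent, _root_.smul_apply, Finset.smul_sum]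
    exact Finset.sum_congr rfl fun j _ ↦ by module
  have h2 : (chartDensity g x₀ x)⁻¹ • ∑ i, mvfderiv (𝓡 4) f x (chartFrame x₀ i x) •
      weightedComponent g x₀ ρ a i x = ρ x • contraction g x (mvfderiv (𝓡 4) f x) (a x) := by
    by_cases hx : x ∈ tsupport ρ
    · have hpos := chartDensity_pos g (hsupp hx)
      rw [contraction_eq_sum_gram_inv g (linearIndependent_chartFrame (hsupp hx))]
      simp only [weightedComponent, Finset.smul_sum, smul_smul]
      refine Finset.sum_congr rfl fun i _ ↦ Finset.sum_congr rfl fun j _ ↦ ?_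
      congr 1
      field_simp
    · have hx0 : ρ x = 0 := image_eq_zero_of_notMem_tsupport hx
      simp [weightedComponent_eq_zero g hx0, hx0]
  rw [← h2]
  simp only [localAdjoint, h, covDeriv_smul A hf (weightedComponent_mem g hρ hsupp ha _),
    Finset.sum_add_distrib, ← Finset.smul_sum]
  module

variable [A.ContMDiffCovariantDerivative ∞]

lemma localAdjoint_mem {x₀ : X} {ρ : X → ℝ} (hρ : ContMDiff (𝓡 4) 𝓘(ℝ, ℝ) ∞ ρ)
    (hsupp : tsupport ρ ⊆ (chartAt R4 x₀).source) {a : Π x : X, OneForm E x} (ha : a ∈ OneForms E) :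
    localAdjoint g A x₀ ρ a ∈ smoothSections R3 E := by
  intro x
  by_cases hx : x ∈ tsupport ρ
  · have hx' := hsupp hx
    have hU := (chartAt R4 x₀).open_source.mem_nhds hx'
    refine ContMDiffAt.smul_section (ContMDiffAt.neg (contMDiffAt_inv
      ((contMDiffOn_chartDensity g x₀ x hx').contMDiffAt hU) (chartDensity_pos g hx').ne'))
      (ContMDiffAt.sum_section fun i _ ↦ ?_)
    exact ContMDiffAt.clm_bundle_apply (F₁ := R4) (E₁ := (TangentSpace (𝓡 4) : X → Type _))
      (F₂ := R3) (E₂ := E) (b := id)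
      (covDeriv_mem A (weightedComponent_mem g hρ hsupp ha i) x)
      ((contMDiffOn_chartFrame x₀ i x hx').contMDiffAt hU)
  · refine (contMDiff_zeroSection ℝ E x).congr_of_eventuallyEq ?_
    filter_upwards [(isClosed_tsupport ρ).isOpen_compl.mem_nhds hx] with z hz
    rw [localAdjoint_eq_zero g A hz]
    rfl

variable [T2Space X] [MeasurableSpace X] [BorelSpace X]

/-- Integration by parts for the 1-form `ρ a`: the difference of the two integrands is the sum of
the functions `∂ᵢ⟨ξ, Wᵢ⟩ / √det g`, where `Wᵢ` is the component `weightedComponent` of `ρ a`. -/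
lemma integral_oneFormInner_eq_integral_localAdjoint (hmetric : A.IsMetricCompatible) {x₀ : X}
    {ρ : X → ℝ} (hρ : ContMDiff (𝓡 4) 𝓘(ℝ, ℝ) ∞ ρ)
    (hsupp : tsupport ρ ⊆ (chartAt R4 x₀).source) {a : Π x : X, OneForm E x} (ha : a ∈ OneForms E)
    {ξ : Π x, E x} (hξ : ξ ∈ smoothSections R3 E) (hc : IsCompact (closure {x | ξ x ≠ 0})) :
    ∫ x, ρ x * oneFormInner (g.inner x) (A ξ x) (a x) ∂(riemannianVolume g) =
      ∫ x, inner ℝ (ξ x) (localAdjoint g A x₀ ρ a x) ∂(riemannianVolume g) := by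
  set K := closure {x | ξ x ≠ 0}
  have hξ0 {x} (hx : x ∉ K) : ∀ᶠ y in 𝓝 x, ξ y = 0 := by
    filter_upwards [isClosed_closure.isOpen_compl.mem_nhds hx] with y hy
    by_contra h
    exact hy (subset_closure h)
  let W := weightedComponent g x₀ ρ a
  have hW (i) : W i ∈ smoothSections R3 E := weightedComponent_mem g hρ hsupp ha i
  let h (i : Fin 4) (x : X) : ℝ := inner ℝ (ξ x) (W i x)
  have hh (i) : ContMDiff (𝓡 4) 𝓘(ℝ, ℝ) ∞ (h i) := ContMDiff.inner_bundle hξ (hW i)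
  have hhc (i) : HasCompactSupport (h i) := HasCompactSupport.intro hc fun x hx ↦ by
    simp [h, (hξ0 hx).self_of_nhds]
  have hhs (i) : tsupport (h i) ⊆ tsupport ρ := closure_mono fun x hx h0 ↦ hx (by
    simp only [h, W]
    rw [weightedComponent_eq_zero g h0, inner_zero_right])
  have hpt (x : X) : ρ x * oneFormInner (g.inner x) (A ξ x) (a x) -
      inner ℝ (ξ x) (localAdjoint g A x₀ ρ a x) =
      ∑ i, (chartDensity g x₀ x)⁻¹ * mvfderiv (𝓡 4) (h i) x (chartFrame x₀ i x) := by
    by_cases hx : x ∈ tsupport ρ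
    · have hpos := chartDensity_pos g (hsupp hx)
      have h1 (i) : mvfderiv (𝓡 4) (h i) x (chartFrame x₀ i x) =
          inner ℝ (A ξ x (chartFrame x₀ i x)) (W i x) +
          inner ℝ (ξ x) (A (W i) x (chartFrame x₀ i x)) :=
        hmetric.mvfderiv_inner_eq (fun x ↦ chartFrame x₀ i x) (mdifferentiableAt_of_mem hξ x)
          (mdifferentiableAt_of_mem (hW i) x)
      have h2 (i) : (chartDensity g x₀ x)⁻¹ * inner ℝ (A ξ x (chartFrame x₀ i x)) (W i x) =
          ρ x * ∑ j, (gram (g.inner x) fun i ↦ chartFrame x₀ i x)⁻¹ i j *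
            inner ℝ (A ξ x (chartFrame x₀ i x)) (a x (chartFrame x₀ j x)) := by
        simp only [W, weightedComponent, real_inner_smul_right, inner_sum]
        field_simp
      simp only [h1, mul_add, Finset.sum_add_distrib, h2]
      rw [oneFormInner_eq_sum_gram_inv g (linearIndependent_chartFrame (hsupp hx)),
        ← Finset.mul_sum, localAdjoint, real_inner_smul_right, inner_sum, ← Finset.mul_sum]
      ring
    · have h0 (i) : mvfderiv (𝓡 4) (h i) x = 0 :=
        mvfderiv_eq_zero_of_notMem_tsupport fun hx' ↦ hx (hhs i hx')
      simp [h0, localAdjoint_eq_zero g A hx, image_eq_zero_of_notMem_tsupport hx]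
  have hF : Integrable (fun x ↦ ρ x * oneFormInner (g.inner x) (A ξ x) (a x))
      (riemannianVolume g) := by
    refine (hρ.continuous.mul (contMDiff_oneFormInner g (covDeriv_mem A hξ) ha).continuous
      ).integrable_of_hasCompactSupport (HasCompactSupport.intro hc fun x hx ↦ ?_)
    simp [covDeriv_eq_zero A (hξ0 hx), oneFormInner]
  have hG : Integrable (fun x ↦ inner ℝ (ξ x) (localAdjoint g A x₀ ρ a x))
      (riemannianVolume g) := by
    have hcont : ContMDiff (𝓡 4) 𝓘(ℝ, ℝ) ∞ fun x ↦ inner ℝ (ξ x) (localAdjoint g A x₀ ρ a x) :=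
      ContMDiff.inner_bundle hξ (localAdjoint_mem g A hρ hsupp ha)
    exact hcont.continuous.integrable_of_hasCompactSupport (HasCompactSupport.intro hc fun x hx ↦ by
      simp [(hξ0 hx).self_of_nhds])
  rw [← sub_eq_zero, ← integral_sub hF hG]
  simp only [hpt]
  rw [integral_finsetSum]
  · exact Finset.sum_eq_zero fun i _ ↦ integral_density_inv_mul_mvfderiv_eq_zero g (hh i) (hhc i)
      ((hhs i).trans hsupp) i
  · intro i _
    refine (continuous_density_inv_mul_mvfderiv g (hh i) ((hhs i).trans hsupp) i
      ).integrable_of_hasCompactSupport (HasCompactSupport.intro (hhc i) fun x hx ↦ ?_)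
    simp [mvfderiv_eq_zero_of_notMem_tsupport hx]

end LocalAdjoint

/-! ### The formal adjoint of the covariant derivative -/

section Adjoint

variable {X : Type*} [TopologicalSpace X] [ChartedSpace R4 X] [IsManifold (𝓡 4) ∞ X]
  {E : X → Type*} [TopologicalSpace (TotalSpace R3 E)]
  [∀ x, NormedAddCommGroup (E x)] [∀ x, InnerProductSpace ℝ (E x)]
  [FiberBundle R3 E] [VectorBundle ℝ R3 E] [ContMDiffVectorBundle ∞ R3 E (𝓡 4)]
  [IsContMDiffRiemannianBundle (𝓡 4) ∞ R3 E]
  (g : ContMDiffRiemannianMetric (𝓡 4) ∞ R4 (TangentSpace (𝓡 4) : X → Type _))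
  (A : CovariantDerivative (𝓡 4) R3 E)
  {ρ : SmoothPartitionOfUnity X (𝓡 4) X univ}

lemma support_localAdjoint_subset (a : Π x : X, OneForm E x) (x : X) :
    {i | localAdjoint g A i (ρ i) a x ≠ 0} ⊆ {i | x ∈ tsupport (ρ i)} := by
  intro i hi
  by_contra h
  exact hi (localAdjoint_eq_zero g A h a)

variable (ρ) in
lemma finite_mem_tsupport (x : X) : {i | x ∈ tsupport (ρ i)}.Finite :=
  ρ.locallyFinite.closure.point_finite x

variable [A.ContMDiffCovariantDerivative ∞]

/-- The formal adjoint `d_A^*`, patched together from the charts by the partition of unity `ρ`. -/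
def covDerivAdjoint (hρ : ρ.IsSubordinate fun x ↦ (chartAt R4 x).source) :
    OneForms E →ₗ[ℝ] smoothSections R3 E where
  toFun a := ⟨fun x ↦ ∑ᶠ i, localAdjoint g A i (ρ i) a x,
    ContMDiff.finsum_section_of_locallyFinite
      (ρ.locallyFinite.closure.subset fun i x hx ↦ by
        by_contra h
        exact hx (localAdjoint_eq_zero g A h _))
      fun i ↦ localAdjoint_mem g A (ρ i).contMDiff (hρ i) a.2⟩
  map_add' a b := by
    refine Subtype.ext (funext fun x ↦ ?_)
    change ∑ᶠ i, localAdjoint g A i (ρ i) ((a : Π x, OneForm E x) + b) x =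
      ∑ᶠ i, localAdjoint g A i (ρ i) a x + ∑ᶠ i, localAdjoint g A i (ρ i) b x
    rw [← finsum_add_distrib
      ((finite_mem_tsupport ρ x).subset (support_localAdjoint_subset g A a x))
      ((finite_mem_tsupport ρ x).subset (support_localAdjoint_subset g A b x))]
    exact finsum_congr fun i ↦ localAdjoint_add g A (ρ i).contMDiff (hρ i) a.2 b.2 x
  map_smul' c a := by
    refine Subtype.ext (funext fun x ↦ ?_)
    change ∑ᶠ i, localAdjoint g A i (ρ i) (fun x ↦ c • (a : Π x, OneForm E x) x) x =
      c • ∑ᶠ i, localAdjoint g A i (ρ i) a x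
    rw [smul_finsum]
    refine finsum_congr fun i ↦ ?_
    rw [localAdjoint_smul g A (ρ i).contMDiff (hρ i) a.2 contMDiff_const, mvfderiv_const]
    simp

lemma covDerivAdjoint_apply (hρ : ρ.IsSubordinate fun x ↦ (chartAt R4 x).source) (a : OneForms E)
    (x : X) : (covDerivAdjoint g A hρ a : Π x, E x) x = ∑ᶠ i, localAdjoint g A i (ρ i) a x := rfl

lemma covDerivAdjoint_symbol (hρ : ρ.IsSubordinate fun x ↦ (chartAt R4 x).source) {f : X → ℝ}
    (hf : ContMDiff (𝓡 4) 𝓘(ℝ, ℝ) ∞ f) {x : X} (hx : f x = 0) (a b : OneForms E)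
    (hab : ∀ y, (b : Π x, OneForm E x) y = f y • (a : Π x, OneForm E x) y) :
    (covDerivAdjoint g A hρ b : Π x, E x) x =
      -contraction g x (mvfderiv (𝓡 4) f x) ((a : Π x, OneForm E x) x) := by
  have hb : (b : Π x, OneForm E x) = fun y ↦ f y • (a : Π x, OneForm E x) y := funext hab
  have h (i) : localAdjoint g A i (ρ i) b x =
      ρ i x • -contraction g x (mvfderiv (𝓡 4) f x) ((a : Π x, OneForm E x) x) := by
    rw [hb, localAdjoint_smul g A (ρ i).contMDiff (hρ i) a.2 hf, hx, zero_smul, zero_sub, smul_neg]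
  rw [covDerivAdjoint_apply, finsum_congr h, ← finsum_smul, ρ.sum_eq_one (mem_univ x), one_smul]

variable [T2Space X] [MeasurableSpace X] [BorelSpace X]

lemma isL2Adjoint_covDerivAdjoint (hmetric : A.IsMetricCompatible)
    (hρ : ρ.IsSubordinate fun x ↦ (chartAt R4 x).source) :
    IsL2Adjoint A g (covDerivAdjoint g A hρ) := by
  intro a ξ hc
  set K := closure {x | (ξ : Π x, E x) x ≠ 0}
  have hξ0 {x} (hx : x ∉ K) : ∀ᶠ y in 𝓝 x, (ξ : Π x, E x) y = 0 := by
    filter_upwards [isClosed_closure.isOpen_compl.mem_nhds hx] with y hy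
    by_contra h
    exact hy (subset_closure h)
  -- only finitely many members of the partition of unity meet the support of `ξ`
  let S := (ρ.locallyFinite.closure.finite_nonempty_inter_compact hc).toFinset
  have hS {x} (hx : x ∈ K) {i} (hi : x ∈ tsupport (ρ i)) : i ∈ S :=
    (Set.Finite.mem_toFinset _).2 ⟨x, hi, hx⟩
  have h1 (x) : oneFormInner (g.inner x) (A (ξ : Π x, E x) x) ((a : Π x, OneForm E x) x) =
      ∑ i ∈ S, ρ i x *
        oneFormInner (g.inner x) (A (ξ : Π x, E x) x) ((a : Π x, OneForm E x) x) := by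
    by_cases hx : x ∈ K
    · have h := ρ.sum_eq_one (mem_univ x)
      rw [finsum_eq_sum_of_support_subset _ (s := S) fun i hi ↦ hS hx (subset_tsupport _ hi)] at h
      rw [← Finset.sum_mul, h, one_mul]
    · simp [covDeriv_eq_zero A (hξ0 hx), oneFormInner]
  have h2 (x) : inner ℝ ((ξ : Π x, E x) x) ((covDerivAdjoint g A hρ a : Π x, E x) x) =
      ∑ i ∈ S, inner ℝ ((ξ : Π x, E x) x) (localAdjoint g A i (ρ i) a x) := by
    by_cases hx : x ∈ K
    · rw [covDerivAdjoint_apply, finsum_eq_sum_of_support_subset _ (s := S) fun i hi ↦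
        hS hx (support_localAdjoint_subset g A a x hi), inner_sum]
    · simp [(hξ0 hx).self_of_nhds]
  rw [integral_congr_ae (Filter.Eventually.of_forall h1),
    integral_congr_ae (Filter.Eventually.of_forall h2), integral_finsetSum, integral_finsetSum]
  · exact Finset.sum_congr rfl fun i _ ↦ integral_oneFormInner_eq_integral_localAdjoint g A hmetric
      (ρ i).contMDiff (hρ i) a.2 ξ.2 hc
  · intro i _
    have hcont : ContMDiff (𝓡 4) 𝓘(ℝ, ℝ) ∞ fun x ↦
        inner ℝ ((ξ : Π x, E x) x) (localAdjoint g A i (ρ i) a x) :=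
      ContMDiff.inner_bundle ξ.2 (localAdjoint_mem g A (ρ i).contMDiff (hρ i) a.2)
    exact hcont.continuous.integrable_of_hasCompactSupport (HasCompactSupport.intro hc fun x hx ↦ by
      simp [(hξ0 hx).self_of_nhds])
  · intro i _
    refine ((ρ i).contMDiff.continuous.mul (contMDiff_oneFormInner g (covDeriv_mem A ξ.2)
      a.2).continuous).integrable_of_hasCompactSupport (HasCompactSupport.intro hc fun x hx ↦ ?_)
    simp [covDeriv_eq_zero A (hξ0 hx), oneFormInner]

/-- The adjoint is unique: otherwise test the difference `δ` of two adjoints against `χ δ`, for a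
cutoff function `χ`. -/
lemma IsL2Adjoint.unique {D D' : OneForms E →ₗ[ℝ] smoothSections R3 E} (hD : IsL2Adjoint A g D)
    (hD' : IsL2Adjoint A g D') : D = D' := by
  refine LinearMap.ext fun a ↦ Subtype.ext (funext fun x₀ ↦ ?_)
  by_contra hne
  let δ : smoothSections R3 E := D a - D' a
  have hδ0 : (δ : Π x, E x) x₀ ≠ 0 := sub_ne_zero.2 hne
  obtain ⟨χ, hχ, -, hχc, hχ0, hχ1⟩ := exists_cutoff (x₀ := x₀) Filter.univ_mem
  let ξ : smoothSections R3 E :=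
    ⟨fun x ↦ χ x • (δ : Π x, E x) x, smul_mem_smoothSections hχ δ.2⟩
  have hξ (x) : (ξ : Π x, E x) x = χ x • (δ : Π x, E x) x := rfl
  have hsub : closure {x | (ξ : Π x, E x) x ≠ 0} ⊆ tsupport χ := closure_mono fun x hx h0 ↦
    hx (by rw [hξ, h0, zero_smul])
  have hc : IsCompact (closure {x | (ξ : Π x, E x) x ≠ 0}) :=
    hχc.isCompact.of_isClosed_subset isClosed_closure hsub
  have hint (t : smoothSections R3 E) : Integrable
      (fun x ↦ inner ℝ ((ξ : Π x, E x) x) ((t : Π x, E x) x)) (riemannianVolume g) := by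
    have hcont : ContMDiff (𝓡 4) 𝓘(ℝ, ℝ) ∞ fun x ↦
        inner ℝ ((ξ : Π x, E x) x) ((t : Π x, E x) x) := ContMDiff.inner_bundle ξ.2 t.2
    refine hcont.continuous.integrable_of_hasCompactSupport (HasCompactSupport.intro hχc
      fun x hx ↦ ?_)
    rw [hξ, image_eq_zero_of_notMem_tsupport hx, zero_smul, inner_zero_left]
  have h0 : ∫ x, inner ℝ ((ξ : Π x, E x) x) ((δ : Π x, E x) x) ∂(riemannianVolume g) = 0 := by
    have h1 := (hD a ξ hc).symm.trans (hD' a ξ hc)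
    rw [← sub_eq_zero, ← integral_sub (hint _) (hint _)] at h1
    rw [← h1]
    refine integral_congr_ae (Filter.Eventually.of_forall fun x ↦ ?_)
    exact inner_sub_right _ _ _
  have hcont : ContMDiff (𝓡 4) 𝓘(ℝ, ℝ) ∞ fun x ↦
      inner ℝ ((ξ : Π x, E x) x) ((δ : Π x, E x) x) := ContMDiff.inner_bundle ξ.2 δ.2
  refine (hcont.continuous.integral_pos_of_hasCompactSupport_nonneg_nonzero
    (μ := riemannianVolume g) (HasCompactSupport.intro hχc fun x hx ↦ ?_) (fun x ↦ ?_)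
    (x := x₀) ?_).ne' h0
  · rw [hξ, image_eq_zero_of_notMem_tsupport hx, zero_smul, inner_zero_left]
  · rw [hξ, real_inner_smul_left]
    exact mul_nonneg (hχ0 x) real_inner_self_nonneg
  · rw [hξ, hχ1.self_of_nhds, one_smul]
    exact (real_inner_self_pos.2 hδ0).ne'

end Adjoint

/-! ### Ellipticity, and the form `Q(A)` as a section of `S²E` -/

section Ellipticity

variable {X : Type*} [TopologicalSpace X] [ChartedSpace R4 X] [IsManifold (𝓡 4) ∞ X] [T2Space X]
  {E : X → Type*} [TopologicalSpace (TotalSpace R3 E)]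
  [∀ x, NormedAddCommGroup (E x)] [∀ x, InnerProductSpace ℝ (E x)]
  [FiberBundle R3 E] [VectorBundle ℝ R3 E] [ContMDiffVectorBundle ∞ R3 E (𝓡 4)]
  [IsContMDiffRiemannianBundle (𝓡 4) ∞ R3 E]
  (g : ContMDiffRiemannianMetric (𝓡 4) ∞ R4 (TangentSpace (𝓡 4) : X → Type _))
  {o : FibreOrientation E} {A : CovariantDerivative (𝓡 4) R3 E}
  [A.ContMDiffCovariantDerivative ∞]

/-- The principal symbol of `D_A`. -/
def gaugeFixedSymbol (hdef : IsDefinite o A) (x : X) : (TangentSpace (𝓡 4) x →L[ℝ] ℝ) →ₗ[ℝ]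
    gaugeFixedForms o A g x →ₗ[ℝ] traceFreeSymForms E x × E x :=
  LinearMap.mk₂ ℝ (fun α v ↦ (linearisationSymbol hdef x α v, -contraction g x α v))
    (fun α β v ↦ by
      simp only [map_add, LinearMap.add_apply]
      exact Prod.ext rfl (neg_add _ _))
    (fun c α v ↦ by
      simp only [map_smul, LinearMap.smul_apply]
      exact Prod.ext rfl (smul_neg _ _).symm)
    (fun α v w ↦ by
      simp only [Submodule.coe_add, map_add]
      exact Prod.ext rfl (neg_add _ _))
    (fun c α v ↦ by
      simp only [Submodule.coe_smul, map_smul]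
      exact Prod.ext rfl (smul_neg _ _).symm)

/-- A form in `V_A` that is killed by the symbol of `δ_A Q` is `ι_u F_A + α ⊗ ξ`; it is orthogonal
to the first summand, and to the second if it is killed by the symbol of `d_A^*`. -/
lemma gaugeFixedSymbol_injective (hdef : IsDefinite o A) (x : X)
    {α : TangentSpace (𝓡 4) x →L[ℝ] ℝ} (hα : α ≠ 0) :
    Function.Injective (gaugeFixedSymbol g hdef x α) := by
  rw [injective_iff_map_eq_zero]
  rintro ⟨v, hv⟩ h
  have h1 : linearisationSymbol hdef x α v = 0 := congrArg Prod.fst h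
  have h2 : contraction g x α v = 0 := neg_eq_zero.1 (congrArg Prod.snd h)
  obtain ⟨⟨u, ξ⟩, rfl⟩ := (exact_gaugeSymbol_linearisationSymbol hdef x hα v).1 h1
  refine Subtype.ext ?_
  by_contra hne
  refine (oneFormBilin_self_pos g hne).ne' ?_
  have h3 := inner_contraction g α (gaugeSymbol o A x α (u, ξ)) ξ
  rw [h2, inner_zero_left] at h3
  have h4 := hv u
  rw [← oneFormBilin_apply] at h3 h4
  change oneFormBilin g x (gaugeSymbol o A x α (u, ξ)) (curvature o A x u + α.smulRight ξ) = 0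
  rw [map_add, h4, ← h3, add_zero]

lemma gaugeFixedSymbol_bijective (hdef : IsDefinite o A) (x : X)
    {α : TangentSpace (𝓡 4) x →L[ℝ] ℝ} (hα : α ≠ 0) :
    Function.Bijective (gaugeFixedSymbol g hdef x α) := by
  have := finiteDimensional_fibre (E := E) x
  have h5 := finrank_traceFreeSymForms hdef x
  have : FiniteDimensional ℝ (traceFreeSymForms E x) :=
    FiniteDimensional.of_finrank_pos (by omega)
  have hinj := gaugeFixedSymbol_injective g hdef x hα
  refine ⟨hinj, (LinearMap.injective_iff_surjective_of_finrank_eq_finrank ?_).1 hinj⟩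
  have h : finrank ℝ (traceFreeSymForms E x × E x) = 5 + 3 := by
    rw [← h5, ← finrank_fibre (E := E) x]
    exact finrank_prod
  rw [finrank_gaugeFixedForms g hdef, h]

lemma isElliptic_gaugeFixedOperator (hdef : IsDefinite o A)
    {ρ : SmoothPartitionOfUnity X (𝓡 4) X univ}
    (hρ : ρ.IsSubordinate fun x ↦ (chartAt R4 x).source) :
    IsElliptic (gaugeFixedOperator o A g (linearisation hdef) (covDerivAdjoint g A hρ)) := by
  refine ⟨gaugeFixedSymbol g hdef, fun x f hf hx s t hst ↦ ?_, fun x α hα ↦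
    gaugeFixedSymbol_bijective g hdef x hα⟩
  let a := inclSections (R4 →L[ℝ] R3) (OneForm E) (gaugeFixedForms o A g) s
  let b := inclSections (R4 →L[ℝ] R3) (OneForm E) (gaugeFixedForms o A g) t
  have hab (y) : (b : Π x, OneForm E x) y = f y • (a : Π x, OneForm E x) y :=
    congrArg Subtype.val (hst y)
  exact Prod.ext (hasPrincipalSymbol_linearisation hdef x f hf hx a b hab)
    (covDerivAdjoint_symbol g A hρ hf hx a b hab)

/-- `Q(A)` as a smooth section of `S²E`. -/
def QSection (hdef : IsDefinite o A) : SymSections E :=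
  ⟨fun x ↦ ⟨fibreBilin (QBilin o A x), fun e f ↦ by
      simp only [fibreBilin_apply, QBilin_apply, Q_comm o A x e f]⟩,
    fibreBilin_mem (B := fun x ↦ fibreBilin (QBilin o A x)) fun _ hs _ ht ↦ by
      simp only [fibreBilin_apply, QBilin_apply]
      exact contMDiff_Q hdef hs ht⟩

lemma QSection_apply (hdef : IsDefinite o A) (x : X) (e f : E x) :
    ((QSection hdef : Π x, symForms E x) x : FibreBilin E x) e f = Q o A x e f :=
  QBilin_apply o A x e f

variable {g} in
/-- The forms `F_A(e)` are self-dual, so that their wedge product is `(F_A(e), F_A(f)) μ_A`. -/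
lemma Q_eq_twoFormInner (hdef : IsDefinite o A) (hg : IsAssociatedMetric o A g) (x : X)
    (e f : E x) : Q o A x e f =
      twoFormInner (g.inner x) (curvatureForm o A x e) (curvatureForm o A x f) := by
  have hf : curvatureForm o A x f ∈ selfDualForms (g.inner x) (volumeForm o A x) :=
    (hg x).2 ▸ LinearMap.mem_range_self _ f
  rw [Q, hf.2 _ (curvatureForm_self A o e), mul_div_assoc,
    div_self (hdef.volumeForm_ne_zero x), mul_one]

end Ellipticity

end

end DefiniteConnection

open DefiniteConnection in
theorem mainTheorem2
    {X : Type*} [TopologicalSpace X] [T2Space X] [SigmaCompactSpace X]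
    [ChartedSpace R4 X] [IsManifold (𝓡 4) ∞ X] [MeasurableSpace X] [BorelSpace X]
    {E : X → Type*} [TopologicalSpace (TotalSpace R3 E)]
    [∀ x, NormedAddCommGroup (E x)] [∀ x, InnerProductSpace ℝ (E x)]
    [FiberBundle R3 E] [VectorBundle ℝ R3 E] [ContMDiffVectorBundle ∞ R3 E (𝓡 4)]
    [IsContMDiffRiemannianBundle (𝓡 4) ∞ R3 E]
    (o : FibreOrientation E)
    (A : CovariantDerivative (𝓡 4) R3 E) [A.ContMDiffCovariantDerivative ∞]
    (hmetric : A.IsMetricCompatible) (hdef : IsDefinite o A) :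
    ∃ g : ContMDiffRiemannianMetric (𝓡 4) ∞ R4 (TangentSpace (𝓡 4) : X → Type _),
      IsAssociatedMetric o A g ∧ (∀ g', IsAssociatedMetric o A g' → g' = g) ∧
      (∃ q : SymSections E, ∀ (x : X) (e f : E x),
        ((q : Π x, symForms E x) x : FibreBilin E x) e f = Q o A x e f ∧
        Q o A x e f =
          twoFormInner (g.inner x) (curvatureForm o A x e) (curvatureForm o A x f)) ∧
      (IsPerfect o A g ↔ ∀ (x : X) (e f : E x), Q o A x e f = inner ℝ e f) ∧
      ∃ dQ : OneForms E →ₗ[ℝ] TraceFreeSymSections E,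
        IsLinearisation o A dQ ∧
        (∃ σ : ∀ x : X, (TangentSpace (𝓡 4) x →L[ℝ] ℝ) →ₗ[ℝ]
            OneForm E x →ₗ[ℝ] traceFreeSymForms E x,
          HasPrincipalSymbol ((TraceFreeSymSections E).subtype ∘ₗ dQ) σ ∧
          ∀ (x : X) (α : TangentSpace (𝓡 4) x →L[ℝ] ℝ), α ≠ 0 →
            Function.Injective (gaugeSymbol o A x α) ∧
            Function.Exact (gaugeSymbol o A x α) (σ x α) ∧
            Function.Surjective (σ x α)) ∧
        IsSubbundleOfRank (R4 →L[ℝ] R3) (OneForm E) (gaugeFixedForms o A g) 8 ∧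
        ∃ dStar : OneForms E →ₗ[ℝ] smoothSections R3 E,
          IsL2Adjoint A g dStar ∧ (∀ dStar', IsL2Adjoint A g dStar' → dStar' = dStar) ∧
          IsElliptic (gaugeFixedOperator o A g dQ dStar) := by
  obtain ⟨ρ, hρ⟩ := SmoothPartitionOfUnity.exists_isSubordinate_chartAt_source (𝓡 4) X
  have hg := hdef.isAssociatedMetric_metric
  have hQ := Q_eq_twoFormInner hdef hg
  refine ⟨hdef.metric, hg, fun g' hg' ↦ hdef.eq_of_isAssociatedMetric hg' hg,
    ⟨QSection hdef, fun x e f ↦ ⟨QSection_apply hdef x e f, hQ x e f⟩⟩, ?_,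
    linearisation hdef, isLinearisation_linearisation hdef,
    ⟨linearisationSymbol hdef, hasPrincipalSymbol_linearisation hdef, fun x α hα ↦
      ⟨gaugeSymbol_injective hdef x hα, exact_gaugeSymbol_linearisationSymbol hdef x hα,
        linearisationSymbol_surjective hdef x hα⟩⟩,
    isSubbundleOfRank_gaugeFixedForms hdef.metric hdef,
    covDerivAdjoint hdef.metric A hρ, isL2Adjoint_covDerivAdjoint hdef.metric A hmetric hρ,
    fun D hD ↦ IsL2Adjoint.unique hdef.metric A hD
      (isL2Adjoint_covDerivAdjoint hdef.metric A hmetric hρ),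
    isElliptic_gaugeFixedOperator hdef.metric hdef hρ⟩
  simp only [IsPerfect, hQ]
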